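/- Let $G$ be a Carnot group, i.e. a connected, simply connected, nilpotent Lie group whose Lie algebra is graded, $\mathfrak g=\mathfrak g_1\oplus\dots\oplus\mathfrak g_d$, with $[\mathfrak g_1,\mathfrak g_j]=\mathfrak g_{j+1}$ for $1\le j\le d$ and $\mathfrak g_{d+1}=0$. Assume that $G$ is rationalizable, i.e. each $\mathfrak g_i$ has a basis such that the Lie bracket of any two elements of the union $\mathfrak X$ of these bases is a linear combination of elements of $\mathfrak X$ with rational coefficients. Let $k=\sum_{j=1}^d j\dim\mathfrak g_j$ be the homogeneous dimension of $G$. Fix an inner product on $\mathfrak g_1$ and let $d_{CC}$ be the corresponding Carnot–Carathéodory distance on $G$: $d_{CC}(g,h)$ is the infimum of $\int_0^1|\gamma'(t)|\,dt$ over all $C^1$ curves $\gamma:[0,1]\to G$ with $\gamma(0)=g$, $\gamma(1)=h$ and $\gamma'(t)\in\mathfrak g_1$ for each $t$, where tangent vectors of $G$ are identified with elements of $\mathfrak g$ by left translation. Then there exist a nonempty open set $U\subset G$, bounded with respect to $d_{CC}$, and a map $F:U\to\mathbf R^k$, Lipschitz with respect to $d_{CC}$ on $U$ and the Euclidean distance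 on $\mathbf R^k$, such that $F(U)$ has Hausdorff dimension exactly $k$. -/

import Mathlib

open scoped Manifold ContDiff ENNReal NNReal

noncomputable section

namespace Carnot

variable {n : ℕ} {G : Type*} [TopologicalSpace G] [ChartedSpace (EuclideanSpace ℝ (Fin n)) G]
  [Group G]

/-- `IsCarnot V d` says that the `n`-dimensional smooth Lie group `G` is a Carnot group of step at
most `d`, with grading `𝔤 = V 1 ⊕ ⋯ ⊕ V d` of its Lie algebra: `G` is connected, simply connected
and nilpotent, `[V 1, V j] = V (j + 1)` for `1 ≤ j ≤ d`, and `V (d + 1) = 0`. The layers are indexed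
by all natural numbers, the superfluous ones being zero. (`SimplyConnectedSpace` contains
path-connectedness.) -/
structure IsCarnot [LieGroup (𝓡 n) ∞ G] (V : ℕ → Submodule ℝ (GroupLieAlgebra (𝓡 n) G)) (d : ℕ) :
    Prop where
  simplyConnected : SimplyConnectedSpace G
  nilpotent : Group.IsNilpotent G
  zero_layer : V 0 = ⊥
  high_layer : ∀ j, d < j → V j = ⊥
  directSum : DirectSum.IsInternal V
  bracket : ∀ j, 1 ≤ j → j ≤ d →
    Submodule.span ℝ {z : GroupLieAlgebra (𝓡 n) G | ∃ x ∈ V 1, ∃ y ∈ V j, ⁅x, y⁆ = z} = V (j + 1)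

/-- Each layer has a basis such that the bracket of any two members of the union of
these bases is a linear combination of members of the union with rational coefficients. -/
def IsRationalizable (V : ℕ → Submodule ℝ (GroupLieAlgebra (𝓡 n) G)) (d : ℕ) : Prop :=
  ∃ X : ∀ i : ℕ, Module.Basis (Fin (Module.finrank ℝ (V i))) ℝ (V i),
    ∀ i ∈ Finset.Icc 1 d, ∀ j ∈ Finset.Icc 1 d,
    ∀ (l : Fin (Module.finrank ℝ (V i))) (m : Fin (Module.finrank ℝ (V j))),
      ∃ c : ∀ r : ℕ, Fin (Module.finrank ℝ (V r)) → ℚ,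
        ⁅(X i l : GroupLieAlgebra (𝓡 n) G), (X j m : GroupLieAlgebra (𝓡 n) G)⁆ =
          ∑ r ∈ Finset.Icc 1 d, ∑ s, (c r s : ℝ) • (X r s : GroupLieAlgebra (𝓡 n) G)

/-- The homogeneous dimension `∑ j, j * dim V j`. -/
def homogeneousDim (V : ℕ → Submodule ℝ (GroupLieAlgebra (𝓡 n) G)) (d : ℕ) : ℕ :=
  ∑ j ∈ Finset.Icc 1 d, j * Module.finrank ℝ (V j)

/-- `γ`, restricted to `[0, 1]`, is a `C¹` curve from `g` to `h` whose velocity at each time `t` is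
horizontal: it is the value at `γ t` of the left-invariant vector field with generator `u t` in the
horizontal layer `W`. For a `C¹` curve with horizontal velocities the function `u` exists, is unique
on `[0, 1]`, and is continuous there; conversely continuity of `u` makes `γ` a `C¹` curve. -/
structure IsHorizontalCurve (W : Submodule ℝ (GroupLieAlgebra (𝓡 n) G)) (g h : G)
    (γ : ℝ → G) (u : ℝ → W) : Prop where
  source : γ 0 = g
  target : γ 1 = h
  continuousOn : ContinuousOn u (Set.Icc 0 1)
  hasDeriv : ∀ t ∈ Set.Icc (0 : ℝ) 1,
    HasMFDerivWithinAt 𝓘(ℝ, ℝ) (𝓡 n) γ (Set.Icc 0 1) t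
      ((1 : ℝ →L[ℝ] ℝ).smulRight
        (mulInvariantVectorField (I := 𝓡 n) (u t : GroupLieAlgebra (𝓡 n) G) (γ t)))

/-- The Carnot-Carathéodory distance: the infimum of the lengths of the horizontal curves from `g`
to `h`, measured with the Euclidean metric `B` on the horizontal layer `W`. The infimum over the
empty family would be `∞`. -/
def ccEDist (W : Submodule ℝ (GroupLieAlgebra (𝓡 n) G)) (B : LinearMap.BilinForm ℝ W) (g h : G) :
    ℝ≥0∞ :=
  ⨅ (γ : ℝ → G) (u : ℝ → W) (_ : IsHorizontalCurve W g h γ u),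
    ∫⁻ t in Set.Icc (0 : ℝ) 1, ENNReal.ofReal (Real.sqrt (B (u t) (u t)))

end Carnot

end

/-!
The homogeneous dimension is the growth exponent of Carnot-Carathéodory balls, so a ball of radius
`ρ` contains about `(ρ / σ) ^ k` points at mutual distance `σ`. This is enough to place inside `G` a
Cantor set which admits a Lipschitz map onto a set of dimension `k`: no regularity of the map has to
be extracted from the group, because Lipschitz functions extend from subsets
(`exists_lipschitzWith_extension`).

*The Cantor set* (`exists_separated_products`). At level `m` choose `2 ^ ((m + 1) k)` points in the
ball of radius about `R m` around the identity, at mutual distance at least `8 R (m + 1)`, where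
`R (m + 1) = κ R m / 2 ^ (m + 1)` for a fixed small `κ = 2 ^ -K`; this is possible by the growth of
balls. Label them by vectors of `k` digits less than `2 ^ (m + 1)`. By left invariance the infinite
products of such points, one from each level, form a Cantor set parametrised by sequences of
digits: two products whose digits first differ at level `m` have distance at least a multiple of
`R (m + 1)`. Send a product with digits `x m` to `∑ R (m + 1) x m / 2 ^ (m + 1)` in `ℝ ^ k`. Two
images whose digits agree below level `m` differ by at most `2 R (m + 1)`, so the map is Lipschitz.
Its image has dimension `k` (`dimH_range_digitSum`): replacing each image by the mixed radix
expansion with the same digits gives a map whose range contains the half-open unit cube. Since the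
number of digits grows from level to level, the factors `κ ^ m` are negligible, and that map is
Hölder with every exponent less than one (`exists_digitSum_holder`).

*The growth of balls* (`IsLogBox.exists_separated`). Near the identity use coordinates of the second
kind `y ↦ ∏ exp (y i • b i)` for a basis `b` adapted to the grading, and the weighted boxes
`|y i| ≤ r ^ w i`. The dilations of the Lie algebra respect the bracket, hence intertwine the
adjoint actions of `exp (t • b i)` and `exp (r ^ w i * t • b i)`, so the Maurer-Cartan form is
homogeneous in these coordinates (`IsGradedBasis.map_curveProdVel`). Thus dilating a horizontal
curve near the identity multiplies its length, and a horizontal curve of length `s` cannot leave the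
box of size proportional to `s`. Together with Chow's theorem (`eventually_reach`) this shows that
small balls and boxes are comparable (`IsLogBox.exists_ballBox`), and a volume count gives the
separated sets. Only this local homogeneity is needed; no dilations of the whole group and no
Baker-Campbell-Hausdorff formula are used.

Curves in the group are handled through their left velocity in the chart at the identity
(`HasLeftVel`), so that Mathlib's calculus in normed spaces applies; `lie_eq_ad` connects the
resulting bilinear map `ad` with the Lie bracket of left-invariant vector fields.
-/

noncomputable section

open scoped Topology
open Filter Set

set_option maxSynthPendingDepth 3

namespace Carnot

/-- The Euclidean space on which the group is modelled. -/
abbrev Model (n : ℕ) : Type := EuclideanSpace ℝ (Fin n)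

/-! ### The chart at the identity -/

section Chart

variable {n : ℕ} {G : Type*} [TopologicalSpace G] [ChartedSpace (Model n) G] [Group G]

variable (n) in
/-- The preferred chart at the identity. -/
def chart (g : G) : Model n := extChartAt (𝓡 n) (1 : G) g

/-- The inverse of the preferred chart at the identity. -/
def unchart (x : Model n) : G := (extChartAt (𝓡 n) (1 : G)).symm x

variable (n G) in
/-- The coordinates of the identity. -/
def origin : Model n := chart n (1 : G)

@[simp] lemma unchart_origin : unchart (origin n G) = (1 : G) :=
  extChartAt_to_inv (I := 𝓡 n) (1 : G)

lemma eventually_unchart_chart : ∀ᶠ g in 𝓝 (1 : G), unchart (chart n g) = g := by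
  filter_upwards [extChartAt_source_mem_nhds (I := 𝓡 n) (1 : G)] with g hg
  exact (extChartAt (𝓡 n) (1 : G)).left_inv hg

lemma eventually_chart_unchart : ∀ᶠ x in 𝓝 (origin n G), chart n (unchart x : G) = x := by
  filter_upwards [extChartAt_target_mem_nhds (I := 𝓡 n) (1 : G)] with x hx
  exact (extChartAt (𝓡 n) (1 : G)).right_inv hx

lemma continuousAt_chart : ContinuousAt (chart n) (1 : G) :=
  continuousAt_extChartAt (I := 𝓡 n) (1 : G)

lemma tendsto_chart : Tendsto (chart n) (𝓝 (1 : G)) (𝓝 (origin n G)) := continuousAt_chart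

lemma contMDiffAt_chart : ContMDiffAt (𝓡 n) 𝓘(ℝ, Model n) ∞ (chart n) (1 : G) :=
  contMDiffAt_extChartAt

lemma contDiffAt_chart_comp {F : Type*} [NormedAddCommGroup F] [NormedSpace ℝ F] {m : ℕ∞ω}
    (hm : m ≤ (∞ : ℕ∞ω)) {f : F → G} {p : F} (hf : ContMDiffAt 𝓘(ℝ, F) (𝓡 n) m f p) (h1 : f p = 1) :
    ContDiffAt ℝ m (fun x => chart n (f x)) p := by
  rw [← contMDiffAt_iff_contDiffAt]
  have h := (contMDiffAt_chart (n := n) (G := G)).of_le hm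
  rw [← h1] at h
  exact h.comp p hf

variable [LieGroup (𝓡 n) ∞ G]

lemma contMDiffAt_unchart :
    ContMDiffAt 𝓘(ℝ, Model n) (𝓡 n) ∞ (unchart : Model n → G) (origin n G) :=
  (contMDiffOn_extChartAt_symm (I := 𝓡 n) (1 : G)).contMDiffAt
    (extChartAt_target_mem_nhds (I := 𝓡 n) (1 : G))

lemma contMDiff_mul_left' (g : G) : ContMDiff (𝓡 n) (𝓡 n) ∞ (fun x : G => g * x) :=
  contMDiff_mul_left

end Chart

/-! ### Left velocities of curves -/

section LeftVelocity

variable {n : ℕ} {G : Type*} [TopologicalSpace G] [ChartedSpace (Model n) G] [Group G]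

/-- `HasLeftVel c S t u` says that the curve `c` in the group, restricted to `S`, is differentiable
at `t` and that `u` is its velocity there, moved to the identity by left translation and read in the
chart at the identity. -/
def HasLeftVel (c : ℝ → G) (S : Set ℝ) (t : ℝ) (u : Model n) : Prop :=
  ContinuousWithinAt c S t ∧ HasDerivWithinAt (fun τ => chart n ((c t)⁻¹ * c τ)) u S t

lemma HasLeftVel.mono {c : ℝ → G} {S T : Set ℝ} {t : ℝ} {u : Model n} (h : HasLeftVel c S t u)
    (hT : T ⊆ S) : HasLeftVel c T t u :=
  ⟨h.1.mono hT, h.2.mono hT⟩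

lemma HasLeftVel.unique {c : ℝ → G} {S : Set ℝ} {t : ℝ} {u v : Model n} (h : HasLeftVel c S t u)
    (h' : HasLeftVel c S t v) (hS : UniqueDiffWithinAt ℝ S t) : u = v :=
  hS.eq_deriv _ h.2 h'.2

lemma HasLeftVel.congr {c c' : ℝ → G} {S : Set ℝ} {t : ℝ} {u : Model n} (h : HasLeftVel c S t u)
    (hc : ∀ τ ∈ S, c' τ = c τ) (ht : t ∈ S) : HasLeftVel c' S t u := by
  refine ⟨h.1.congr hc (hc t ht), h.2.congr (fun τ hτ => ?_) ?_⟩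
  · rw [hc τ hτ, hc t ht]
  · rw [hc t ht]

lemma HasLeftVel.union {c : ℝ → G} {S T : Set ℝ} {t : ℝ} {u : Model n} (h : HasLeftVel c S t u)
    (h' : HasLeftVel c T t u) : HasLeftVel c (S ∪ T) t u :=
  ⟨h.1.union h'.1, h.2.union h'.2⟩

lemma HasLeftVel.comp {c : ℝ → G} {S T : Set ℝ} {t : ℝ} {u : Model n} {f : ℝ → ℝ} {f' : ℝ}
    (h : HasLeftVel c S (f t) u) (hf : HasDerivWithinAt f f' T t) (hT : MapsTo f T S) :
    HasLeftVel (fun τ => c (f τ)) T t (f' • u) :=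
  ⟨h.1.comp hf.continuousWithinAt hT, h.2.scomp t hf hT⟩

/-- Curves with constant value. -/
lemma hasLeftVel_const (g : G) (S : Set ℝ) (t : ℝ) :
    HasLeftVel (fun _ => g) S t (0 : Model n) :=
  ⟨continuousWithinAt_const, hasDerivWithinAt_const _ _ _⟩

lemma mulInvariantVectorField_one (u : GroupLieAlgebra (𝓡 n) G) :
    mulInvariantVectorField (I := 𝓡 n) u (1 : G) = u := by
  have h : (fun x : G => 1 * x) = id := by funext x; simp
  have h2 : mfderiv (𝓡 n) (𝓡 n) (fun x : G => 1 * x) 1 = ContinuousLinearMap.id ℝ _ := by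
    rw [h]; exact mfderiv_id
  exact DFunLike.congr_fun h2 u

lemma hasMFDerivWithinAt_iff_hasLeftVel_of_eq_one {c : ℝ → G} {S : Set ℝ} {t : ℝ}
    (ht : c t = 1) (u : Model n) :
    HasMFDerivWithinAt 𝓘(ℝ, ℝ) (𝓡 n) c S t ((1 : ℝ →L[ℝ] ℝ).smulRight u) ↔
      HasLeftVel c S t u := by
  have key : HasFDerivWithinAt (writtenInExtChartAt 𝓘(ℝ, ℝ) (𝓡 n) t c)
      ((1 : ℝ →L[ℝ] ℝ).smulRight u)
      ((extChartAt 𝓘(ℝ, ℝ) t).symm ⁻¹' S ∩ range 𝓘(ℝ, ℝ)) (extChartAt 𝓘(ℝ, ℝ) t t) ↔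
      HasDerivWithinAt (fun τ ↦ chart n ((c t)⁻¹ * c τ)) u S t := by
    simp only [writtenInExtChartAt, ht, hasDerivWithinAt_iff_hasFDerivWithinAt]
    simp [chart, Function.comp_def, chartAt_self_eq,
      ContinuousLinearMap.smulRight_one_eq_toSpanSingleton]
  exact and_congr Iff.rfl key

variable [LieGroup (𝓡 n) ∞ G]

lemma HasLeftVel.const_mul {c : ℝ → G} {S : Set ℝ} {t : ℝ} {u : Model n} (h : HasLeftVel c S t u)
    (g : G) : HasLeftVel (fun τ => g * c τ) S t u := by
  have : IsTopologicalGroup G := topologicalGroup_of_lieGroup (𝓡 n) ∞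
  refine ⟨continuousWithinAt_const.mul h.1, ?_⟩
  have : (fun τ => chart n ((g * c t)⁻¹ * (g * c τ))) = fun τ => chart n ((c t)⁻¹ * c τ) := by
    funext τ; congr 1; group
  rw [this]; exact h.2

lemma hasMFDerivWithinAt_mul_left {c : ℝ → G} {S : Set ℝ} {t : ℝ} (u : GroupLieAlgebra (𝓡 n) G)
    {a : G} (g : G) (ha : c t = a)
    (h : HasMFDerivWithinAt 𝓘(ℝ, ℝ) (𝓡 n) c S t ((1 : ℝ →L[ℝ] ℝ).smulRight
        (mulInvariantVectorField (I := 𝓡 n) u a))) :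
    HasMFDerivWithinAt 𝓘(ℝ, ℝ) (𝓡 n) (fun τ => g * c τ) S t ((1 : ℝ →L[ℝ] ℝ).smulRight
        (mulInvariantVectorField (I := 𝓡 n) u (g * a))) := by
  subst ha
  have hg : MDifferentiableAt (𝓡 n) (𝓡 n) (fun x : G => g * x) (c t) :=
    (contMDiff_mul_left' g).mdifferentiableAt (by simp)
  have hc : MDifferentiableAt (𝓡 n) (𝓡 n) (fun x : G => c t * x) 1 :=
    (contMDiff_mul_left' (c t)).mdifferentiableAt (by simp)
  have h1 := hg.hasMFDerivAt.comp_hasMFDerivWithinAt t h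
  refine h1.congr_mfderiv ?_
  ext
  have hcomp : (fun x : G => g * c t * x) = (fun x : G => g * x) ∘ (fun x : G => c t * x) := by
    funext x; simp [mul_assoc]
  have hg' : MDifferentiableAt (𝓡 n) (𝓡 n) (fun x : G => g * x) (c t * 1) := by
    rw [mul_one]; exact hg
  have key : mfderiv (𝓡 n) (𝓡 n) (fun x : G => g * c t * x) 1 =
      (mfderiv (𝓡 n) (𝓡 n) (fun x : G => g * x) (c t * 1)).comp
        (mfderiv (𝓡 n) (𝓡 n) (fun x : G => c t * x) 1) := by
    rw [hcomp]; exact mfderiv_comp (I' := 𝓡 n) 1 hg' hc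
  have key2 : mfderiv (𝓡 n) (𝓡 n) (fun x : G => g * x) (c t * 1) =
      mfderiv (𝓡 n) (𝓡 n) (fun x : G => g * x) (c t) := by
    rw [mul_one]
  rw [key2] at key
  have := DFunLike.congr_fun key u
  have h3 : ∀ (L : Model n →L[ℝ] Model n) (v w : Model n), w = L v →
      (L ∘SL ContinuousLinearMap.smulRight (1 : ℝ →L[ℝ] ℝ) v) 1 =
        (ContinuousLinearMap.smulRight (1 : ℝ →L[ℝ] ℝ) w) 1 := by
    intro L v w hw; simp [hw]
  exact h3 _ _ _ this

/-- The differential of a curve is the left-invariant vector field with generator `u` exactly when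
the left velocity of the curve is `u`. -/
lemma hasMFDerivWithinAt_iff_hasLeftVel {c : ℝ → G} {S : Set ℝ} {t : ℝ}
    (u : GroupLieAlgebra (𝓡 n) G) :
    HasMFDerivWithinAt 𝓘(ℝ, ℝ) (𝓡 n) c S t ((1 : ℝ →L[ℝ] ℝ).smulRight
        (mulInvariantVectorField (I := 𝓡 n) u (c t))) ↔
      HasLeftVel c S t (u : Model n) := by
  have key : ∀ {c : ℝ → G} {a : G}, c t = a → a = 1 →
      (HasMFDerivWithinAt 𝓘(ℝ, ℝ) (𝓡 n) c S t ((1 : ℝ →L[ℝ] ℝ).smulRight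
        (mulInvariantVectorField (I := 𝓡 n) u a)) ↔ HasLeftVel c S t (u : Model n)) := by
    intro c a hc ha
    subst ha
    rw [mulInvariantVectorField_one]
    exact hasMFDerivWithinAt_iff_hasLeftVel_of_eq_one hc _
  constructor
  · intro h
    have h1 := hasMFDerivWithinAt_mul_left u (c t)⁻¹ rfl h
    have h2 := ((key (by simp) (by simp)).1 h1).const_mul (c t)
    simpa using h2
  · intro h
    have h1 := (key (c := fun τ => (c t)⁻¹ * c τ) (by simp) rfl).2
      (by simpa using h.const_mul (c t)⁻¹)
    have h2 := hasMFDerivWithinAt_mul_left u (c t) (by simp) h1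
    have h3 : ∀ {c₁ c₂ : ℝ → G} {a b : G}, c₁ = c₂ → a = b →
        HasMFDerivWithinAt 𝓘(ℝ, ℝ) (𝓡 n) c₁ S t ((1 : ℝ →L[ℝ] ℝ).smulRight
          (mulInvariantVectorField (I := 𝓡 n) u a)) →
        HasMFDerivWithinAt 𝓘(ℝ, ℝ) (𝓡 n) c₂ S t ((1 : ℝ →L[ℝ] ℝ).smulRight
          (mulInvariantVectorField (I := 𝓡 n) u b)) := by
      rintro c₁ c₂ a b rfl rfl h; exact h
    exact h3 (by funext τ; group) (mul_one _) h2

end LeftVelocity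

/-! ### The adjoint action in the chart -/

section Adjoint

variable {n : ℕ} {G : Type*} [TopologicalSpace G] [ChartedSpace (Model n) G] [Group G]

/-- A differentiable function of two variables has the differential given by its partial
derivatives. -/
lemma hasFDerivAt_prod_of_partial {E F H : Type*} [NormedAddCommGroup E] [NormedSpace ℝ E]
    [NormedAddCommGroup F] [NormedSpace ℝ F] [NormedAddCommGroup H] [NormedSpace ℝ H]
    {f : E × F → H} {a : E} {b : F} {A : E →L[ℝ] H} {B : F →L[ℝ] H}
    (hf : DifferentiableAt ℝ f (a, b)) (hA : HasFDerivAt (fun x => f (x, b)) A a)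
    (hB : HasFDerivAt (fun y => f (a, y)) B b) : HasFDerivAt f (A.coprod B) (a, b) := by
  have h1 : HasFDerivAt (fun x : E => f (x, b)) ((fderiv ℝ f (a, b)).comp (.inl ℝ E F)) a :=
    hf.hasFDerivAt.comp a (hasFDerivAt_prodMk_left a b)
  have h2 : HasFDerivAt (fun y : F => f (a, y)) ((fderiv ℝ f (a, b)).comp (.inr ℝ E F)) b :=
    hf.hasFDerivAt.comp b (hasFDerivAt_prodMk_right a b)
  have h3 : A.coprod B = fderiv ℝ f (a, b) := by
    rw [hA.unique h1, hB.unique h2]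
    ext <;> simp
  rw [h3]
  exact hf.hasFDerivAt

/-- The adjoint action of the group on the model space, identified with the Lie algebra: the
derivative at the identity of conjugation by `g`, read in the chart. -/
def Ad (g : G) : Model n →L[ℝ] Model n :=
  fderiv ℝ (fun x => chart n (g * unchart x * g⁻¹)) (origin n G)

@[simp] lemma Ad_one : Ad (1 : G) = ContinuousLinearMap.id ℝ (Model n) := by
  have h : (fun x => chart n ((1 : G) * unchart x * 1⁻¹)) =ᶠ[𝓝 (origin n G)] id := by
    filter_upwards [eventually_chart_unchart (n := n) (G := G)] with x hx
    simpa using hx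
  rw [Ad, h.fderiv_eq, fderiv_id]

lemma tendsto_prod_origin : Tendsto (fun x : Model n => (x, origin n G)) (𝓝 (origin n G))
    (𝓝 (origin n G, origin n G)) := by
  have h : Continuous (fun x : Model n => (x, origin n G)) := by fun_prop
  exact h.tendsto' _ _ rfl

lemma tendsto_prod_origin' : Tendsto (fun x : Model n => (origin n G, x)) (𝓝 (origin n G))
    (𝓝 (origin n G, origin n G)) := by
  have h : Continuous (fun x : Model n => (origin n G, x)) := by fun_prop
  exact h.tendsto' _ _ rfl

variable [LieGroup (𝓡 n) ∞ G]

lemma contMDiffAt_conj (g : G) :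
    ContMDiffAt 𝓘(ℝ, Model n) (𝓡 n) ∞ (fun x : Model n => g * unchart x * g⁻¹) (origin n G) :=
  (contMDiffAt_const.mul contMDiffAt_unchart).mul contMDiffAt_const

lemma contDiffAt_conj (g : G) :
    ContDiffAt ℝ ∞ (fun x => chart n (g * unchart x * g⁻¹)) (origin n G) :=
  contDiffAt_chart_comp le_rfl (contMDiffAt_conj g) (by simp)

lemma hasFDerivAt_conj (g : G) :
    HasFDerivAt (fun x => chart n (g * unchart x * g⁻¹)) (Ad g) (origin n G) :=
  ((contDiffAt_conj g).differentiableAt (by simp)).hasFDerivAt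

lemma tendsto_conj (g : G) :
    Tendsto (fun x : Model n => g * unchart x * g⁻¹) (𝓝 (origin n G)) (𝓝 1) := by
  have h := (contMDiffAt_conj (n := n) g).continuousAt
  rw [ContinuousAt] at h
  simpa using h

lemma Ad_mul (g h : G) : (Ad (g * h) : Model n →L[ℝ] Model n) = (Ad g).comp (Ad h) := by
  have h2 := hasFDerivAt_conj (n := n) h
  have h1 : HasFDerivAt (fun x => chart n (g * unchart x * g⁻¹)) (Ad g)
      (chart n (h * unchart (origin n G) * h⁻¹)) := by
    have e : chart n (h * unchart (origin n G) * h⁻¹) = origin n G := by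
      simp only [unchart_origin, mul_one, mul_inv_cancel]; rfl
    rw [e]; exact hasFDerivAt_conj (n := n) g
  have h3 := h1.comp (origin n G) h2
  have h4 : (fun x => chart n (g * h * unchart x * (g * h)⁻¹)) =ᶠ[𝓝 (origin n G)]
      (fun x => chart n (g * unchart x * g⁻¹)) ∘ (fun x => chart n (h * unchart x * h⁻¹)) := by
    filter_upwards [(tendsto_conj h).eventually (eventually_unchart_chart (n := n) (G := G))]
      with x hx
    simp only [Function.comp, hx]
    congr 1; group
  exact (h3.congr_of_eventuallyEq h4).fderiv

lemma Ad_inv_comp (g : G) : (Ad g⁻¹).comp (Ad g) = ContinuousLinearMap.id ℝ (Model n) := by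
  rw [← Ad_mul]; simp

lemma Ad_comp_inv (g : G) : (Ad g).comp (Ad g⁻¹) = ContinuousLinearMap.id ℝ (Model n) := by
  rw [← Ad_mul]; simp

lemma contMDiffAt_unchart_fst : ContMDiffAt 𝓘(ℝ, Model n × Model n) (𝓡 n) ∞
      (fun p : Model n × Model n => (unchart p.1 : G)) (origin n G, origin n G) :=
    ContMDiffAt.comp (I' := 𝓘(ℝ, Model n)) _ contMDiffAt_unchart contDiffAt_fst.contMDiffAt

lemma contMDiffAt_unchart_snd : ContMDiffAt 𝓘(ℝ, Model n × Model n) (𝓡 n) ∞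
      (fun p : Model n × Model n => (unchart p.2 : G)) (origin n G, origin n G) :=
    ContMDiffAt.comp (I' := 𝓘(ℝ, Model n)) _ contMDiffAt_unchart contDiffAt_snd.contMDiffAt

/-- The differential of `(x, y) ↦ g x g⁻¹ y` at the identity, read in the chart. -/
lemma hasFDerivAt_conj_mul (g : G) :
    HasFDerivAt (fun p : Model n × Model n => chart n (g * unchart p.1 * g⁻¹ * unchart p.2))
      ((Ad g).coprod (.id ℝ _)) (origin n G, origin n G) := by
  refine hasFDerivAt_prod_of_partial ?_ ?_ ?_
  · refine ContDiffAt.differentiableAt (n := ∞) ?_ (by simp)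
    exact contDiffAt_chart_comp le_rfl
      (((contMDiffAt_const.mul contMDiffAt_unchart_fst).mul contMDiffAt_const).mul
        contMDiffAt_unchart_snd) (by simp)
  · simpa using hasFDerivAt_conj (n := n) g
  · refine (hasFDerivAt_id _).congr_of_eventuallyEq ?_
    filter_upwards [eventually_chart_unchart (n := n) (G := G)] with x hx
    simpa using hx

/-- The product rule for left velocities. -/
lemma HasLeftVel.mul {c₁ c₂ : ℝ → G} {S : Set ℝ} {t : ℝ} {u₁ u₂ : Model n}
    (h₁ : HasLeftVel c₁ S t u₁) (h₂ : HasLeftVel c₂ S t u₂) (ht : t ∈ S) :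
    HasLeftVel (fun τ => c₁ τ * c₂ τ) S t (Ad (c₂ t)⁻¹ u₁ + u₂) := by
  have : IsTopologicalGroup G := topologicalGroup_of_lieGroup (𝓡 n) ∞
  refine ⟨h₁.1.mul h₂.1, ?_⟩
  have e1 : ∀ {c : ℝ → G}, ContinuousWithinAt c S t →
      Tendsto (fun τ => (c t)⁻¹ * c τ) (𝓝[S] t) (𝓝 1) := by
    intro c hc
    have h : ContinuousWithinAt (fun τ => (c t)⁻¹ * c τ) S t := continuousWithinAt_const.mul hc
    simpa [ContinuousWithinAt] using h
  have key := (hasFDerivAt_conj_mul (n := n) (c₂ t)⁻¹)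
  have hp : (origin n G, origin n G) =
      (chart n ((c₁ t)⁻¹ * c₁ t), chart n ((c₂ t)⁻¹ * c₂ t)) := by simp [origin]
  rw [hp] at key
  have h3 := key.comp_hasDerivWithinAt t (h₁.2.prodMk h₂.2)
  have h4 : (fun τ => chart n ((c₁ t * c₂ t)⁻¹ * (c₁ τ * c₂ τ))) =ᶠ[𝓝[S] t]
      (fun p : Model n × Model n =>
        chart n ((c₂ t)⁻¹ * unchart p.1 * (c₂ t)⁻¹⁻¹ * unchart p.2)) ∘
      (fun τ => (chart n ((c₁ t)⁻¹ * c₁ τ), chart n ((c₂ t)⁻¹ * c₂ τ))) := by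
    filter_upwards [(e1 h₁.1).eventually (eventually_unchart_chart (n := n)),
      (e1 h₂.1).eventually (eventually_unchart_chart (n := n))] with τ h5 h6
    simp only [Function.comp, h5, h6]
    congr 1; group
  have h5 := h3.congr_of_eventuallyEq_of_mem h4 ht
  simpa using h5

/-- Group multiplication read in the chart. -/
def chartMul (n : ℕ) (G : Type*) [TopologicalSpace G] [ChartedSpace (Model n) G] [Group G]
    (p : Model n × Model n) : Model n :=
  chart n ((unchart p.1 : G) * unchart p.2)

lemma contDiffAt_chartMul : ContDiffAt ℝ ∞ (chartMul n G) (origin n G, origin n G) :=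
  contDiffAt_chart_comp le_rfl (contMDiffAt_unchart_fst.mul contMDiffAt_unchart_snd) (by simp)

/-- Conjugation read in the chart, as a function of both variables. -/
def chartConj (n : ℕ) (G : Type*) [TopologicalSpace G] [ChartedSpace (Model n) G] [Group G]
    (p : Model n × Model n) : Model n :=
  chart n ((unchart p.1 : G) * unchart p.2 * (unchart p.1)⁻¹)

lemma contMDiffAt_chartConj_aux : ContMDiffAt 𝓘(ℝ, Model n × Model n) (𝓡 n) ∞
      (fun p : Model n × Model n => (unchart p.1 : G) * unchart p.2 * (unchart p.1)⁻¹)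
      (origin n G, origin n G) :=
  ((contMDiffAt_unchart_fst.mul contMDiffAt_unchart_snd).mul contMDiffAt_unchart_fst.inv)

lemma contDiffAt_chartConj : ContDiffAt ℝ ∞ (chartConj n G) (origin n G, origin n G) :=
  contDiffAt_chart_comp le_rfl contMDiffAt_chartConj_aux (by simp)

/-- In the chart, `Ad` is a partial derivative of conjugation. -/
lemma eventually_Ad_unchart : ∀ᶠ x in 𝓝 (origin n G), Ad (unchart x : G) =
    (fderiv ℝ (chartConj n G) (x, origin n G)).comp (.inr ℝ _ _) := by
  have h := (contDiffAt_chartConj (n := n) (G := G)).of_le (m := 1) (by simp)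
  filter_upwards [tendsto_prod_origin.eventually (h.eventually (by simp))] with x hx
  exact ((hx.differentiableAt (by simp)).hasFDerivAt.comp _
    (hasFDerivAt_prodMk_right x (origin n G))).fderiv

lemma contDiffAt_Ad_unchart :
    ContDiffAt ℝ ∞ (fun x => (Ad (unchart x : G) : Model n →L[ℝ] Model n)) (origin n G) := by
  refine ContDiffAt.congr_of_eventuallyEq ?_ eventually_Ad_unchart
  have h1 : ContDiffAt ℝ ∞ (fderiv ℝ (chartConj n G)) (origin n G, origin n G) :=
    contDiffAt_chartConj.fderiv_right (m := ∞) (by simp)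
  have h2 : ContDiffAt ℝ ∞ (fun x => fderiv ℝ (chartConj n G) (x, origin n G)) (origin n G) :=
    h1.comp (f := fun x => (x, origin n G)) _ (by fun_prop)
  exact h2.clm_comp contDiffAt_const

lemma fderiv_chartMul_origin :
    fderiv ℝ (chartMul n G) (origin n G, origin n G) =
      (ContinuousLinearMap.id ℝ _).coprod (.id ℝ _) := by
  have h := (hasFDerivAt_conj_mul (n := n) (1 : G)).fderiv
  have e : chartMul n G = fun p => chart n ((1 : G) * unchart p.1 * 1⁻¹ * unchart p.2) := by
    funext p; simp [chartMul]
  rw [e, h, Ad_one]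

/-- The identity `∂₁m(0, x) ∘ Ad x = ∂₂m(x, 0)` for multiplication `m` in the chart. -/
lemma eventually_fderiv_chartMul : ∀ᶠ x in 𝓝 (origin n G), ∀ v : Model n,
    fderiv ℝ (chartMul n G) (origin n G, x) (Ad (unchart x : G) v, 0) =
      fderiv ℝ (chartMul n G) (x, origin n G) (0, v) := by
  have hm := (contDiffAt_chartMul (n := n) (G := G)).of_le (m := 1) (by simp)
  have hd := hm.eventually (by simp)
  have ht : Tendsto (fun p : Model n × Model n => (unchart p.1 : G) * unchart p.2 * (unchart p.1)⁻¹)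
      (𝓝 (origin n G, origin n G)) (𝓝 1) := by
    have := (contMDiffAt_chartConj_aux (n := n) (G := G)).continuousAt
    rw [ContinuousAt] at this
    simpa using this
  have he := (ht.eventually (eventually_unchart_chart (n := n) (G := G))).eventually_nhds
  filter_upwards [tendsto_prod_origin.eventually hd, tendsto_prod_origin'.eventually hd,
    tendsto_prod_origin.eventually he] with x h1 h2 h3 v
  have hc : HasFDerivAt (fun y => chartConj n G (x, y)) (Ad (unchart x : G)) (origin n G) :=
    hasFDerivAt_conj (unchart x : G)
  have hc0 : chartConj n G (x, origin n G) = origin n G := by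
    simp only [chartConj, unchart_origin, mul_one, mul_inv_cancel]; rfl
  have h4 : HasFDerivAt (fun y => chartMul n G (chartConj n G (x, y), x))
      ((fderiv ℝ (chartMul n G) (origin n G, x)).comp
        ((Ad (unchart x : G)).prod 0)) (origin n G) := by
    have h5 := (h2.differentiableAt (by simp)).hasFDerivAt
    rw [← hc0] at h5
    have := h5.comp (f := fun y => (chartConj n G (x, y), x)) (origin n G)
      (hc.prodMk (hasFDerivAt_const x _))
    rw [hc0] at this
    exact this
  have h5 : HasFDerivAt (fun y => chartMul n G (x, y))
      ((fderiv ℝ (chartMul n G) (x, origin n G)).comp (.inr ℝ _ _)) (origin n G) :=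
    (h1.differentiableAt (by simp)).hasFDerivAt.comp _ (hasFDerivAt_prodMk_right x (origin n G))
  have h6 : (fun y => chartMul n G (chartConj n G (x, y), x)) =ᶠ[𝓝 (origin n G)]
      (fun y => chartMul n G (x, y)) := by
    have hy : Tendsto (fun y => (x, y)) (𝓝 (origin n G)) (𝓝 (x, origin n G)) :=
      Continuous.tendsto' (by fun_prop) _ _ rfl
    filter_upwards [hy.eventually h3] with y hy
    simp only [chartMul, chartConj] at hy ⊢
    rw [hy]; congr 1; group
  have h7 := h4.unique (h5.congr_of_eventuallyEq h6)
  simpa using DFunLike.congr_fun h7 v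

/-- The derivative of `Ad` at the identity, as a bilinear map on the model space. It is the Lie
bracket, see `lie_eq_ad`. -/
def ad (n : ℕ) (G : Type*) [TopologicalSpace G] [ChartedSpace (Model n) G] [Group G] :
    Model n →L[ℝ] Model n →L[ℝ] Model n :=
  fderiv ℝ (fun x => (Ad (unchart x : G) : Model n →L[ℝ] Model n)) (origin n G)

lemma hasFDerivAt_Ad : HasFDerivAt (fun x => (Ad (unchart x : G) : Model n →L[ℝ] Model n))
    (ad n G) (origin n G) :=
  (contDiffAt_Ad_unchart.differentiableAt (by simp)).hasFDerivAt

/-- In the chart, `ad` is the antisymmetrised second derivative of multiplication `m`. This follows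
by differentiating `∂₁m(0, x) ∘ Ad x = ∂₂m(x, 0)`, with the symmetry of the second derivative. -/
lemma ad_eq_fderiv_fderiv (u v : Model n) :
    ad n G u v =
      fderiv ℝ (fun x => fderiv ℝ (chartMul n G) (x, origin n G) (0, v)) (origin n G) u -
      fderiv ℝ (fun x => fderiv ℝ (chartMul n G) (x, origin n G) (0, u)) (origin n G) v := by
  set D := fderiv ℝ (chartMul n G) with hD
  have hDc : ContDiffAt ℝ ∞ D (origin n G, origin n G) :=
    contDiffAt_chartMul.fderiv_right (m := ∞) (by simp)
  have hDd := (hDc.differentiableAt (by simp)).hasFDerivAt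
  set D2 := fderiv ℝ D (origin n G, origin n G) with hD2
  have hsymm : ∀ p q, D2 p q = D2 q p := fun p q =>
    (contDiffAt_chartMul (n := n) (G := G)).isSymmSndFDerivAt
      (by
        simp only [minSmoothness_of_isRCLikeNormedField]
        exact WithTop.coe_le_coe.2 (le_top : (2 : ℕ∞) ≤ ⊤)) p q
  have hl : HasFDerivAt (fun x => D (x, origin n G)) (D2.comp (.inl ℝ _ _)) (origin n G) :=
    HasFDerivAt.comp (f := fun x => (x, origin n G)) (origin n G) hDd
      (hasFDerivAt_prodMk_left _ _)
  have hr : HasFDerivAt (fun x => D (origin n G, x)) (D2.comp (.inr ℝ _ _)) (origin n G) :=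
    HasFDerivAt.comp (f := fun x => (origin n G, x)) (origin n G) hDd
      (hasFDerivAt_prodMk_right _ _)
  have e1 : ∀ v w, fderiv ℝ (fun x => D (x, origin n G) (0, v)) (origin n G) w
      = D2 (w, 0) (0, v) := by
    intro v w
    have := (hl.clm_apply (hasFDerivAt_const ((0 : Model n), v) (origin n G))).fderiv
    rw [this]; simp
  have h2 : HasFDerivAt (fun x => D (origin n G, x) (Ad (unchart x : G) v, 0))
      ((D (origin n G, origin n G)).comp ((ContinuousLinearMap.apply ℝ _ v ∘L ad n G).prod 0) +
        (D2.comp (.inr ℝ _ _)).flip (v, 0)) (origin n G) := by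
    have h3 : HasFDerivAt (fun x => ((Ad (unchart x : G) v, 0) : Model n × Model n))
        ((ContinuousLinearMap.apply ℝ _ v ∘L ad n G).prod 0) (origin n G) :=
      ((ContinuousLinearMap.apply ℝ (Model n) v).hasFDerivAt.comp _ hasFDerivAt_Ad).prodMk
        (hasFDerivAt_const (0 : Model n) _)
    have := hr.clm_apply h3
    simpa using this
  have h3 : HasFDerivAt (fun x => D (x, origin n G) (0, v))
      ((D2.comp (.inl ℝ _ _)).flip (0, v)) (origin n G) := by
    have := (hl.clm_apply (hasFDerivAt_const ((0 : Model n), v) (origin n G)))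
    simpa using this
  have h4 : (fun x => D (origin n G, x) (Ad (unchart x : G) v, 0)) =ᶠ[𝓝 (origin n G)]
      (fun x => D (x, origin n G) (0, v)) := by
    filter_upwards [eventually_fderiv_chartMul (n := n) (G := G)] with x hx using hx v
  have h5 := DFunLike.congr_fun (h2.unique (h3.congr_of_eventuallyEq h4)) u
  have h6 : D (origin n G, origin n G) = (ContinuousLinearMap.id ℝ _).coprod (.id ℝ _) :=
    fderiv_chartMul_origin
  rw [e1, e1, hsymm (v, 0) (0, u), eq_sub_iff_add_eq]
  simpa [h6] using h5

end Adjoint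

/-! ### The Lie bracket as the derivative of the adjoint action -/

section LieBracket

open VectorField

lemma lieBracketWithin_univ_eq_of_eventuallyEq {E : Type*} [NormedAddCommGroup E]
    [NormedSpace ℝ E] {U V P Q : E → E} {x u v : E} (hU : U =ᶠ[𝓝 x] P) (hV : V =ᶠ[𝓝 x] Q)
    (hu : P x = u) (hv : Q x = v) :
    lieBracketWithin ℝ U V univ x = fderiv ℝ Q x u - fderiv ℝ P x v := by
  rw [lieBracketWithin_univ, lieBracket, hU.fderiv_eq, hV.fderiv_eq, hU.self_of_nhds,
    hV.self_of_nhds, hu, hv]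

variable {n : ℕ} {G : Type*} [TopologicalSpace G] [ChartedSpace (Model n) G] [Group G]
  [LieGroup (𝓡 n) ∞ G]

/-- The left-invariant vector field with generator `v`, read in the chart, is the partial derivative
`∂₂m(x, 0) v` of multiplication `m`. -/
lemma eventually_mpullbackWithin_eq (v : GroupLieAlgebra (𝓡 n) G) : ∀ᶠ x in 𝓝 (origin n G),
    (mpullbackWithin 𝓘(ℝ, Model n) (𝓡 n) (extChartAt (𝓡 n) (1 : G)).symm
      (mulInvariantVectorField (I := 𝓡 n) v) (range (𝓡 n)) x : Model n) =
    fderiv ℝ (chartMul n G) (x, origin n G) (0, v) := by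
  have hm := (contDiffAt_chartMul (n := n) (G := G)).of_le (m := 1) (by simp)
  have hd := hm.eventually (by simp)
  have ht : Tendsto (fun p : Model n × Model n => (unchart p.1 : G) * unchart p.2)
      (𝓝 (origin n G, origin n G)) (𝓝 1) := by
    have := (contMDiffAt_unchart_fst.mul contMDiffAt_unchart_snd :
      ContMDiffAt 𝓘(ℝ, Model n × Model n) (𝓡 n) ∞ (fun p : Model n × Model n =>
        (unchart p.1 : G) * unchart p.2) (origin n G, origin n G)).continuousAt
    rw [ContinuousAt] at this
    simp only [Pi.mul_apply, unchart_origin, mul_one] at this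
    exact this
  have he := (ht.eventually (eventually_unchart_chart (n := n) (G := G))).eventually_nhds
  have htgt : ∀ᶠ x in 𝓝 (origin n G), x ∈ (extChartAt (𝓡 n) (1 : G)).target :=
    extChartAt_target_mem_nhds (I := 𝓡 n) (1 : G)
  filter_upwards [tendsto_prod_origin.eventually hd, tendsto_prod_origin.eventually he,
    eventually_chart_unchart (n := n) (G := G), htgt] with x h1 h2 h3 h4
  have hinv := isInvertible_mfderivWithin_extChartAt_symm (I := 𝓡 n) (x := (1 : G)) h4
  have hx : MDifferentiableWithinAt 𝓘(ℝ, Model n) (𝓡 n) (extChartAt (𝓡 n) (1 : G)).symm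
      (range (𝓡 n)) x := by
    exact mdifferentiableWithinAt_extChartAt_symm h4
  have hx' : HasMFDerivAt 𝓘(ℝ, Model n) (𝓡 n) (unchart : Model n → G) x
      (mfderivWithin 𝓘(ℝ, Model n) (𝓡 n) (extChartAt (𝓡 n) (1 : G)).symm (range (𝓡 n)) x) := by
    have := hx.hasMFDerivWithinAt
    exact this.hasMFDerivAt (by simp)
  have ho : HasMFDerivAt 𝓘(ℝ, Model n) (𝓡 n) (unchart : Model n → G) (origin n G)
      (ContinuousLinearMap.id ℝ (Model n)) := by
    have h4 : origin n G ∈ (extChartAt (𝓡 n) (1 : G)).target := mem_extChartAt_target (I := 𝓡 n) _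
    have := (mdifferentiableWithinAt_extChartAt_symm (I := 𝓡 n) h4).hasMFDerivWithinAt
    have := this.hasMFDerivAt (by simp)
    have h5 := mfderivWithin_range_extChartAt_symm (I := 𝓡 n) (x := (1 : G))
    rw [origin, chart, h5] at this
    exact this
  have hcm : HasMFDerivAt 𝓘(ℝ, Model n) 𝓘(ℝ, Model n) (fun y => chartMul n G (x, y)) (origin n G)
      ((fderiv ℝ (chartMul n G) (x, origin n G)).comp (.inr ℝ _ _)) :=
    ((h1.differentiableAt (by simp)).hasFDerivAt.comp _
      (hasFDerivAt_prodMk_right x (origin n G))).hasMFDerivAt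
  have hx2 : chartMul n G (x, origin n G) = x := by simp [chartMul, h3]
  rw [← hx2] at hx'
  have hB := HasMFDerivAt.comp (origin n G) hx' hcm
  have hg : HasMFDerivAt (𝓡 n) (𝓡 n) (fun y : G => unchart x * y) 1
     (mfderiv (𝓡 n) (𝓡 n) (fun y : G => unchart x * y) 1) :=
    ((contMDiff_mul_left' (n := n) (unchart x : G)).mdifferentiableAt (by simp)).hasMFDerivAt
  rw [← unchart_origin (n := n) (G := G)] at hg
  have hA := HasMFDerivAt.comp (origin n G) hg ho
  have heq : (unchart ∘ fun y => chartMul n G (x, y)) =ᶠ[𝓝 (origin n G)]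
      (fun y : G => unchart x * y) ∘ unchart := by
    have hy : Tendsto (fun y => (x, y)) (𝓝 (origin n G)) (𝓝 (x, origin n G)) :=
      Continuous.tendsto' (by fun_prop) _ _ rfl
    filter_upwards [hy.eventually h2] with y hy using hy
  have hAB := DFunLike.congr_fun (hasMFDerivAt_unique hB (hA.congr_of_eventuallyEq heq)) v
  rw [hx2, unchart_origin] at hAB
  have key : mfderivWithin 𝓘(ℝ, Model n) (𝓡 n) (extChartAt (𝓡 n) (1 : G)).symm (range (𝓡 n)) x
      (fderiv ℝ (chartMul n G) (x, origin n G) (0, v)) = mulInvariantVectorField (I := 𝓡 n) v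
        ((extChartAt (𝓡 n) (1 : G)).symm x) := by
    exact hAB
  rw [mpullbackWithin_apply, ← key]
  exact hinv.inverse_apply_self _

/-- The Lie bracket of the group Lie algebra is the derivative of the adjoint action. -/
lemma lie_eq_ad (u v : GroupLieAlgebra (𝓡 n) G) :
    ⁅u, v⁆ = (ad n G (u : Model n) (v : Model n) : Model n) := by
  have h0 : ⁅u, v⁆ = lieBracketWithin ℝ
      (mpullbackWithin 𝓘(ℝ, Model n) (𝓡 n) (extChartAt (𝓡 n) (1 : G)).symm
        (mulInvariantVectorField (I := 𝓡 n) u) (range (𝓡 n)))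
      (mpullbackWithin 𝓘(ℝ, Model n) (𝓡 n) (extChartAt (𝓡 n) (1 : G)).symm
        (mulInvariantVectorField (I := 𝓡 n) v) (range (𝓡 n)))
      ((extChartAt (𝓡 n) (1 : G)).symm ⁻¹' univ ∩ range (𝓡 n)) (extChartAt (𝓡 n) (1 : G) 1) := by
    have hid : (mfderiv (𝓡 n) 𝓘(ℝ, Model n) (extChartAt (𝓡 n) (1 : G)) 1).inverse =
        ContinuousLinearMap.id ℝ _ := by
      rw [mfderiv_extChartAt_self]; exact ContinuousLinearMap.inverse_id
    rw [GroupLieAlgebra.bracket_def, ← mlieBracketWithin_univ, mlieBracketWithin]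
    exact DFunLike.congr_fun hid _
  refine h0.trans ?_
  have hset : ((extChartAt (𝓡 n) (1 : G)).symm ⁻¹' univ ∩ range (𝓡 n)) = univ := by simp
  rw [hset]
  have hu := eventually_mpullbackWithin_eq u
  have hv := eventually_mpullbackWithin_eq v
  have hval : ∀ w : Model n, fderiv ℝ (chartMul n G) (origin n G, origin n G) (0, w) = w := by
    intro w; rw [fderiv_chartMul_origin]; simp
  refine Eq.trans ?_ (ad_eq_fderiv_fderiv (G := G) (u : Model n) (v : Model n)).symm
  exact lieBracketWithin_univ_eq_of_eventuallyEq (E := Model n) hu hv (hval u) (hval v)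

end LieBracket

/-! ### One-parameter subgroups -/

section ExpCurve

variable {n : ℕ} {G : Type*} [TopologicalSpace G] [ChartedSpace (Model n) G] [Group G]
  [LieGroup (𝓡 n) ∞ G]

/-- Along a curve with left velocity `u`, the derivative of `Ad` is `Ad ∘ ad u`. -/
lemma HasLeftVel.hasDerivWithinAt_Ad {c : ℝ → G} {S : Set ℝ} {t : ℝ} {u : Model n}
    (h : HasLeftVel c S t u) (ht : t ∈ S) :
    HasDerivWithinAt (fun τ => (Ad (c τ) : Model n →L[ℝ] Model n))
      ((Ad (c t)).comp (ad n G u)) S t := by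
  have : IsTopologicalGroup G := topologicalGroup_of_lieGroup (𝓡 n) ∞
  have e1 : Tendsto (fun τ => (c t)⁻¹ * c τ) (𝓝[S] t) (𝓝 1) := by
    have h : ContinuousWithinAt (fun τ => (c t)⁻¹ * c τ) S t := continuousWithinAt_const.mul h.1
    simpa [ContinuousWithinAt] using h
  have key := hasFDerivAt_Ad (n := n) (G := G)
  have hp : origin n G = chart n ((c t)⁻¹ * c t) := by simp [origin]
  rw [hp] at key
  have h1 := key.comp_hasDerivWithinAt t h.2
  have h2 := ((ContinuousLinearMap.compL ℝ (Model n) (Model n) (Model n)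
    (Ad (c t))).hasFDerivAt).comp_hasDerivWithinAt t h1
  refine h2.congr_of_eventuallyEq_of_mem ?_ ht
  filter_upwards [e1.eventually (eventually_unchart_chart (n := n))] with τ hτ
  simp only [Function.comp, hτ, ContinuousLinearMap.compL_apply]
  rw [← Ad_mul]; congr 1; group

lemma continuous_Ad : Continuous (Ad : G → Model n →L[ℝ] Model n) := by
  have : IsTopologicalGroup G := topologicalGroup_of_lieGroup (𝓡 n) ∞
  have h1 : ContinuousAt (Ad : G → Model n →L[ℝ] Model n) 1 := by
    have h := (hasFDerivAt_Ad (n := n) (G := G)).continuousAt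
    have h2 : Tendsto (fun g : G => (Ad (unchart (chart n g) : G) : Model n →L[ℝ] Model n))
        (𝓝 1) (𝓝 (Ad (1 : G))) := by
      rw [ContinuousAt, unchart_origin] at h
      exact h.comp tendsto_chart
    refine h2.congr' ?_
    filter_upwards [eventually_unchart_chart (n := n) (G := G)] with g hg
    rw [hg]
  rw [continuous_iff_continuousAt]
  intro g
  have h2 : Tendsto (fun h : G => g⁻¹ * h) (𝓝 g) (𝓝 1) :=
    Continuous.tendsto' (by fun_prop) _ _ (by simp)
  have h3 : ContinuousAt (fun h : G => (Ad g).comp (Ad (g⁻¹ * h) : Model n →L[ℝ] Model n)) g := by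
    refine continuousAt_const.clm_comp ?_
    have h4 := h1.tendsto.comp h2
    rw [ContinuousAt, inv_mul_cancel]
    exact h4
  refine h3.congr (Eventually.of_forall fun h => ?_)
  simp only [← Ad_mul]; congr 1; group

/-- The solution of `T' = T ∘ A` with `T 0 = id` is `exp (t A)`. -/
lemma exp_of_deriv {E : Type*} [NormedAddCommGroup E] [NormedSpace ℝ E] [CompleteSpace E]
    {T : ℝ → E →L[ℝ] E} {A : E →L[ℝ] E} (h0 : T 0 = .id ℝ E)
    (hT : ∀ t, HasDerivAt T ((T t).comp A) t) (t : ℝ) : T t = NormedSpace.exp (t • A) := by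
  have hd : ∀ t, HasDerivAt (fun t => (T t).comp (NormedSpace.exp ((-t) • A))) 0 t := by
    intro t
    have h2 : HasDerivAt (fun t : ℝ => NormedSpace.exp ((-t) • A))
        (-(A * NormedSpace.exp ((-t) • A))) t := by
      have := (hasDerivAt_exp_smul_const' (𝕂 := ℝ) A (-t)).scomp t (hasDerivAt_neg t)
      simpa only [neg_smul, one_smul, Function.comp_def] using this
    have h3 := (hT t).clm_comp h2
    convert h3 using 1
    simp [ContinuousLinearMap.mul_def, ContinuousLinearMap.comp_assoc]
  have hconst := is_const_of_deriv_eq_zero (fun t => (hd t).differentiableAt)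
    (fun t => (hd t).deriv) t 0
  have hz : NormedSpace.exp ((-(0 : ℝ)) • A) = 1 := by
    rw [neg_zero, zero_smul, NormedSpace.exp_zero]
  simp only [hz, h0] at hconst
  have h4 : (NormedSpace.exp ((-t) • A)).comp (NormedSpace.exp (t • A)) = 1 := by
    let +nondep : NormedAlgebra ℚ (E →L[ℝ] E) := NormedAlgebra.restrictScalars ℚ ℝ _
    rw [← ContinuousLinearMap.mul_def, ← NormedSpace.exp_add_of_commute]
    · rw [← add_smul]; simp
    · exact ((Commute.refl A).smul_left _).smul_right _
  calc T t = ((T t).comp (NormedSpace.exp ((-t) • A))).comp (NormedSpace.exp (t • A)) := by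
        rw [ContinuousLinearMap.comp_assoc, h4]; rfl
    _ = _ := by rw [hconst]; rfl

/-- Solutions of `T' = T ∘ A` and `S' = S ∘ B` starting at the identity are intertwined by every map
intertwining `A` and a multiple of `B`, up to the corresponding change of speed. -/
lemma comp_eq_comp_of_deriv {E : Type*} [NormedAddCommGroup E] [NormedSpace ℝ E] [CompleteSpace E]
    {T S : ℝ → E →L[ℝ] E} {A B D : E →L[ℝ] E} {r : ℝ} (hT0 : T 0 = .id ℝ E)
    (hT : ∀ t, HasDerivAt T ((T t).comp A) t) (hS0 : S 0 = .id ℝ E)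
    (hS : ∀ t, HasDerivAt S ((S t).comp B) t) (hD : D.comp A = r • B.comp D) (t : ℝ) :
    D.comp (T t) = (S (r * t)).comp D := by
  rw [exp_of_deriv hT0 hT, exp_of_deriv hS0 hS]
  let +nondep : NormedAlgebra ℚ (E →L[ℝ] E) := NormedAlgebra.restrictScalars ℚ ℝ _
  have h : SemiconjBy D (t • A) ((r * t) • B) := by
    simp only [SemiconjBy, ContinuousLinearMap.mul_def, ContinuousLinearMap.comp_smul, hD,
      ContinuousLinearMap.smul_comp, smul_smul, mul_comm t r]
  exact h.exp_right

/-- Near the identity, a curve with left velocity `u` is differentiable in the chart. -/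
lemma eventually_hasDerivWithinAt_chart : ∀ᶠ g in 𝓝 (1 : G), ∀ (c : ℝ → G) (S : Set ℝ) (t : ℝ)
    (u : Model n), HasLeftVel c S t u → t ∈ S → c t = g → HasDerivWithinAt
      (fun τ => chart n (c τ)) (fderiv ℝ (chartMul n G) (chart n g, origin n G) (0, u)) S t := by
  have : IsTopologicalGroup G := topologicalGroup_of_lieGroup (𝓡 n) ∞
  have hm := ((contDiffAt_chartMul (n := n) (G := G)).of_le (m := 1) (by simp)).eventually (by simp)
  filter_upwards [eventually_unchart_chart (n := n) (G := G),
    tendsto_chart.eventually (tendsto_prod_origin.eventually hm)] with g hg1 hg2 c S t u hc ht hcg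
  subst hcg
  have e1 : Tendsto (fun τ => (c t)⁻¹ * c τ) (𝓝[S] t) (𝓝 1) := by
    have h : ContinuousWithinAt (fun τ => (c t)⁻¹ * c τ) S t := continuousWithinAt_const.mul hc.1
    simpa [ContinuousWithinAt] using h
  have h1 := (hg2.differentiableAt (by simp)).hasFDerivAt
  have hp : origin n G = chart n ((c t)⁻¹ * c t) := by simp [origin]
  rw [hp] at h1
  have h2 := h1.comp_hasDerivWithinAt t ((hasDerivWithinAt_const t S (chart n (c t))).prodMk hc.2)
  rw [← hp] at h2
  refine h2.congr_of_eventuallyEq_of_mem ?_ ht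
  filter_upwards [e1.eventually (eventually_unchart_chart (n := n))] with τ hτ
  simp only [Function.comp, chartMul, hτ, hg1]
  congr 1; group

/-- `IsOneParam c X` says that `c` is the one-parameter subgroup `t ↦ exp (t X)`, characterised by
its value at `0` and its constant left velocity. -/
structure IsOneParam (c : ℝ → G) (X : Model n) : Prop where
  map_zero : c 0 = 1
  hasLeftVel : ∀ t, HasLeftVel c univ t X

/-- Every vector generates a one-parameter subgroup: left translations make the time of existence of
integral curves of a left-invariant field uniform. -/
lemma exists_isOneParam [T2Space G] (X : Model n) : ∃ c : ℝ → G, IsOneParam c X := by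
  have : LieGroup (𝓡 n) (minSmoothness ℝ 3) G := by
    rw [minSmoothness_of_isRCLikeNormedField]
    infer_instance
  have : IsManifold (𝓡 n) 1 G := IsManifold.of_le (n := ∞)
    (WithTop.coe_le_coe.2 (le_top : (1 : ℕ∞) ≤ ⊤))
  let v : (g : G) → TangentSpace (𝓡 n) g := mulInvariantVectorField (I := 𝓡 n) (G := G) X
  have hv : ContMDiff (𝓡 n) (𝓡 n).tangent 1 (fun g => (⟨g, v g⟩ : TangentBundle (𝓡 n) G)) :=
    (contMDiff_mulInvariantVectorField (I := 𝓡 n) (G := G) X).of_le (by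
      rw [minSmoothness_of_isRCLikeNormedField]; exact one_le_two)
  obtain ⟨γ, h0, hγ⟩ :=
    exists_isMIntegralCurveAt_of_contMDiffAt_boundaryless 0 (hv.contMDiffAt (x := 1))
  obtain ⟨ε, hε, hγ⟩ := isMIntegralCurveAt_iff'.1 hγ
  have key : ∀ {S : Set ℝ} {c : ℝ → G}, IsMIntegralCurveOn c v S ↔ ∀ t ∈ S, HasLeftVel c S t X := by
    intro S c
    exact forall₂_congr fun t ht => hasMFDerivWithinAt_iff_hasLeftVel (G := G) X
  have hS : Metric.ball (0 : ℝ) ε = Ioo (-ε) ε := by simp [Real.ball_eq_Ioo]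
  rw [hS] at hγ
  obtain ⟨c, hc0, hc⟩ := exists_isMIntegralCurve_of_isMIntegralCurveOn hv hε (fun g => by
    refine ⟨fun τ => g * γ τ, by simp [h0], ?_⟩
    rw [key] at hγ ⊢
    exact fun t ht => (hγ t ht).const_mul g) 1
  refine ⟨c, hc0, fun t => ?_⟩
  exact key.1 (hc.isMIntegralCurveOn univ) t (mem_univ t)

namespace IsOneParam

variable {c : ℝ → G} {X : Model n}

omit [LieGroup (𝓡 n) ∞ G] in
lemma continuous (h : IsOneParam c X) : Continuous c := by
  rw [continuous_iff_continuousAt]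
  exact fun t => (continuousWithinAt_univ _ _).1 (h.hasLeftVel t).1

lemma hasDerivAt_Ad (h : IsOneParam c X) (t : ℝ) :
    HasDerivAt (fun t => (Ad (c t) : Model n →L[ℝ] Model n)) ((Ad (c t)).comp (ad n G X)) t := by
  have h1 := (h.hasLeftVel t).hasDerivWithinAt_Ad (mem_univ t)
  rwa [hasDerivWithinAt_univ] at h1

/-- If `D` intertwines `ad X` with `r • ad X`, then it intertwines `Ad (exp tX)` with
`Ad (exp (rt)X)`. -/
lemma comp_Ad (h : IsOneParam c X) {D : Model n →L[ℝ] Model n} {r : ℝ}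
    (hD : D.comp (ad n G X) = r • (ad n G X).comp D) (t : ℝ) :
    D.comp (Ad (c t)) = (Ad (c (r * t))).comp D :=
  comp_eq_comp_of_deriv (T := fun t => Ad (c t)) (S := fun t => Ad (c t))
    (by simp [h.map_zero]) h.hasDerivAt_Ad (by simp [h.map_zero]) h.hasDerivAt_Ad hD t

/-- Conjugating `exp (t X)` by `g` gives `exp (t Ad g X)`. -/
lemma conj (h : IsOneParam c X) (g : G) : IsOneParam (fun t => g * c t * g⁻¹) (Ad g X) := by
  refine ⟨by simp [h.map_zero], fun t => ?_⟩
  have h1 := ((h.hasLeftVel t).const_mul g).mul (hasLeftVel_const (n := n) g⁻¹ univ t) (mem_univ t)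
  simpa using h1

lemma contDiffAt_chart (h : IsOneParam c X) : ContDiffAt ℝ 1 (fun t => chart n (c t)) 0 := by
  have hc : Tendsto c (𝓝 0) (𝓝 1) := h.continuous.tendsto' _ _ h.map_zero
  have hg := hc.eventually (eventually_hasDerivWithinAt_chart (n := n) (G := G))
  have hm := ((contDiffAt_chartMul (n := n) (G := G)).of_le (m := 1) (by simp)).eventually (by simp)
  have hm2 := hc.eventually (tendsto_chart.eventually (tendsto_prod_origin.eventually hm))
  rw [contDiffAt_one_iff]
  refine ⟨fun t => ContinuousLinearMap.toSpanSingleton ℝ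
    (fderiv ℝ (chartMul n G) (chart n (c t), origin n G) (0, X)), _,
    hg.and hm2, ?_, ?_⟩
  · rintro t ⟨h1, h2⟩
    refine ContinuousAt.continuousWithinAt ?_
    have h3 := (h1 _ univ t X (h.hasLeftVel t) (mem_univ t) rfl).continuousWithinAt
    rw [continuousWithinAt_univ] at h3
    have h4 : ContinuousAt (fderiv ℝ (chartMul n G)) (chart n (c t), origin n G) :=
      (h2.fderiv_right (m := 0) (by simp)).continuousAt
    have h5 : ContinuousAt (fun τ => fderiv ℝ (chartMul n G)
        (chart n (c τ), origin n G)) t :=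
      ContinuousAt.comp (f := fun τ => (chart n (c τ), origin n G)) h4
        (h3.prodMk continuousAt_const)
    have h6 : ContinuousAt (fun τ => fderiv ℝ (chartMul n G)
        (chart n (c τ), origin n G) (0, X)) t := h5.clm_apply continuousAt_const
    exact (ContinuousLinearMap.toSpanSingletonCLE (𝕜 := ℝ)
      (E := Model n)).continuous.continuousAt.comp h6
  · rintro t ⟨h1, h2⟩
    have h3 := h1 _ univ t X (h.hasLeftVel t) (mem_univ t) rfl
    rw [hasDerivWithinAt_univ] at h3
    exact h3.hasFDerivAt

end IsOneParam

end ExpCurve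

/-! ### Coordinates of the second kind -/

section CurveProd

lemma one_le_infty : (1 : ℕ∞ω) ≤ (∞ : ℕ∞ω) := WithTop.coe_le_coe.2 (le_top : (1 : ℕ∞) ≤ ⊤)

section Group

variable {G : Type*} [Group G] {ι : Type*}

/-- The product of the points `c i (y i)`, in the order given by the list `l`. For one-parameter
subgroups `c i` these are coordinates of the second kind. -/
def curveProd (c : ι → ℝ → G) (l : List ι) (y : ι → ℝ) : G := (l.map fun i => c i (y i)).prod

@[simp] lemma curveProd_nil (c : ι → ℝ → G) (y : ι → ℝ) : curveProd c [] y = 1 := rfl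

@[simp] lemma curveProd_cons (c : ι → ℝ → G) (i : ι) (l : List ι) (y : ι → ℝ) :
    curveProd c (i :: l) y = c i (y i) * curveProd c l y := by simp [curveProd]

lemma curveProd_zero {c : ι → ℝ → G} (hc : ∀ i, c i 0 = 1) (l : List ι) : curveProd c l 0 = 1 := by
  induction l with
  | nil => rfl
  | cons i l ih => simp [ih, hc]

end Group

variable {n : ℕ} {G : Type*} [TopologicalSpace G] [ChartedSpace (Model n) G] [Group G]
  {ι : Type*}

/-- The left velocity of `curveProd` as a linear function of the velocity of the coordinates. -/
def curveProdVel (c : ι → ℝ → G) (v : ι → Model n) :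
    List ι → (ι → ℝ) → (ι → ℝ) →L[ℝ] Model n
  | [], _ => 0
  | i :: l, y => (Ad (curveProd c l y)⁻¹).comp
      ((ContinuousLinearMap.toSpanSingleton ℝ (v i)).comp (.proj i)) + curveProdVel c v l y

variable {c : ι → ℝ → G} {v : ι → Model n}

lemma curveProdVel_zero (hc : ∀ i, c i 0 = 1) (l : List ι) (s : ι → ℝ) :
    curveProdVel c v l 0 s = (l.map fun i => s i • v i).sum := by
  induction l with
  | nil => rfl
  | cons i l ih => simp [curveProdVel, ih, curveProd_zero hc]

variable [LieGroup (𝓡 n) ∞ G]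

lemma continuous_curveProd (hc : ∀ i, IsOneParam (c i) (v i)) (l : List ι) :
    Continuous (curveProd c l) := by
  have : IsTopologicalGroup G := topologicalGroup_of_lieGroup (𝓡 n) ∞
  exact continuous_list_prod _ fun i _ => (hc i).continuous.comp (continuous_apply i)

lemma continuous_curveProdVel [Fintype ι] (hc : ∀ i, IsOneParam (c i) (v i)) (l : List ι) :
    Continuous (curveProdVel c v l) := by
  have : IsTopologicalGroup G := topologicalGroup_of_lieGroup (𝓡 n) ∞
  induction l with
  | nil => exact continuous_const
  | cons i l ih =>
    refine Continuous.add ?_ ih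
    have h1 : Continuous fun y => (Ad (curveProd c l y)⁻¹ : Model n →L[ℝ] Model n) :=
      continuous_Ad.comp (continuous_curveProd hc l).inv
    exact h1.clm_comp continuous_const

/-- The chain rule for `curveProd`: its left velocity is `curveProdVel` applied to the velocity of
the coordinates. -/
lemma hasLeftVel_curveProd [Fintype ι] (hc : ∀ i, IsOneParam (c i) (v i)) (l : List ι)
    {y : ℝ → ι → ℝ} {y' : ι → ℝ} {S : Set ℝ} {t : ℝ} (hy : HasDerivWithinAt y y' S t) (ht : t ∈ S) :
    HasLeftVel (fun τ => curveProd c l (y τ)) S t (curveProdVel c v l (y t) y') := by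
  induction l with
  | nil => exact hasLeftVel_const 1 S t
  | cons i l ih =>
    have h1 : HasLeftVel (fun τ => c i (y τ i)) S t (y' i • v i) :=
      ((hc i).hasLeftVel (y t i)).comp (f := fun τ => y τ i)
        (hasDerivWithinAt_pi.1 hy i) (mapsTo_univ _ _)
    have h2 := h1.mul ih ht
    simpa [curveProdVel] using h2

lemma contMDiffAt_curveProd [Fintype ι] (hc : ∀ i, IsOneParam (c i) (v i)) (l : List ι) :
    ContMDiffAt 𝓘(ℝ, ι → ℝ) (𝓡 n) 1 (curveProd c l) 0 := by
  induction l with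
  | nil => exact contMDiffAt_const
  | cons i l ih =>
    have e : curveProd c (i :: l) = fun y => c i (y i) * curveProd c l y := by
      funext y; exact curveProd_cons c i l y
    rw [e]
    refine ContMDiffAt.mul ?_ ih
    have h1 : ContMDiffAt 𝓘(ℝ, ι → ℝ) 𝓘(ℝ, Model n) 1 (fun y : ι → ℝ => chart n (c i (y i))) 0 := by
      have h2 : ContDiffAt ℝ 1 (fun t => chart n (c i t)) ((0 : ι → ℝ) i) := (hc i).contDiffAt_chart
      have h3 : ContDiffAt ℝ 1 (fun y : ι → ℝ => y i) 0 := by fun_prop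
      exact (ContDiffAt.comp (g := fun t => chart n (c i t)) (0 : ι → ℝ) h2 h3).contMDiffAt
    have h2 : ContMDiffAt 𝓘(ℝ, Model n) (𝓡 n) 1 (unchart : Model n → G)
        (chart n (c i ((0 : ι → ℝ) i))) := by
      rw [Pi.zero_apply, (hc i).map_zero]
      exact contMDiffAt_unchart.of_le one_le_infty
    refine (h2.comp (0 : ι → ℝ) h1).congr_of_eventuallyEq ?_
    have h3 : Tendsto (fun y : ι → ℝ => c i (y i)) (𝓝 0) (𝓝 1) :=
      ((hc i).continuous.comp (continuous_apply i)).tendsto' _ _ (hc i).map_zero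
    filter_upwards [h3.eventually (eventually_unchart_chart (n := n) (G := G))] with y hy
    exact hy.symm

lemma contDiffAt_chart_curveProd [Fintype ι] (hc : ∀ i, IsOneParam (c i) (v i)) (l : List ι) :
    ContDiffAt ℝ 1 (fun y => chart n (curveProd c l y)) 0 :=
  contDiffAt_chart_comp one_le_infty (contMDiffAt_curveProd hc l)
    (curveProd_zero (fun i => (hc i).map_zero) l)

/-- Coordinates of the second kind are a `C¹` chart at the identity. -/
lemma exists_log [Fintype ι] (b : Module.Basis ι ℝ (Model n)) (hc : ∀ i, IsOneParam (c i) (b i)) :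
    ∃ β : Model n → ι → ℝ, ContDiffAt ℝ 1 β (origin n G) ∧ β (origin n G) = 0 ∧
      (∀ᶠ y in 𝓝 (0 : ι → ℝ), β (chart n (curveProd c Finset.univ.toList y)) = y) ∧
      (∀ᶠ g in 𝓝 (1 : G), curveProd c Finset.univ.toList (β (chart n g)) = g) := by
  set l := (Finset.univ : Finset ι).toList with hl
  set F : (ι → ℝ) → Model n := fun y => chart n (curveProd c l y) with hF
  have hP0 : curveProd c l 0 = 1 := curveProd_zero (fun i => (hc i).map_zero) l
  have hF0 : F 0 = origin n G := by simp only [hF, hP0]; rfl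
  have hF1 : ContDiffAt ℝ 1 F 0 := contDiffAt_chart_curveProd hc l
  let e : (ι → ℝ) ≃L[ℝ] Model n := b.equivFun.symm.toContinuousLinearEquiv
  have he : ∀ s, e s = curveProdVel c b l 0 s := by
    intro s
    rw [curveProdVel_zero (fun i => (hc i).map_zero), hl, Finset.sum_map_toList]
    simp [e, Module.Basis.equivFun_symm_apply]
  have hF2 : HasFDerivAt F (e : (ι → ℝ) →L[ℝ] Model n) 0 := by
    have h1 := (hF1.differentiableAt (by simp)).hasFDerivAt
    have h2 : fderiv ℝ F 0 = (e : (ι → ℝ) →L[ℝ] Model n) := by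
      ext1 s
      have h3 : HasDerivAt (fun τ : ℝ => τ • s) s 0 := by
        simpa using (hasDerivAt_id (0 : ℝ)).smul_const s
      have h4 := (hasLeftVel_curveProd hc l h3.hasDerivWithinAt (mem_univ 0)).2
      simp only [zero_smul, hP0, inv_one, one_mul, hasDerivWithinAt_univ] at h4
      have h5 : HasDerivAt (fun τ : ℝ => F (τ • s)) (fderiv ℝ F 0 s) 0 := by
        have h6 : HasFDerivAt F (fderiv ℝ F 0) ((0 : ℝ) • s) := by rwa [zero_smul]
        exact h6.comp_hasDerivAt 0 h3
      exact (h5.unique h4).trans (he s).symm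
    rwa [h2] at h1
  refine ⟨hF1.localInverse hF2 (by simp), ?_, ?_, ?_, ?_⟩
  · rw [← hF0]; exact hF1.to_localInverse hF2 (by simp)
  · rw [← hF0]; exact hF1.localInverse_apply_image hF2 (by simp)
  · exact (hF1.hasStrictFDerivAt' hF2 (by simp)).eventually_left_inverse
  · have h1 : ∀ᶠ x in 𝓝 (origin n G), F (hF1.localInverse hF2 (by simp) x) = x := by
      rw [← hF0]; exact (hF1.hasStrictFDerivAt' hF2 (by simp)).eventually_right_inverse
    have h2 : Tendsto (fun g : G => curveProd c l (hF1.localInverse hF2 (by simp) (chart n g)))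
        (𝓝 1) (𝓝 1) := by
      have h3 : ContinuousAt (hF1.localInverse hF2 (by simp)) (origin n G) := by
        rw [← hF0]; exact (hF1.to_localInverse hF2 (by simp)).continuousAt
      have h4 : Tendsto (hF1.localInverse hF2 (by simp)) (𝓝 (origin n G)) (𝓝 0) := by
        have h5 := hF1.localInverse_apply_image hF2 (by simp)
        rw [hF0] at h5
        rw [ContinuousAt, h5] at h3
        exact h3
      exact ((continuous_curveProd hc l).tendsto' _ _ hP0).comp (h4.comp tendsto_chart)
    filter_upwards [tendsto_chart.eventually h1, eventually_unchart_chart (n := n) (G := G),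
      h2.eventually (eventually_unchart_chart (n := n) (G := G))] with g h3 h4 h5
    rw [← h5, ← h4]
    simp only [hF] at h3
    rw [h4, h3, h4]

end CurveProd

/-! ### Horizontal curves and their lengths -/

section Horizontal

variable {n : ℕ} {G : Type*} [TopologicalSpace G] [ChartedSpace (Model n) G] [Group G]

/-- Away from the closure of the parameter set any vector is a left velocity. This junk case lets
velocities on two adjacent intervals be combined without distinguishing the position of `t`. -/
lemma hasLeftVel_of_notMem_closure {c : ℝ → G} {S : Set ℝ} {t : ℝ} (u : Model n)
    (h : t ∉ closure S) : HasLeftVel c S t u :=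
  ⟨continuousWithinAt_of_notMem_closure h, (HasFDerivWithinAt.of_notMem_closure h).congr_fderiv rfl⟩

/-- `γ` is a horizontal curve on `[0, 1]` from `g` to `h` whose left velocity is `u`. This is
`IsHorizontalCurve`, expressed through the chart at the identity. -/
structure IsHorizontal (W : Submodule ℝ (Model n)) (g h : G) (γ : ℝ → G) (u : ℝ → W) : Prop where
  source : γ 0 = g
  target : γ 1 = h
  continuousOn : ContinuousOn u (Icc 0 1)
  hasLeftVel : ∀ t ∈ Icc (0 : ℝ) 1, HasLeftVel γ (Icc 0 1) t (u t : Model n)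

/-- The properties of the Euclidean length of horizontal vectors which are used. -/
structure IsLength {W : Submodule ℝ (Model n)} (p : W → ℝ) : Prop where
  continuous : Continuous p
  smul : ∀ (r : ℝ) w, p (r • w) = |r| * p w
  norm_le : ∃ C : ℝ, 0 < C ∧ ∀ w : W, ‖(w : Model n)‖ ≤ C * p w

lemma IsLength.nonneg {W : Submodule ℝ (Model n)} {p : W → ℝ} (hp : IsLength p) (w : W) :
    0 ≤ p w := by
  obtain ⟨C, hC, h⟩ := hp.norm_le
  exact nonneg_of_mul_nonneg_right ((norm_nonneg _).trans (h w)) hC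

/-- `Reach p g h L` says that some horizontal curve from `g` to `h` has length less than `L`. -/
def Reach {W : Submodule ℝ (Model n)} (p : W → ℝ) (g h : G) (L : ℝ) : Prop :=
  ∃ (γ : ℝ → G) (u : ℝ → W), IsHorizontal W g h γ u ∧ ∫ t in (0 : ℝ)..1, p (u t) < L

variable {W : Submodule ℝ (Model n)} {p : W → ℝ}

lemma Reach.mono {g h : G} {L L' : ℝ} (hr : Reach p g h L) (hL : L ≤ L') : Reach p g h L' := by
  obtain ⟨γ, u, h1, h2⟩ := hr
  exact ⟨γ, u, h1, h2.trans_le hL⟩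

/-- Change of parameter in a horizontal curve. -/
lemma IsHorizontal.hasLeftVel_comp {g h : G} {γ : ℝ → G} {u : ℝ → W} (H : IsHorizontal W g h γ u)
    {f : ℝ → ℝ} {f' : ℝ} {S : Set ℝ} {t : ℝ} (hf : HasDerivWithinAt f f' S t)
    (hS : MapsTo f S (Icc 0 1)) (ht : t ∈ S) :
    HasLeftVel (fun τ => γ (f τ)) S t ((f' • u (f t) : W) : Model n) :=
  (H.hasLeftVel _ (hS ht)).comp hf hS

/-- The length of a curve does not depend on its parametrisation. -/
lemma IsLength.integral_comp (hp : IsLength p) {u : ℝ → W} (hu : ContinuousOn u (Icc 0 1))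
    {f f' : ℝ → ℝ} {a b : ℝ} (hab : a ≤ b) (hf : ∀ t, HasDerivAt f (f' t) t) (hf' : Continuous f')
    (hS : MapsTo f (Icc a b) (Icc 0 1)) (hpos : ∀ t ∈ Icc a b, 0 ≤ f' t) (hfa : f a = 0)
    (hfb : f b = 1) :
    ∫ t in a..b, p (f' t • u (f t)) = ∫ t in (0 : ℝ)..1, p (u t) := by
  have h1 : ∫ t in a..b, ((fun s => p (u s)) ∘ f) t * f' t = ∫ s in f a..f b, p (u s) := by
    refine intervalIntegral.integral_comp_mul_deriv'' ?_ (fun t _ => (hf t).hasDerivWithinAt)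
      hf'.continuousOn ?_
    · exact fun t _ => (hf t).continuousAt.continuousWithinAt
    · rw [uIcc_of_le hab]
      exact hp.continuous.comp_continuousOn (hu.mono hS.image_subset)
  rw [hfa, hfb] at h1
  rw [← h1]
  refine intervalIntegral.integral_congr fun t ht => ?_
  rw [uIcc_of_le hab] at ht
  simp only [Function.comp, hp.smul, abs_of_nonneg (hpos t ht), mul_comm]

lemma Reach.symm (hp : IsLength p) {g h : G} {L : ℝ} (hr : Reach p g h L) : Reach p h g L := by
  obtain ⟨γ, u, H, hL⟩ := hr
  have hd : ∀ t : ℝ, HasDerivAt (fun t : ℝ => 1 - t) (-1) t := fun t => by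
    simpa using (hasDerivAt_id t).const_sub 1
  have hm : MapsTo (fun t : ℝ => 1 - t) (Icc 0 1) (Icc 0 1) := fun t ht =>
    ⟨by linarith [ht.2], by linarith [ht.1]⟩
  refine ⟨fun t => γ (1 - t), fun t => (-1 : ℝ) • u (1 - t),
    ⟨by simp [H.target], by simp [H.source], ?_,
      fun t ht => H.hasLeftVel_comp (hd t).hasDerivWithinAt hm ht⟩, ?_⟩
  · have hc : ContinuousOn (fun t => u (1 - t)) (Icc 0 1) := H.continuousOn.comp (by fun_prop) hm
    exact hc.const_smul (-1 : ℝ)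
  · have : ∫ t in (0 : ℝ)..1, p ((-1 : ℝ) • u (1 - t)) = ∫ t in (0 : ℝ)..1, p (u t) := by
      simp only [hp.smul, abs_neg, abs_one, one_mul]
      rw [intervalIntegral.integral_comp_sub_left (fun t => p (u t))]
      simp
    rwa [this]

/-- The parameter change used to join curves: it is increasing from `0` to `1` on `[0, 1]`, and its
derivative vanishes at both ends, which makes the joined curve `C¹`. -/
def smoothStep (t : ℝ) : ℝ := 3 * t ^ 2 - 2 * t ^ 3

/-- The derivative of `smoothStep`. -/
def smoothStepDeriv (t : ℝ) : ℝ := 6 * t * (1 - t)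

lemma hasDerivAt_smoothStep (t : ℝ) : HasDerivAt smoothStep (smoothStepDeriv t) t := by
  have h := ((hasDerivAt_pow 2 t).const_mul 3).sub ((hasDerivAt_pow 3 t).const_mul 2)
  refine h.congr_deriv ?_
  simp only [smoothStepDeriv]
  norm_num
  ring

lemma smoothStep_mem {t : ℝ} (ht : t ∈ Icc (0 : ℝ) 1) : smoothStep t ∈ Icc (0 : ℝ) 1 := by
  obtain ⟨h0, h1⟩ := ht
  constructor
  · have : smoothStep t = t ^ 2 * (3 - 2 * t) := by simp only [smoothStep]; ring
    rw [this]
    exact mul_nonneg (sq_nonneg t) (by linarith)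
  · have : 1 - smoothStep t = (1 - t) ^ 2 * (1 + 2 * t) := by simp only [smoothStep]; ring
    have h2 : 0 ≤ (1 - t) ^ 2 * (1 + 2 * t) := mul_nonneg (sq_nonneg _) (by linarith)
    linarith

lemma smoothStepDeriv_nonneg {t : ℝ} (ht : t ∈ Icc (0 : ℝ) 1) : 0 ≤ smoothStepDeriv t :=
  mul_nonneg (by linarith [ht.1]) (by linarith [ht.2])

lemma Reach.trans (hp : IsLength p) {g h k : G} {L M : ℝ} (h₁ : Reach p g h L)
    (h₂ : Reach p h k M) : Reach p g k (L + M) := by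
  obtain ⟨γ₁, u₁, H₁, hL⟩ := h₁
  obtain ⟨γ₂, u₂, H₂, hM⟩ := h₂
  set f₁ : ℝ → ℝ := fun t => smoothStep (2 * t) with hf₁
  set f₂ : ℝ → ℝ := fun t => smoothStep (2 * t - 1) with hf₂
  set f₁' : ℝ → ℝ := fun t => smoothStepDeriv (2 * t) * 2 with hf₁'
  set f₂' : ℝ → ℝ := fun t => smoothStepDeriv (2 * t - 1) * 2 with hf₂'
  have hd₁ : ∀ t, HasDerivAt f₁ (f₁' t) t := fun t => by
    have h : HasDerivAt (fun t : ℝ => 2 * t) 2 t := by simpa using (hasDerivAt_id t).const_mul 2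
    exact (hasDerivAt_smoothStep (2 * t)).comp t h
  have hd₂ : ∀ t, HasDerivAt f₂ (f₂' t) t := fun t => by
    have h : HasDerivAt (fun t : ℝ => 2 * t - 1) 2 t := by
      simpa using ((hasDerivAt_id t).const_mul 2).sub_const 1
    exact (hasDerivAt_smoothStep (2 * t - 1)).comp t h
  have hm₁' : ∀ t ∈ Icc (0 : ℝ) (1 / 2), 2 * t ∈ Icc (0 : ℝ) 1 := fun t ht =>
    ⟨by linarith [ht.1], by linarith [ht.2]⟩
  have hm₂' : ∀ t ∈ Icc (1 / 2 : ℝ) 1, 2 * t - 1 ∈ Icc (0 : ℝ) 1 := fun t ht =>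
    ⟨by linarith [ht.1], by linarith [ht.2]⟩
  have hm₁ : MapsTo f₁ (Icc 0 (1 / 2)) (Icc 0 1) := fun t ht => smoothStep_mem (hm₁' t ht)
  have hm₂ : MapsTo f₂ (Icc (1 / 2) 1) (Icc 0 1) := fun t ht => smoothStep_mem (hm₂' t ht)
  have hc₁ : Continuous f₁' := by simp only [hf₁', smoothStepDeriv]; fun_prop
  have hc₂ : Continuous f₂' := by simp only [hf₂', smoothStepDeriv]; fun_prop
  have hcf₁ : Continuous f₁ := by simp only [hf₁, smoothStep]; fun_prop
  have hcf₂ : Continuous f₂ := by simp only [hf₂, smoothStep]; fun_prop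
  have e₁ : f₁' (1 / 2) = 0 := by simp [hf₁', smoothStepDeriv]
  have e₂ : f₂' (1 / 2) = 0 := by simp [hf₂', smoothStepDeriv]
  have v₁ : f₁ (1 / 2) = 1 := by simp only [hf₁, smoothStep]; norm_num
  have v₂ : f₂ (1 / 2) = 0 := by simp only [hf₂, smoothStep]; norm_num
  have w₁ : f₁ 0 = 0 := by simp [hf₁, smoothStep]
  have w₂ : f₂ 1 = 1 := by simp only [hf₂, smoothStep]; norm_num
  set γ : ℝ → G := fun t => if t ≤ 1 / 2 then γ₁ (f₁ t) else γ₂ (f₂ t) with hγ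
  set u : ℝ → W := fun t => if t ≤ 1 / 2 then f₁' t • u₁ (f₁ t) else f₂' t • u₂ (f₂ t) with hu
  have hγ₁ : ∀ t ∈ Icc (0 : ℝ) (1 / 2), γ t = γ₁ (f₁ t) := fun t ht => if_pos ht.2
  have hu₁ : ∀ t ∈ Icc (0 : ℝ) (1 / 2), u t = f₁' t • u₁ (f₁ t) := fun t ht => if_pos ht.2
  have hγ₂ : ∀ t ∈ Icc (1 / 2 : ℝ) 1, γ t = γ₂ (f₂ t) := by
    intro t ht
    rcases eq_or_lt_of_le ht.1 with h | h
    · subst h; simp only [hγ, le_refl, if_true, v₁, v₂, H₁.target, H₂.source]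
    · exact if_neg (not_le.2 h)
  have hu₂ : ∀ t ∈ Icc (1 / 2 : ℝ) 1, u t = f₂' t • u₂ (f₂ t) := by
    intro t ht
    rcases eq_or_lt_of_le ht.1 with h | h
    · subst h; simp only [hu, le_refl, if_true, e₁, e₂, zero_smul]
    · exact if_neg (not_le.2 h)
  have hunion : Icc (0 : ℝ) 1 = Icc 0 (1 / 2) ∪ Icc (1 / 2) 1 :=
    (Icc_union_Icc_eq_Icc (by norm_num) (by norm_num)).symm
  have hcu₁ : ContinuousOn u (Icc 0 (1 / 2)) :=
    (hc₁.continuousOn.smul (H₁.continuousOn.comp hcf₁.continuousOn hm₁)).congr hu₁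
  have hcu₂ : ContinuousOn u (Icc (1 / 2) 1) :=
    (hc₂.continuousOn.smul (H₂.continuousOn.comp hcf₂.continuousOn hm₂)).congr hu₂
  refine ⟨γ, u, ⟨?_, ?_, ?_, ?_⟩, ?_⟩
  · rw [hγ₁ 0 (by norm_num), w₁, H₁.source]
  · rw [hγ₂ 1 (by norm_num), w₂, H₂.target]
  · rw [hunion]; exact hcu₁.union_of_isClosed hcu₂ isClosed_Icc isClosed_Icc
  · intro t _
    rw [hunion]
    refine HasLeftVel.union ?_ ?_
    · by_cases h : t ∈ Icc (0 : ℝ) (1 / 2)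
      · rw [hu₁ t h]
        exact (H₁.hasLeftVel_comp (hd₁ t).hasDerivWithinAt hm₁ h).congr hγ₁ h
      · exact hasLeftVel_of_notMem_closure _ (by rwa [isClosed_Icc.closure_eq])
    · by_cases h : t ∈ Icc (1 / 2 : ℝ) 1
      · rw [hu₂ t h]
        exact (H₂.hasLeftVel_comp (hd₂ t).hasDerivWithinAt hm₂ h).congr hγ₂ h
      · exact hasLeftVel_of_notMem_closure _ (by rwa [isClosed_Icc.closure_eq])
  · have hi₁ : IntervalIntegrable (fun t => p (u t)) MeasureTheory.volume 0 (1 / 2) :=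
      (hp.continuous.comp_continuousOn hcu₁).intervalIntegrable_of_Icc (by norm_num)
    have hi₂ : IntervalIntegrable (fun t => p (u t)) MeasureTheory.volume (1 / 2) 1 :=
      (hp.continuous.comp_continuousOn hcu₂).intervalIntegrable_of_Icc (by norm_num)
    rw [← intervalIntegral.integral_add_adjacent_intervals hi₁ hi₂]
    have j₁ : ∫ t in (0 : ℝ)..(1 / 2), p (u t) = ∫ t in (0 : ℝ)..1, p (u₁ t) := by
      rw [← hp.integral_comp H₁.continuousOn (by norm_num) hd₁ hc₁ hm₁
        (fun t ht => mul_nonneg (smoothStepDeriv_nonneg (hm₁' t ht)) zero_le_two) w₁ v₁]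
      refine intervalIntegral.integral_congr fun t ht => ?_
      rw [uIcc_of_le (by norm_num)] at ht
      simp only [hu₁ t ht]
    have j₂ : ∫ t in (1 / 2 : ℝ)..1, p (u t) = ∫ t in (0 : ℝ)..1, p (u₂ t) := by
      rw [← hp.integral_comp H₂.continuousOn (by norm_num) hd₂ hc₂ hm₂
        (fun t ht => mul_nonneg (smoothStepDeriv_nonneg (hm₂' t ht)) zero_le_two) v₂ w₂]
      refine intervalIntegral.integral_congr fun t ht => ?_
      rw [uIcc_of_le (by norm_num)] at ht
      simp only [hu₂ t ht]
    rw [j₁, j₂]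
    exact add_lt_add hL hM

lemma reach_isOneParam (hp : IsLength p) {c : ℝ → G} {X : W} (hc : IsOneParam c (X : Model n))
    {t L : ℝ} (hL : |t| * p X < L) : Reach p 1 (c t) L := by
  refine ⟨fun τ => c (t * τ), fun _ => t • X, ⟨by simp [hc.map_zero], by simp, continuousOn_const,
    fun τ hτ => ?_⟩, ?_⟩
  · have h : HasDerivWithinAt (fun τ : ℝ => t * τ) t (Icc 0 1) τ := by
      simpa using ((hasDerivAt_id τ).const_mul t).hasDerivWithinAt
    exact (hc.hasLeftVel (t * τ)).comp h (mapsTo_univ _ _)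
  · simpa [hp.smul] using hL

variable [LieGroup (𝓡 n) ∞ G]

lemma IsHorizontal.const_mul {g h : G} {γ : ℝ → G} {u : ℝ → W} (H : IsHorizontal W g h γ u)
    (a : G) : IsHorizontal W (a * g) (a * h) (fun t => a * γ t) u :=
  ⟨by rw [H.source], by rw [H.target], H.continuousOn, fun t ht => (H.hasLeftVel t ht).const_mul a⟩

lemma Reach.const_mul {g h : G} {L : ℝ} (hr : Reach p g h L) (a : G) :
    Reach p (a * g) (a * h) L := by
  obtain ⟨γ, u, H, hL⟩ := hr
  exact ⟨_, u, H.const_mul a, hL⟩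

lemma isHorizontalCurve_iff {g h : G} {γ : ℝ → G}
    {u : ℝ → W} :
    IsHorizontalCurve W g h γ u ↔ IsHorizontal W g h γ u := by
  constructor
  · intro H
    exact ⟨H.source, H.target, H.continuousOn,
      fun t ht => (hasMFDerivWithinAt_iff_hasLeftVel _).1 (H.hasDeriv t ht)⟩
  · intro H
    exact ⟨H.source, H.target, H.continuousOn,
      fun t ht => (hasMFDerivWithinAt_iff_hasLeftVel _).2 (H.hasLeftVel t ht)⟩

/-- The relation `Reach` describes the balls of the Carnot-Carathéodory distance. -/
lemma ccEDist_lt_iff {B : LinearMap.BilinForm ℝ W} (hpB : ∀ w : W, p w = √(B w w))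
    (hp : IsLength p) {g h : G} {L : ℝ} (hL : 0 < L) :
    ccEDist W B g h < ENNReal.ofReal L ↔ Reach p g h L := by
  have key : ∀ {γ : ℝ → G} {u : ℝ → W}, IsHorizontalCurve W g h γ u →
      ∫⁻ t in Set.Icc (0 : ℝ) 1, ENNReal.ofReal (√(B (u t) (u t))) =
        ENNReal.ofReal (∫ t in (0 : ℝ)..1, p (u t)) := by
    intro γ u H
    have hc : ContinuousOn (fun t => p (u t)) (Icc 0 1) :=
      hp.continuous.comp_continuousOn H.continuousOn
    rw [intervalIntegral.integral_of_le zero_le_one, ← MeasureTheory.integral_Icc_eq_integral_Ioc,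
      MeasureTheory.ofReal_integral_eq_lintegral_ofReal hc.integrableOn_Icc
        (Eventually.of_forall fun t => hp.nonneg _)]
    simp only [hpB]
  simp only [ccEDist, iInf_lt_iff]
  constructor
  · rintro ⟨γ, u, H, h1⟩
    exact ⟨γ, u, isHorizontalCurve_iff.1 H,
      (ENNReal.ofReal_lt_ofReal_iff hL).1 (lt_of_eq_of_lt (key H).symm h1)⟩
  · rintro ⟨γ, u, H, h1⟩
    exact ⟨γ, u, isHorizontalCurve_iff.2 H, lt_of_eq_of_lt (key (isHorizontalCurve_iff.2 H))
      ((ENNReal.ofReal_lt_ofReal_iff hL).2 h1)⟩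

end Horizontal

/-! ### Chow's theorem near the identity -/

section Chow

variable {n : ℕ} {G : Type*} [TopologicalSpace G] [ChartedSpace (Model n) G] [Group G]
  {W : Submodule ℝ (Model n)} {p : W → ℝ}

lemma reach_self (hp : IsLength p) (g : G) {L : ℝ} (hL : 0 < L) : Reach p g g L := by
  have h0 : p 0 = 0 := by simpa using hp.smul 0 0
  refine ⟨fun _ => g, fun _ => 0, ⟨rfl, rfl, continuousOn_const, fun t _ => ?_⟩,
    by simpa [h0] using hL⟩
  exact hasLeftVel_const g _ t

lemma Reach.exists_lt {g h : G} {L : ℝ} (hr : Reach p g h L) : ∃ L' < L, Reach p g h L' := by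
  obtain ⟨γ, u, H, hL⟩ := hr
  obtain ⟨L', h1, h2⟩ := exists_between hL
  exact ⟨L', h2, γ, u, H, h1⟩

lemma mem_of_hasDerivAt_of_eventually {E : Type*} [NormedAddCommGroup E] [NormedSpace ℝ E]
    [FiniteDimensional ℝ E] {S : Submodule ℝ E} {f : ℝ → E} {f' : E} {t : ℝ}
    (hf : HasDerivAt f f' t) (hS : ∀ᶠ τ in 𝓝 t, f τ ∈ S) : f' ∈ S := by
  have h1 := hasDerivAt_iff_tendsto_slope.1 hf
  refine S.closed_of_finiteDimensional.mem_of_tendsto h1 ?_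
  filter_upwards [hS.filter_mono nhdsWithin_le_nhds] with τ hτ
  exact S.smul_mem _ (S.sub_mem hτ hS.self_of_nhds)

variable [LieGroup (𝓡 n) ∞ G]

lemma Reach.inv (hp : IsLength p) {h : G} {L : ℝ} (hr : Reach p 1 h L) : Reach p 1 h⁻¹ L := by
  have := hr.const_mul h⁻¹
  rw [mul_one, inv_mul_cancel] at this
  exact this.symm hp

lemma Reach.mul (hp : IsLength p) {g h : G} {L M : ℝ} (hg : Reach p 1 g L) (hh : Reach p 1 h M) :
    Reach p 1 (g * h) (L + M) := by
  have := hh.const_mul g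
  rw [mul_one] at this
  exact hg.trans hp this

/-- The layers `V 1, V 2, …` span the model space and the brackets of the first layer with each
layer span the next one. -/
structure IsStratified (n : ℕ) (G : Type*) [TopologicalSpace G] [ChartedSpace (Model n) G]
    [Group G] (V : ℕ → Submodule ℝ (Model n)) : Prop where
  zero_layer : V 0 = ⊥
  iSup_eq_top : ⨆ j, V j = ⊤
  le_span : ∀ j, 1 ≤ j →
    V (j + 1) ≤ Submodule.span ℝ {z | ∃ x ∈ V 1, ∃ y ∈ V j, ad n G x y = z}

/-- The conjugates of horizontal vectors by points close to the identity for the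
Carnot-Carathéodory distance span the Lie algebra: their span is invariant under `ad u` for
horizontal `u`, since `Ad (h * exp (t u)) v` has derivative `Ad h ⁅u, v⁆` at `0`. -/
lemma span_Ad_eq_top [T2Space G] {V : ℕ → Submodule ℝ (Model n)} (hV : IsStratified n G V)
    {p : V 1 → ℝ} (hp : IsLength p) {ε : ℝ} (hε : 0 < ε) :
    Submodule.span ℝ {z | ∃ (h : G) (X : V 1), Reach p 1 h ε ∧ Ad h (X : Model n) = z} = ⊤ := by
  set S := Submodule.span ℝ {z | ∃ (h : G) (X : V 1), Reach p 1 h ε ∧ Ad h (X : Model n) = z}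
  have key : ∀ j, 1 ≤ j → ∀ v ∈ V j, ∀ h : G, Reach p 1 h ε → Ad h v ∈ S := by
    intro j hj
    induction j, hj using Nat.le_induction with
    | base => exact fun v hv h hh => Submodule.subset_span ⟨h, ⟨v, hv⟩, hh, rfl⟩
    | succ j hj ih =>
      intro v hv h hh
      have h1 := hV.le_span j hj hv
      have h2 : Submodule.span ℝ {z | ∃ x ∈ V 1, ∃ y ∈ V j, ad n G x y = z} ≤
          S.comap ((Ad h : Model n →L[ℝ] Model n) : Model n →ₗ[ℝ] Model n) := by
        rw [Submodule.span_le]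
        rintro z ⟨x, hx, y, hy, rfl⟩
        obtain ⟨c, hc⟩ := exists_isOneParam (G := G) x
        obtain ⟨L, hL, hL'⟩ := hh.exists_lt
        have h3 : HasDerivAt (fun t => Ad h ((Ad (c t) : Model n →L[ℝ] Model n) y))
            (Ad h (ad n G x y)) 0 := by
          have h4 := (hc.hasDerivAt_Ad 0).clm_apply (hasDerivAt_const 0 y)
          have h5 := (Ad h : Model n →L[ℝ] Model n).hasFDerivAt.comp_hasDerivAt 0 h4
          simpa [hc.map_zero, Function.comp_def] using h5
        show Ad h (ad n G x y) ∈ S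
        refine mem_of_hasDerivAt_of_eventually h3 ?_
        have h4 : ∀ᶠ t : ℝ in 𝓝 0, |t| * p ⟨x, hx⟩ < ε - L := by
          have : Tendsto (fun t : ℝ => |t| * p ⟨x, hx⟩) (𝓝 0) (𝓝 0) :=
            Continuous.tendsto' (by fun_prop) _ _ (by simp)
          exact this.eventually_lt_const (by linarith)
        filter_upwards [h4] with t ht
        have h5 : Reach p 1 (h * c t) ε := by
          have := hL'.mul hp (reach_isOneParam hp (X := ⟨x, hx⟩) hc ht)
          rwa [add_sub_cancel] at this
        have := ih y hy _ h5
        rwa [Ad_mul] at this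
      exact h2 h1
  rw [eq_top_iff, ← hV.iSup_eq_top]
  refine iSup_le fun j v hv => ?_
  rcases Nat.eq_zero_or_pos j with rfl | hj
  · rw [hV.zero_layer] at hv
    rw [(Submodule.mem_bot ℝ).1 hv]; exact S.zero_mem
  · simpa using key j hj v hv 1 (reach_self hp 1 hε)

/-- A product of points reached by curves of length less than `L` is reached with the sum of the
lengths; the extra summand `L` covers the empty product. -/
lemma reach_curveProd {ι : Type*} (hp : IsLength p) {c : ι → ℝ → G} {y : ι → ℝ} {L : ℝ} (hL : 0 < L)
    (h : ∀ i, Reach p 1 (c i (y i)) L) (l : List ι) :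
    Reach p 1 (curveProd c l y) ((l.length + 1) * L) := by
  induction l with
  | nil => simpa using reach_self hp 1 hL
  | cons i l ih =>
    rw [curveProd_cons]
    have := (h i).mul hp ih
    refine this.mono (le_of_eq ?_)
    push_cast [List.length_cons]; ring

/-- Points close to the identity can be reached by short horizontal curves. -/
theorem eventually_reach [T2Space G] {V : ℕ → Submodule ℝ (Model n)} (hV : IsStratified n G V)
    {p : V 1 → ℝ} (hp : IsLength p) {ε : ℝ} (hε : 0 < ε) : ∀ᶠ g in 𝓝 (1 : G), Reach p 1 g ε := by
  -- A product of `n` conjugates, each of three factors shorter than `ε'`, is shorter than `ε`.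
  set ε' : ℝ := ε / (3 * (n + 1)) with hε'
  have hε'0 : 0 < ε' := by positivity
  have hspan := span_Ad_eq_top (G := G) hV hp hε'0
  set s := {z | ∃ (h : G) (X : V 1), Reach p 1 h ε' ∧ Ad h (X : Model n) = z} with hs
  let b := Module.Basis.ofSpan hspan.ge
  let κ := ((linearIndepOn_empty ℝ (id : Model n → Model n)).extend (empty_subset s))
  have : Fintype κ := FiniteDimensional.fintypeBasisIndex b
  have hb : ∀ i : κ, ∃ (h : G) (X : V 1), Reach p 1 h ε' ∧ Ad h (X : Model n) = b i := fun i =>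
    Module.Basis.ofSpan_subset hspan.ge (mem_range_self i)
  choose h X hh hX using hb
  choose c hc using fun i => exists_isOneParam (G := G) (X i : Model n)
  have hc' : ∀ i, IsOneParam (fun t => h i * c i t * (h i)⁻¹) (b i) := fun i => by
    rw [← hX i]; exact (hc i).conj (h i)
  obtain ⟨β, hβ1, hβ0, -, hβ⟩ := exists_log (G := G) b hc'
  have hsmall : ∀ᶠ y in 𝓝 (0 : κ → ℝ), ∀ i, |y i| * p (X i) < ε' := by
    rw [eventually_all]
    intro i
    have : Tendsto (fun y : κ → ℝ => |y i| * p (X i)) (𝓝 0) (𝓝 0) :=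
      Continuous.tendsto' (by fun_prop) _ _ (by simp)
    exact this.eventually_lt_const hε'0
  have ht : Tendsto (fun g : G => β (chart n g)) (𝓝 1) (𝓝 0) := by
    have h1 := hβ1.continuousAt
    rw [ContinuousAt, hβ0] at h1
    exact h1.comp tendsto_chart
  filter_upwards [ht.eventually hsmall, hβ] with g h1 h2
  rw [← h2]
  have h3 : ∀ i, Reach p 1 (h i * c i (β (chart n g) i) * (h i)⁻¹) (3 * ε') := fun i => by
    have := ((hh i).mul hp (reach_isOneParam hp (hc i) (h1 i))).mul hp ((hh i).inv hp)
    exact this.mono (by linarith)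
  refine (reach_curveProd hp (by positivity) h3 _).mono ?_
  have hcard : (Finset.univ.toList : List κ).length = n := by
    rw [Finset.length_toList, Finset.card_univ, ← Module.finrank_eq_card_basis b]
    simp
  rw [hcard, hε']
  apply le_of_eq
  field_simp

end Chow

/-! ### Weighted boxes and dilations -/

section Box

variable {ι : Type*}

/-- The weighted box `{y | ∀ i, |y i| ≤ r ^ w i}`. -/
def box (w : ι → ℕ) (r : ℝ) : Set (ι → ℝ) := Icc (fun i => -(r ^ w i)) (fun i => r ^ w i)

/-- The dilation `y ↦ (r ^ w i * y i)`. -/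
def coordDil (w : ι → ℕ) (r : ℝ) (y : ι → ℝ) : ι → ℝ := fun i => r ^ w i * y i

variable {w : ι → ℕ}

lemma mem_box {r : ℝ} {y : ι → ℝ} : y ∈ box w r ↔ ∀ i, |y i| ≤ r ^ w i := by
  simp only [box, mem_Icc, Pi.le_def, abs_le, forall_and]

lemma isCompact_box (r : ℝ) : IsCompact (box w r) := isCompact_Icc

lemma zero_mem_box {r : ℝ} (hr : 0 ≤ r) : (0 : ι → ℝ) ∈ box w r :=
  mem_box.2 fun i => by simpa using pow_nonneg hr _

lemma box_mono {r s : ℝ} (hr : 0 ≤ r) (hrs : r ≤ s) : box w r ⊆ box w s := fun _ hy =>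
  mem_box.2 fun i => (mem_box.1 hy i).trans (pow_le_pow_left₀ hr hrs _)

lemma coordDil_mem_box {r s : ℝ} (hr : 0 ≤ r) {y : ι → ℝ} (hy : y ∈ box w s) :
    coordDil w r y ∈ box w (r * s) := mem_box.2 fun i => by
  rw [coordDil, abs_mul, abs_of_nonneg (pow_nonneg hr _), mul_pow]
  exact mul_le_mul_of_nonneg_left (mem_box.1 hy i) (pow_nonneg hr _)

lemma coordDil_coordDil (r s : ℝ) (y : ι → ℝ) :
    coordDil w r (coordDil w s y) = coordDil w (r * s) y := by
  funext i; simp only [coordDil, mul_pow, mul_assoc]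

@[simp] lemma coordDil_one (y : ι → ℝ) : coordDil w 1 y = y := by
  funext i; simp [coordDil]

@[simp] lemma coordDil_zero (r : ℝ) : coordDil w r 0 = 0 := by
  funext i; simp [coordDil]

lemma hasDerivWithinAt_coordDil {r : ℝ} {y : ℝ → ι → ℝ} {y' : ι → ℝ} {S : Set ℝ} {t : ℝ}
    (hy : HasDerivWithinAt y y' S t) :
    HasDerivWithinAt (fun τ => coordDil w r (y τ)) (coordDil w r y') S t :=
  hasDerivWithinAt_pi.2 fun i => (hasDerivWithinAt_pi.1 hy i).const_mul _

variable [Fintype ι]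

lemma box_subset_of_mem_nhds (hw : ∀ i, 1 ≤ w i) {N : Set (ι → ℝ)} (hN : N ∈ 𝓝 0) :
    ∃ r, 0 < r ∧ r ≤ 1 ∧ box w r ⊆ N := by
  obtain ⟨ε, hε, h⟩ := Metric.mem_nhds_iff.1 hN
  refine ⟨min 1 (ε / 2), by positivity, min_le_left _ _, fun y hy => h ?_⟩
  rw [mem_ball_zero_iff]
  refine lt_of_le_of_lt ((pi_norm_le_iff_of_nonneg (by positivity)).2 fun i => ?_) (half_lt_self hε)
  refine (mem_box.1 hy i).trans ((pow_le_of_le_one (by positivity) (min_le_left _ _)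
    (Nat.one_le_iff_ne_zero.1 (hw i))).trans (min_le_right _ _))

lemma volume_box {r : ℝ} (hr : 0 ≤ r) : MeasureTheory.volume (box w r) =
    ENNReal.ofReal (2 ^ Fintype.card ι * r ^ (∑ i, w i)) := by
  rw [box, Real.volume_Icc_pi, ← ENNReal.ofReal_prod_of_nonneg]
  · congr 1
    rw [← Finset.prod_pow_eq_pow_sum, ← Finset.card_univ, ← Finset.prod_const,
      ← Finset.prod_mul_distrib]
    exact Finset.prod_congr rfl fun i _ => by ring
  · intro i _
    have := pow_nonneg hr (w i)
    linarith

end Box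

/-! ### Homogeneity of the Maurer-Cartan form -/

section Graded

variable {n : ℕ} {G : Type*} [TopologicalSpace G] [ChartedSpace (Model n) G] [Group G]
  {ι : Type*} [Fintype ι] {W : Submodule ℝ (Model n)}

/-- A basis `b` of the Lie algebra with positive weights `w`, together with the dilations `D r`:
these multiply `b i` by `r ^ w i` and horizontal vectors by `r`, and are compatible with the
bracket. -/
structure IsGradedBasis (G : Type*) [TopologicalSpace G] [ChartedSpace (Model n) G] [Group G]
    (W : Submodule ℝ (Model n)) (b : Module.Basis ι ℝ (Model n)) (w : ι → ℕ)
    (D : ℝ → Model n →L[ℝ] Model n) : Prop where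
  one_le : ∀ i, 1 ≤ w i
  map_basis : ∀ r i, D r (b i) = r ^ w i • b i
  map_horizontal : ∀ r, ∀ u ∈ W, D r u = r • u
  comp_ad : ∀ r i, (D r).comp (ad n G (b i)) = r ^ w i • (ad n G (b i)).comp (D r)

variable {b : Module.Basis ι ℝ (Model n)} {w : ι → ℕ} {D : ℝ → Model n →L[ℝ] Model n}
  {c : ι → ℝ → G} [LieGroup (𝓡 n) ∞ G]

omit [Fintype ι] in
/-- Dilations intertwine the adjoint actions of a point and of the point with dilated
coordinates. -/
lemma IsGradedBasis.comp_Ad_curveProd (hD : IsGradedBasis G W b w D)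
    (hc : ∀ i, IsOneParam (c i) (b i)) (r : ℝ) (l : List ι) (y : ι → ℝ) :
    (D r).comp (Ad (curveProd c l y)) = (Ad (curveProd c l (coordDil w r y))).comp (D r) := by
  induction l with
  | nil => simp
  | cons i l ih =>
    rw [curveProd_cons, Ad_mul, ← ContinuousLinearMap.comp_assoc, (hc i).comp_Ad (hD.comp_ad r i),
      ContinuousLinearMap.comp_assoc, ih, ← ContinuousLinearMap.comp_assoc, ← Ad_mul,
      curveProd_cons]
    rfl

omit [Fintype ι] in
lemma IsGradedBasis.comp_Ad_curveProd_inv (hD : IsGradedBasis G W b w D)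
    (hc : ∀ i, IsOneParam (c i) (b i)) (r : ℝ) (l : List ι) (y : ι → ℝ) :
    (D r).comp (Ad (curveProd c l y)⁻¹) = (Ad (curveProd c l (coordDil w r y))⁻¹).comp (D r) := by
  have h := hD.comp_Ad_curveProd hc r l y
  calc (D r).comp (Ad (curveProd c l y)⁻¹)
      = (Ad (curveProd c l (coordDil w r y))⁻¹).comp
          (((Ad (curveProd c l (coordDil w r y))).comp (D r)).comp (Ad (curveProd c l y)⁻¹)) := by
        rw [ContinuousLinearMap.comp_assoc, ← ContinuousLinearMap.comp_assoc, Ad_inv_comp,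
          ContinuousLinearMap.id_comp]
    _ = _ := by
        rw [← h, ContinuousLinearMap.comp_assoc, Ad_comp_inv, ContinuousLinearMap.comp_id]

omit [Fintype ι] in
/-- In coordinates of the second kind, the left-invariant Maurer-Cartan form is homogeneous for the
dilations. -/
lemma IsGradedBasis.map_curveProdVel (hD : IsGradedBasis G W b w D)
    (hc : ∀ i, IsOneParam (c i) (b i)) (r : ℝ) (l : List ι) (y s : ι → ℝ) :
    D r (curveProdVel c b l y s) = curveProdVel c b l (coordDil w r y) (coordDil w r s) := by
  induction l with
  | nil => simp [curveProdVel]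
  | cons i l ih =>
    have h := DFunLike.congr_fun (hD.comp_Ad_curveProd_inv hc r l y) (b i)
    simp only [ContinuousLinearMap.comp_apply, hD.map_basis, map_smul] at h
    simp only [curveProdVel, add_apply, ContinuousLinearMap.comp_apply,
      ContinuousLinearMap.proj_apply, ContinuousLinearMap.toSpanSingleton_apply, map_add, map_smul,
      h, ih, coordDil, smul_smul, mul_comm (r ^ w i)]

/-- The product in coordinates of the second kind, over all basis vectors. -/
abbrev expProd (c : ι → ℝ → G) : (ι → ℝ) → G := curveProd c Finset.univ.toList

/-- The Maurer-Cartan form in coordinates of the second kind. -/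
abbrev expVel (c : ι → ℝ → G) (b : Module.Basis ι ℝ (Model n)) :
    (ι → ℝ) → (ι → ℝ) →L[ℝ] Model n := curveProdVel c b Finset.univ.toList

/-- Coordinates of the second kind `lg`, defined on an open neighbourhood `N` of the identity and
controlled on the weighted box of size `r`. -/
structure IsLogBox (c : ι → ℝ → G) (b : Module.Basis ι ℝ (Model n)) (w : ι → ℕ)
    (lg : G → ι → ℝ) (N : Set G) (r C : ℝ) (K : ℝ≥0) : Prop where
  r_pos : 0 < r
  r_le_one : r ≤ 1
  C_pos : 0 < C
  isOpen : IsOpen N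
  right_inv : ∀ g ∈ N, expProd c (lg g) = g
  continuousOn : ContinuousOn lg N
  diff : ∀ g ∈ N, ∀ (γ : ℝ → G) (S : Set ℝ) (t : ℝ) (u : Model n), HasLeftVel γ S t u → t ∈ S →
    γ t = g → ∃ y', HasDerivWithinAt (fun τ => lg (γ τ)) y' S t
  mem : ∀ y ∈ box w r, expProd c y ∈ N
  left_inv : ∀ y ∈ box w r, lg (expProd c y) = y
  bound : ∀ y ∈ box w r, ∀ s, ‖s‖ ≤ C * ‖expVel c b y s‖
  lipschitz : ∀ a ∈ box w r, LipschitzOnWith K (fun z => lg (expProd c a * expProd c z)) (box w r)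

omit [LieGroup (𝓡 n) ∞ G] in
lemma expVel_zero (hc : ∀ i, c i 0 = 1) (s : ι → ℝ) : expVel c b 0 s = b.equivFun.symm s := by
  rw [expVel, curveProdVel_zero hc, Finset.sum_map_toList, Module.Basis.equivFun_symm_apply]

/-- Close to the identity the velocity of the coordinates is bounded by the left velocity. -/
lemma eventually_bound (hc : ∀ i, IsOneParam (c i) (b i)) :
    ∃ C : ℝ, 0 < C ∧ ∀ᶠ y in 𝓝 (0 : ι → ℝ), ∀ s, ‖s‖ ≤ C * ‖expVel c b y s‖ := by
  let e : (ι → ℝ) ≃L[ℝ] Model n := b.equivFun.symm.toContinuousLinearEquiv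
  have he : expVel c b 0 = (e : (ι → ℝ) →L[ℝ] Model n) := by
    ext1 s; exact expVel_zero (fun i => (hc i).map_zero) s
  obtain ⟨C, hC, hCe⟩ : ∃ C : ℝ, 0 < C ∧ ∀ s, ‖s‖ ≤ C * ‖e s‖ := by
    refine ⟨‖(e.symm : Model n →L[ℝ] ι → ℝ)‖ + 1, by positivity, fun s => ?_⟩
    have h1 := (e.symm : Model n →L[ℝ] ι → ℝ).le_opNorm (e s)
    simp only [ContinuousLinearEquiv.coe_coe, ContinuousLinearEquiv.symm_apply_apply] at h1
    nlinarith [norm_nonneg (e s)]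
  refine ⟨2 * C, by positivity, ?_⟩
  have h1 : ∀ᶠ y in 𝓝 (0 : ι → ℝ), ‖expVel c b y - expVel c b 0‖ < 1 / (2 * C) := by
    have := (continuous_curveProdVel hc Finset.univ.toList).tendsto 0
    have h2 := (tendsto_iff_norm_sub_tendsto_zero.1 this)
    exact h2.eventually_lt_const (by positivity)
  filter_upwards [h1] with y hy s
  have h2 : ‖(expVel c b y - expVel c b 0) s‖ ≤ 1 / (2 * C) * ‖s‖ :=
    (ContinuousLinearMap.le_opNorm _ s).trans (mul_le_mul_of_nonneg_right hy.le (norm_nonneg _))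
  have h3 : ‖e s‖ ≤ ‖expVel c b y s‖ + 1 / (2 * C) * ‖s‖ := by
    rw [sub_apply, he, ContinuousLinearEquiv.coe_coe] at h2
    have := norm_sub_norm_le (e s) (expVel c b y s)
    rw [norm_sub_rev] at this
    linarith
  have h4 : ‖s‖ ≤ C * ‖expVel c b y s‖ + ‖s‖ / 2 := by
    have h5 := (hCe s).trans (mul_le_mul_of_nonneg_left h3 hC.le)
    have h6 : C * (‖expVel c b y s‖ + 1 / (2 * C) * ‖s‖) = C * ‖expVel c b y s‖ + ‖s‖ / 2 := by
      field_simp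
    linarith
  linarith

/-- In coordinates, left translations by points close to the identity are uniformly Lipschitz. -/
lemma eventually_lipschitz (hc : ∀ i, IsOneParam (c i) (b i)) {β : Model n → ι → ℝ}
    (hβ : ContDiffAt ℝ 1 β (origin n G)) :
    ∃ K : ℝ≥0, ∃ U ∈ 𝓝 (0 : ι → ℝ), ∀ a ∈ U,
      LipschitzOnWith K (fun z => β (chart n (expProd c a * expProd c z))) U := by
  have h1 : ContDiffAt ℝ 1 (fun q : (ι → ℝ) × (ι → ℝ) =>
      β (chart n (expProd c q.1 * expProd c q.2))) (0, 0) := by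
    have hP0 : expProd c 0 = 1 := curveProd_zero (fun i => (hc i).map_zero) _
    have hP : ContMDiffAt 𝓘(ℝ, ι → ℝ) (𝓡 n) 1 (expProd c) 0 :=
      contMDiffAt_curveProd hc _
    have hP1 : ContMDiffAt 𝓘(ℝ, (ι → ℝ) × (ι → ℝ)) (𝓡 n) 1
        (fun q : (ι → ℝ) × (ι → ℝ) => expProd c q.1) (0, 0) :=
      ContMDiffAt.comp (I' := 𝓘(ℝ, ι → ℝ)) (g := expProd c)
        (f := fun q : (ι → ℝ) × (ι → ℝ) => q.1) (0, 0) hP contDiffAt_fst.contMDiffAt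
    have hP2 : ContMDiffAt 𝓘(ℝ, (ι → ℝ) × (ι → ℝ)) (𝓡 n) 1
        (fun q : (ι → ℝ) × (ι → ℝ) => expProd c q.2) (0, 0) :=
      ContMDiffAt.comp (I' := 𝓘(ℝ, ι → ℝ)) (g := expProd c)
        (f := fun q : (ι → ℝ) × (ι → ℝ) => q.2) (0, 0) hP contDiffAt_snd.contMDiffAt
    have : LieGroup (𝓡 n) 1 G := LieGroup.of_le one_le_infty
    have h2 : ContDiffAt ℝ 1 (fun q : (ι → ℝ) × (ι → ℝ) =>
        chart n (expProd c q.1 * expProd c q.2)) (0, 0) :=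
      contDiffAt_chart_comp one_le_infty (hP1.mul hP2) (by simp [hP0])
    refine ContDiffAt.comp (g := β) (0, 0) ?_ h2
    simpa [hP0, origin] using hβ
  obtain ⟨K, U, hU, hK⟩ := h1.exists_lipschitzOnWith
  obtain ⟨U₁, hU₁, U₂, hU₂, h3⟩ := mem_nhds_prod_iff.1 hU
  refine ⟨K, U₁ ∩ U₂, inter_mem hU₁ hU₂, fun a ha => ?_⟩
  refine LipschitzOnWith.of_dist_le_mul fun z hz z' hz' => ?_
  have := hK.dist_le_mul (a, z) (h3 ⟨ha.1, hz.2⟩) (a, z') (h3 ⟨ha.1, hz'.2⟩)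
  simpa using this

lemma exists_isLogBox (hw : ∀ i, 1 ≤ w i) (hc : ∀ i, IsOneParam (c i) (b i)) :
    ∃ (lg : G → ι → ℝ) (N : Set G) (r C : ℝ) (K : ℝ≥0), IsLogBox c b w lg N r C K := by
  obtain ⟨β, hβ1, hβ0, hβl, hβr⟩ := exists_log (G := G) b hc
  obtain ⟨C, hC, hCb⟩ := eventually_bound (G := G) hc
  obtain ⟨K, U, hU, hK⟩ := eventually_lipschitz (G := G) hc hβ1
  have hβd : ∀ᶠ x in 𝓝 (origin n G), ContDiffAt ℝ 1 β x := hβ1.eventually (by simp)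
  have hch : ∀ᶠ g in 𝓝 (1 : G), ContinuousAt (chart n) g := by
    filter_upwards [extChartAt_source_mem_nhds (I := 𝓡 n) (1 : G)] with g hg
    exact continuousAt_extChartAt' hg
  obtain ⟨N, hN, hNo, hN1⟩ := eventually_nhds_iff.1 ((hβr.and (tendsto_chart.eventually hβd)).and
    (hch.and (eventually_hasDerivWithinAt_chart (n := n) (G := G))))
  have hP0 : expProd c 0 = 1 := curveProd_zero (fun i => (hc i).map_zero) _
  have hPN : ∀ᶠ y in 𝓝 (0 : ι → ℝ), expProd c y ∈ N := by
    have : Tendsto (expProd c) (𝓝 0) (𝓝 1) := (continuous_curveProd hc _).tendsto' _ _ hP0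
    exact this.eventually (hNo.mem_nhds hN1)
  obtain ⟨r, hr, hr1, hbox⟩ := box_subset_of_mem_nhds hw (((hPN.and hβl).and hCb).and hU)
  refine ⟨fun g => β (chart n g), N, r, C, K, hr, hr1, hC, hNo, fun g hg => (hN g hg).1.1, ?_, ?_,
    fun y hy => (hbox hy).1.1.1, fun y hy => (hbox hy).1.1.2, fun y hy => (hbox hy).1.2,
    fun a ha => (hK a (hbox ha).2).mono fun z hz => (hbox hz).2⟩
  · exact fun g hg => (ContinuousAt.comp (hN g hg).1.2.continuousAt
      (hN g hg).2.1).continuousWithinAt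
  · intro g hg γ S t u hγ ht hγt
    have h1 := (hN g hg).2.2 γ S t u hγ ht hγt
    have h2 := ((hN g hg).1.2.differentiableAt (by simp)).hasFDerivAt
    subst hγt
    exact ⟨_, h2.comp_hasDerivWithinAt t h1⟩

end Graded

/-! ### The ball-box theorem and separated sets -/

section BallBox

variable {n : ℕ} {G : Type*} [TopologicalSpace G] [ChartedSpace (Model n) G] [Group G]
  {ι : Type*} [Fintype ι] {W : Submodule ℝ (Model n)}
  {b : Module.Basis ι ℝ (Model n)} {w : ι → ℕ} {D : ℝ → Model n →L[ℝ] Model n}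
  {c : ι → ℝ → G} [LieGroup (𝓡 n) ∞ G] {lg : G → ι → ℝ} {N : Set G} {r C : ℝ} {K : ℝ≥0}
  {p : W → ℝ}

/-- The coordinates of a differentiable curve are differentiable, and the Maurer-Cartan form maps
their velocity to the left velocity of the curve. -/
lemma IsLogBox.hasDerivWithinAt_lg (hL : IsLogBox c b w lg N r C K)
    (hc : ∀ i, IsOneParam (c i) (b i)) {γ : ℝ → G} {S : Set ℝ} {t : ℝ} {u : Model n}
    (hγ : HasLeftVel γ S t u) (hS : UniqueDiffWithinAt ℝ S t) (ht : t ∈ S)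
    (hN : ∀ s ∈ S, γ s ∈ N) :
    ∃ y', HasDerivWithinAt (fun τ => lg (γ τ)) y' S t ∧ expVel c b (lg (γ t)) y' = u := by
  obtain ⟨y', hy'⟩ := hL.diff (γ t) (hN t ht) γ S t u hγ ht rfl
  refine ⟨y', hy', ?_⟩
  have h1 := (hasLeftVel_curveProd hc Finset.univ.toList hy' ht).congr
    (c' := γ) (fun s hs => (hL.right_inv _ (hN s hs)).symm) ht
  exact h1.unique hγ hS

/-- A horizontal curve which starts at the identity and stays in the weighted box of size `s * r`
satisfies the ball-box estimate at scale `s`: after dilation by `s⁻¹` it has bounded speed. -/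
lemma IsLogBox.norm_coordDil_le (hL : IsLogBox c b w lg N r C K) (hD : IsGradedBasis G W b w D)
    (hc : ∀ i, IsOneParam (c i) (b i)) (hp : IsLength p) {A : ℝ} (hA : 0 < A)
    (hpA : ∀ v : W, ‖(v : Model n)‖ ≤ A * p v) {g h : G} {γ : ℝ → G} {u : ℝ → W}
    (H : IsHorizontal W g h γ u) {s : ℝ} (hs : 0 < s) {T : ℝ} (hT : T ∈ Icc (0 : ℝ) 1)
    (h0 : lg (γ 0) = 0) (hN : ∀ t ∈ Icc 0 T, γ t ∈ N)
    (hbox : ∀ t ∈ Icc 0 T, lg (γ t) ∈ box w (s * r)) :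
    ‖coordDil w s⁻¹ (lg (γ T))‖ ≤ C * A * s⁻¹ * ∫ t in (0 : ℝ)..1, p (u t) := by
  have hTs : Icc 0 T ⊆ Icc (0 : ℝ) 1 := Icc_subset_Icc_right hT.2
  -- `u` is continuous on `[0, 1]` only; `v` extends it continuously.
  set v : ℝ → W := fun t => u (projIcc 0 1 zero_le_one t) with hv
  have hvc : Continuous fun t => p (v t) :=
    hp.continuous.comp (continuousOn_iff_continuous_domRestrict.1 H.continuousOn |>.comp
      continuous_projIcc)
  have hvu : ∀ t ∈ Icc (0 : ℝ) 1, v t = u t := fun t ht => by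
    simp only [hv, projIcc_of_mem zero_le_one ht]
  choose! y' hy' using fun t (ht : t ∈ Ico 0 T) => hL.hasDerivWithinAt_lg hc
    ((H.hasLeftVel t (hTs (Ico_subset_Icc_self ht))).mono hTs)
    (uniqueDiffOn_Icc (ht.1.trans_lt ht.2) t (Ico_subset_Icc_self ht)) (Ico_subset_Icc_self ht) hN
  have hγc : ContinuousOn γ (Icc 0 T) := fun t ht => (H.hasLeftVel t (hTs ht)).1.mono hTs
  have hcc : Continuous (coordDil w s⁻¹) := by unfold coordDil; fun_prop
  have hint : ∀ t, HasDerivAt (fun t => C * A * s⁻¹ * ∫ τ in (0 : ℝ)..t, p (v τ))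
      (C * A * s⁻¹ * p (v t)) t := fun t =>
    (hvc.integral_hasStrictDerivAt 0 t).hasDerivAt.const_mul _
  have key := image_norm_le_of_norm_deriv_right_le_deriv_boundary' (a := 0) (b := T)
    (f := fun t => coordDil w s⁻¹ (lg (γ t))) (f' := fun t => coordDil w s⁻¹ (y' t))
    (B := fun t => C * A * s⁻¹ * ∫ τ in (0 : ℝ)..t, p (v τ))
    (B' := fun t => C * A * s⁻¹ * p (v t)) ?_ ?_ ?_ ?_ ?_ ?_ (right_mem_Icc.2 hT.1)
  · refine key.trans (mul_le_mul_of_nonneg_left ?_ (by have := hL.C_pos; positivity))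
    have h1 : ∫ t in (0 : ℝ)..1, p (u t) = ∫ t in (0 : ℝ)..1, p (v t) :=
      intervalIntegral.integral_congr fun t ht => by
        rw [uIcc_of_le zero_le_one] at ht
        simp only [hvu t ht]
    rw [h1]
    exact intervalIntegral.integral_mono_interval le_rfl hT.1 hT.2
      (Eventually.of_forall fun t => hp.nonneg _) (hvc.intervalIntegrable _ _)
  · exact hcc.comp_continuousOn (hL.continuousOn.comp hγc hN)
  · intro t ht
    exact hasDerivWithinAt_coordDil ((hy' t ht).1.mono_of_mem_nhdsWithin (Icc_mem_nhdsGE_of_mem ht))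
  · simp [h0]
  · exact fun t _ => (hint t).continuousAt.continuousWithinAt
  · exact fun t _ => (hint t).hasDerivWithinAt
  · intro t ht
    have ht' := Ico_subset_Icc_self ht
    have h1 := hD.map_curveProdVel hc s⁻¹ Finset.univ.toList (lg (γ t)) (y' t)
    rw [show curveProdVel c b Finset.univ.toList (lg (γ t)) (y' t) = _ from (hy' t ht).2,
      hD.map_horizontal _ _ (u t).2] at h1
    have h2 : coordDil w s⁻¹ (lg (γ t)) ∈ box w r := by
      have := coordDil_mem_box (inv_nonneg.2 hs.le) (hbox t ht')
      rwa [inv_mul_cancel_left₀ hs.ne'] at this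
    refine (hL.bound _ h2 _).trans ?_
    rw [show expVel c b (coordDil w s⁻¹ (lg (γ t))) (coordDil w s⁻¹ (y' t)) = _ from h1.symm,
      norm_smul, Real.norm_eq_abs, abs_of_pos (inv_pos.2 hs), hvu t (hTs ht')]
    have h3 := hpA (u t)
    calc C * (s⁻¹ * ‖(u t : Model n)‖) ≤ C * (s⁻¹ * (A * p (u t))) := by
          have := hL.C_pos
          gcongr
      _ = _ := by ring

/-- Short horizontal curves from the identity stay in small weighted boxes. -/
lemma IsLogBox.exists_forall_mem_box [T2Space G] (hL : IsLogBox c b w lg N r C K)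
    (hD : IsGradedBasis G W b w D) (hc : ∀ i, IsOneParam (c i) (b i)) (hp : IsLength p) :
    ∃ ε : ℝ, 0 < ε ∧ ∀ s : ℝ, 0 < s → s ≤ 1 → ∀ (h : G) (γ : ℝ → G) (u : ℝ → W),
      IsHorizontal W 1 h γ u → ∫ t in (0 : ℝ)..1, p (u t) < s * ε →
      ∀ t ∈ Icc (0 : ℝ) 1, γ t ∈ expProd c '' box w (s * r) := by
  obtain ⟨A, hA, hpA⟩ := hp.norm_le
  have hC := hL.C_pos
  have hr := hL.r_pos
  -- Since `r ≤ 1`, the power `r ^ ∑ i, w i` is at most each of the side lengths `r ^ w i`.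
  refine ⟨r ^ (∑ i, w i) / (C * A), by positivity, fun s hs hs1 h γ u H hlen => ?_⟩
  have hsr : s * r ≤ r := mul_le_of_le_one_left hr.le hs1
  have hbb : box w (s * r) ⊆ box w r := box_mono (by positivity) hsr
  have hP0 : expProd c 0 = 1 := curveProd_zero (fun i => (hc i).map_zero) _
  have h0 : lg (γ 0) = 0 := by
    rw [H.source, ← hP0, hL.left_inv 0 (zero_mem_box hr.le)]
  -- `O` is the open box; the curve leaves it for the first time at `T`, if at all.
  set O : Set (ι → ℝ) := univ.pi fun i => Ioo (-((s * r) ^ w i)) ((s * r) ^ w i) with hO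
  have hOo : IsOpen O := isOpen_set_pi finite_univ fun i _ => isOpen_Ioo
  have hOb : O ⊆ box w (s * r) := fun y hy => mem_box.2 fun i => (abs_lt.2 (hy i (mem_univ i))).le
  have hQ : IsOpen (N ∩ lg ⁻¹' O) := hL.continuousOn.isOpen_inter_preimage hL.isOpen hOo
  have hQb : ∀ g ∈ N ∩ lg ⁻¹' O, g ∈ expProd c '' box w (s * r) := fun g hg =>
    ⟨lg g, hOb hg.2, hL.right_inv g hg.1⟩
  have hγc : ContinuousOn γ (Icc 0 1) := fun t ht => (H.hasLeftVel t ht).1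
  by_contra! hbad
  have hcl : IsCompact (Icc (0 : ℝ) 1 ∩ γ ⁻¹' (N ∩ lg ⁻¹' O)ᶜ) :=
    isCompact_Icc.of_isClosed_subset
      (hγc.preimage_isClosed_of_isClosed isClosed_Icc hQ.isClosed_compl) inter_subset_left
  obtain ⟨T, hT, hTmin⟩ := hcl.exists_isLeast (by
    obtain ⟨t, ht, ht'⟩ := hbad
    exact ⟨t, ht, fun h => ht' (hQb _ h)⟩)
  have hlt : ∀ t ∈ Ico 0 T, γ t ∈ expProd c '' box w (s * r) := fun t ht => by
    by_contra h
    exact (hTmin ⟨⟨ht.1, ht.2.le.trans hT.1.2⟩, fun h' => h (hQb _ h')⟩).not_gt ht.2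
  have hle : ∀ t ∈ Icc 0 T, γ t ∈ expProd c '' box w (s * r) := by
    rcases hT.1.1.eq_or_lt with hT0 | hT0
    · intro t ht
      have : t = 0 := le_antisymm (by rw [hT0]; exact ht.2) ht.1
      subst this
      exact ⟨0, zero_mem_box (by positivity), by rw [hP0, H.source]⟩
    · have h1 : IsClosed (Icc (0 : ℝ) 1 ∩ γ ⁻¹' (expProd c '' box w (s * r))) :=
        hγc.preimage_isClosed_of_isClosed isClosed_Icc
          ((isCompact_box _).image (continuous_curveProd hc _)).isClosed
      have h2 : Ico 0 T ⊆ Icc (0 : ℝ) 1 ∩ γ ⁻¹' (expProd c '' box w (s * r)) := fun t ht =>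
        ⟨⟨ht.1, ht.2.le.trans hT.1.2⟩, hlt t ht⟩
      have h3 := h1.closure_subset_iff.2 h2
      rw [closure_Ico hT0.ne] at h3
      exact fun t ht => (h3 ht).2
  have hN : ∀ t ∈ Icc 0 T, γ t ∈ N := fun t ht => by
    obtain ⟨y, hy, hyt⟩ := hle t ht
    rw [← hyt]; exact hL.mem y (hbb hy)
  have hb : ∀ t ∈ Icc 0 T, lg (γ t) ∈ box w (s * r) := fun t ht => by
    obtain ⟨y, hy, hyt⟩ := hle t ht
    rw [← hyt, hL.left_inv y (hbb hy)]; exact hy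
  have hest := hL.norm_coordDil_le hD hc hp hA hpA H hs hT.1 h0 hN hb
  refine hT.2 ⟨hN T (right_mem_Icc.2 hT.1.1), fun i _ => abs_lt.1 ?_⟩
  have h1 : |s⁻¹ ^ w i * lg (γ T) i| < r ^ w i := by
    refine lt_of_le_of_lt ((norm_le_pi_norm (coordDil w s⁻¹ (lg (γ T))) i).trans hest) ?_
    calc C * A * s⁻¹ * ∫ t in (0 : ℝ)..1, p (u t)
        < C * A * s⁻¹ * (s * (r ^ (∑ i, w i) / (C * A))) := by gcongr
      _ = r ^ (∑ i, w i) := by field_simp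
      _ ≤ r ^ w i := pow_le_pow_of_le_one hr.le hL.r_le_one
          (Finset.single_le_sum (fun _ _ => Nat.zero_le _) (Finset.mem_univ i))
  rw [abs_mul, abs_of_pos (pow_pos (inv_pos.2 hs) _), inv_pow, inv_mul_lt_iff₀ (by positivity),
    ← mul_pow] at h1
  exact h1

/-- The ball-box theorem: close to the identity, Carnot-Carathéodory balls of radius `s * ε` are
comparable to weighted boxes of size proportional to `s`. -/
lemma IsLogBox.exists_ballBox [T2Space G] (hL : IsLogBox c b w lg N r C K)
    (hD : IsGradedBasis G W b w D) (hc : ∀ i, IsOneParam (c i) (b i)) (hp : IsLength p)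
    (hchow : ∀ ε > 0, ∀ᶠ g in 𝓝 (1 : G), Reach p 1 g ε) :
    ∃ ε r' : ℝ, 0 < ε ∧ 0 < r' ∧ r' ≤ r ∧ ∀ s : ℝ, 0 < s → s ≤ 1 →
      (∀ g : G, Reach p 1 g (s * ε) → g ∈ expProd c '' box w (s * r)) ∧
      ∀ y ∈ box w (s * r'), Reach p 1 (expProd c y) (s * ε) := by
  obtain ⟨ε, hε, h1⟩ := hL.exists_forall_mem_box hD hc hp
  have hr := hL.r_pos
  have hP0 : expProd c 0 = 1 := curveProd_zero (fun i => (hc i).map_zero) _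
  have h2 : Tendsto (expProd c) (𝓝 0) (𝓝 1) := (continuous_curveProd hc _).tendsto' _ _ hP0
  obtain ⟨r₁, hr₁, -, h3⟩ := box_subset_of_mem_nhds hD.one_le (h2.eventually (hchow ε hε))
  refine ⟨ε, min r₁ r, hε, by positivity, min_le_right _ _, fun s hs hs1 => ⟨?_, ?_⟩⟩
  · rintro g ⟨γ, u, H, hlen⟩
    have := h1 s hs hs1 g γ u H hlen 1 (right_mem_Icc.2 zero_le_one)
    rwa [H.target] at this
  · intro y hy
    have hz : coordDil w s⁻¹ y ∈ box w (min r₁ r) := by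
      have := coordDil_mem_box (inv_nonneg.2 hs.le) hy
      rwa [inv_mul_cancel_left₀ hs.ne'] at this
    set z := coordDil w s⁻¹ y
    have hyz : coordDil w s z = y := by
      rw [coordDil_coordDil, mul_inv_cancel₀ hs.ne', coordDil_one]
    obtain ⟨γ, u, H, hlen⟩ := h3 (box_mono (by positivity) (min_le_left _ _) hz)
    have hγ := h1 1 one_pos le_rfl _ γ u H (by rwa [one_mul])
    rw [one_mul] at hγ
    have hN : ∀ t ∈ Icc (0 : ℝ) 1, γ t ∈ N := fun t ht => by
      obtain ⟨x, hx, hxt⟩ := hγ t ht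
      rw [← hxt]; exact hL.mem x hx
    -- The dilation by `s` of a curve to the point with coordinates `z`.
    refine ⟨fun t => expProd c (coordDil w s (lg (γ t))), fun t => s • u t,
      ⟨?_, ?_, H.continuousOn.const_smul s, fun t ht => ?_⟩, ?_⟩
    · rw [H.source, ← hP0, hL.left_inv 0 (zero_mem_box hr.le), coordDil_zero]
    · rw [H.target, hL.left_inv z (box_mono (by positivity) (min_le_right _ _) hz), hyz]
    · obtain ⟨y', hy', hu⟩ := hL.hasDerivWithinAt_lg hc (H.hasLeftVel t ht)
        (uniqueDiffOn_Icc zero_lt_one t ht) ht hN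
      have h4 := hasLeftVel_curveProd hc Finset.univ.toList
        (hasDerivWithinAt_coordDil (w := w) (r := s) hy') ht
      rw [← hD.map_curveProdVel hc,
        show curveProdVel c b Finset.univ.toList (lg (γ t)) y' = _ from hu,
        hD.map_horizontal _ _ (u t).2] at h4
      exact h4
    · simp only [hp.smul, abs_of_pos hs, intervalIntegral.integral_const_mul]
      exact mul_lt_mul_of_pos_left hlen hs

/-- Large separated sets in small balls: the ball of radius `ρ` contains a number of points
proportional to `(ρ / σ) ^ k` at mutual distance at least `σ`, where `k` is the homogeneous
dimension. This is a volume count. -/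
theorem IsLogBox.exists_separated [T2Space G] (hL : IsLogBox c b w lg N r C K)
    (hD : IsGradedBasis G W b w D) (hc : ∀ i, IsOneParam (c i) (b i)) (hp : IsLength p)
    (hchow : ∀ ε > 0, ∀ᶠ g in 𝓝 (1 : G), Reach p 1 g ε) :
    ∃ a ρ₀ : ℝ, 0 < a ∧ 0 < ρ₀ ∧ ∀ ρ σ : ℝ, 0 < σ → σ ≤ ρ → ρ ≤ ρ₀ → ∀ M : ℕ,
      (M : ℝ) ≤ a * (ρ / σ) ^ (∑ i, w i) → ∃ S : Finset G, S.card = M ∧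
        (∀ g ∈ S, Reach p 1 g ρ) ∧ ∀ g ∈ S, ∀ h ∈ S, g ≠ h → ¬ Reach p g h σ := by
  obtain ⟨ε, r', hε, hr', hr'r, hbb⟩ := hL.exists_ballBox hD hc hp hchow
  have hr := hL.r_pos
  set m := Fintype.card ι with hm
  set k := ∑ i, w i with hk
  -- `K + 1` instead of `K` makes the constant positive also when `K = 0`.
  refine ⟨(r' / r) ^ k / (K + 1) ^ m, ε, by positivity, hε, fun ρ σ hσ hσρ hρ M hM => ?_⟩
  have hρ0 : 0 < ρ := hσ.trans_le hσρ
  set s := ρ / ε with hs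
  set s' := σ / ε with hs'
  have hs0 : 0 < s := by positivity
  have hs'0 : 0 < s' := by positivity
  have hs1 : s ≤ 1 := (div_le_one hε).2 hρ
  have hs'1 : s' ≤ 1 := (div_le_one hε).2 (hσρ.trans hρ)
  have hsε : s * ε = ρ := div_mul_cancel₀ _ hε.ne'
  have hs'ε : s' * ε = σ := div_mul_cancel₀ _ hε.ne'
  suffices ∃ S : Finset G, S.card = M ∧ (∀ g ∈ S, g ∈ expProd c '' box w (s * r')) ∧
      ∀ g ∈ S, ∀ h ∈ S, g ≠ h → ¬ Reach p g h σ by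
    obtain ⟨S, h1, h2, h3⟩ := this
    refine ⟨S, h1, fun g hg => ?_, h3⟩
    obtain ⟨y, hy, rfl⟩ := h2 g hg
    rw [← hsε]
    exact (hbb s hs0 hs1).2 y hy
  have hsub : box w (s * r') ⊆ box w r := box_mono (by positivity)
    ((mul_le_of_le_one_left hr'.le hs1).trans hr'r)
  have hsub' : box w (s' * r) ⊆ box w r := box_mono (by positivity)
    (mul_le_of_le_one_left hr.le hs'1)
  induction M with
  | zero => exact ⟨∅, rfl, by simp, by simp⟩
  | succ M ih =>
    push_cast at hM
    obtain ⟨S, hS, hSb, hSsep⟩ := ih (by linarith)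
    classical
    by_cases hex : ∃ z ∈ box w (s * r'), ∀ g ∈ S, ¬ Reach p g (expProd c z) σ
    · obtain ⟨z, hz, hzS⟩ := hex
      have hzn : expProd c z ∉ S := fun h => hzS _ h (reach_self hp _ hσ)
      refine ⟨insert (expProd c z) S, by rw [Finset.card_insert_of_notMem hzn, hS], ?_, ?_⟩
      · intro g hg
        rcases Finset.mem_insert.1 hg with rfl | hg
        · exact ⟨z, hz, rfl⟩
        · exact hSb g hg
      · intro g hg h hh hgh
        rcases Finset.mem_insert.1 hg with rfl | hg
        · rcases Finset.mem_insert.1 hh with rfl | hh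
          · exact absurd rfl hgh
          · exact fun hR => hzS h hh (hR.symm hp)
        · rcases Finset.mem_insert.1 hh with rfl | hh
          · exact hzS g hg
          · exact hSsep g hg h hh hgh
    · -- Otherwise translates of the small box cover the large one, against the volume bound.
      exfalso
      push Not at hex
      have hcov : box w (s * r') ⊆ ⋃ g ∈ S, (fun x => lg (g * expProd c x)) '' box w (s' * r) := by
        intro z hz
        obtain ⟨g, hg, hR⟩ := hex z hz
        have h1 := hR.const_mul g⁻¹
        rw [inv_mul_cancel, ← hs'ε] at h1
        obtain ⟨x, hx, hxg⟩ := (hbb s' hs'0 hs'1).1 _ h1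
        refine mem_biUnion hg ⟨x, hx, ?_⟩
        simp only [hxg, mul_inv_cancel_left, hL.left_inv z (hsub hz)]
      have hvol : ∀ g ∈ S,
          MeasureTheory.volume ((fun x => lg (g * expProd c x)) '' box w (s' * r)) ≤
            ENNReal.ofReal (K ^ m * (2 ^ m * (s' * r) ^ k)) := by
        intro g hg
        obtain ⟨y, hy, rfl⟩ := hSb g hg
        have h1 := ((hL.lipschitz y (hsub hy)).mono hsub').hausdorffMeasure_image_le
          (d := (m : ℝ)) (Nat.cast_nonneg _)
        rw [hm, MeasureTheory.hausdorffMeasure_pi_real, volume_box (by positivity),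
          ENNReal.rpow_natCast] at h1
        refine h1.trans (le_of_eq ?_)
        rw [ENNReal.ofReal_mul (p := (K : ℝ) ^ m) (by positivity),
          ENNReal.ofReal_pow (p := (K : ℝ)) (by positivity), ENNReal.ofReal_coe_nnreal]
      have htot : ENNReal.ofReal (2 ^ m * (s * r') ^ k) ≤
          ENNReal.ofReal (M * (K ^ m * (2 ^ m * (s' * r) ^ k))) := by
        rw [hk, hm, ← volume_box (by positivity)]
        refine (MeasureTheory.measure_mono hcov).trans
          ((MeasureTheory.measure_biUnion_finset_le S _).trans ((Finset.sum_le_sum hvol).trans ?_))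
        rw [Finset.sum_const, hS, nsmul_eq_mul, ENNReal.ofReal_mul (Nat.cast_nonneg _),
          ENNReal.ofReal_natCast]
      rw [ENNReal.ofReal_le_ofReal_iff (by positivity)] at htot
      have hKm : (K : ℝ) ^ m ≤ (K + 1 : ℝ) ^ m := by gcongr; linarith
      have hratio : ρ / σ = s / s' := by rw [hs, hs']; field_simp
      have h5 : (r' / r) ^ k * (s / s') ^ k ≤ M * (K + 1 : ℝ) ^ m := by
        rw [← mul_pow, show r' / r * (s / s') = (s * r') / (s' * r) by field_simp, div_pow,
          div_le_iff₀ (by positivity)]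
        have h6 : (2 : ℝ) ^ m * (s * r') ^ k ≤ 2 ^ m * (M * (K + 1) ^ m * (s' * r) ^ k) := by
          refine htot.trans ?_
          have h7 : (M : ℝ) * (K ^ m * (2 ^ m * (s' * r) ^ k)) ≤
              M * ((K + 1) ^ m * (2 ^ m * (s' * r) ^ k)) := by gcongr
          linarith
        exact le_of_mul_le_mul_left h6 (by positivity)
      rw [hratio, div_mul_eq_mul_div, le_div_iff₀ (by positivity)] at hM
      have h8 : (0 : ℝ) < (K + 1 : ℝ) ^ m := by positivity
      linarith

end BallBox

/-! ### Hölder maps between parametrised sets -/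

section HolderDim

/-- If `V` is a Hölder function of `F` with exponent `θ`, then the range of `V` has dimension at
most `θ⁻¹` times that of `F`. -/
lemma dimH_range_le_of_edist_le {Ω X Y : Type*} [MetricSpace X] [MetricSpace Y] {F : Ω → X}
    {V : Ω → Y} {C θ : ℝ≥0} (hθ : 0 < θ)
    (h : ∀ x y, edist (V x) (V y) ≤ C * edist (F x) (F y) ^ (θ : ℝ)) :
    dimH (range V) ≤ dimH (range F) / θ := by
  rcases isEmpty_or_nonempty Ω with hΩ | hΩ
  · rw [range_eq_empty, dimH_empty]; exact zero_le
  have hinv : ∀ x, V (Function.invFun F (F x)) = V x := fun x => by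
    have h1 := h (Function.invFun F (F x)) x
    rw [Function.invFun_eq (f := F) ⟨x, rfl⟩, edist_self,
      ENNReal.zero_rpow_of_pos (by exact_mod_cast hθ), mul_zero] at h1
    exact edist_le_zero.1 h1
  have h2 : HolderOnWith C θ (fun z => V (Function.invFun F z)) (range F) := by
    rintro _ ⟨x, rfl⟩ _ ⟨y, rfl⟩
    simp only [hinv]
    exact h x y
  have h3 : range V = (fun z => V (Function.invFun F z)) '' range F := by
    rw [← range_comp]
    exact congrArg range (funext fun x => (hinv x).symm)
  rw [h3]
  exact h2.dimH_image_le hθ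

/-- McShane extension from a parametrised set: if `F` is a Lipschitz function of `A`, then it
factors through a Lipschitz function on the whole space. -/
lemma exists_lipschitzWith_extension {Ω X ι : Type*} [PseudoMetricSpace X] [Fintype ι] {A : Ω → X}
    {F : Ω → ι → ℝ} {L : ℝ≥0} (h : ∀ x y, dist (F x) (F y) ≤ L * dist (A x) (A y)) :
    ∃ f : X → ι → ℝ, LipschitzWith L f ∧ ∀ x, f (A x) = F x := by
  rcases isEmpty_or_nonempty Ω with hΩ | hΩ
  · exact ⟨fun _ => 0, LipschitzWith.const' _, fun x => isEmptyElim x⟩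
  have hinv : ∀ x, F (Function.invFun A (A x)) = F x := fun x => by
    have h1 := h (Function.invFun A (A x)) x
    rw [Function.invFun_eq (f := A) ⟨x, rfl⟩, dist_self, mul_zero] at h1
    exact dist_le_zero.1 h1
  have h2 : LipschitzOnWith L (fun z => F (Function.invFun A z)) (range A) := by
    refine LipschitzOnWith.of_dist_le_mul ?_
    rintro _ ⟨x, rfl⟩ _ ⟨y, rfl⟩
    simp only [hinv]
    exact h x y
  obtain ⟨f, hf, hfe⟩ := h2.extend_pi
  exact ⟨f, hf, fun x => (hfe (mem_range_self x)).symm.trans (hinv x)⟩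

end HolderDim

/-! ### Fast decreasing series -/

section Series

variable {r : ℕ → ℝ}

lemma le_mul_half_pow (h : ∀ m, r (m + 1) ≤ r m / 2) (m j : ℕ) :
    r (m + j) ≤ r m * (1 / 2) ^ j := by
  induction j with
  | zero => simp
  | succ j ih => rw [← add_assoc, pow_succ]; linarith [h (m + j)]

lemma summable_mul_of_abs_le_one (h0 : ∀ m, 0 ≤ r m) (h : ∀ m, r (m + 1) ≤ r m / 2) {δ : ℕ → ℝ}
    (hδ : ∀ m, |δ m| ≤ 1) : Summable fun m => r m * δ m := by
  refine Summable.of_norm_bounded (g := fun m => r 0 * (1 / 2) ^ m)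
    ((summable_geometric_of_lt_one (by norm_num) (by norm_num)).mul_left _) fun m => ?_
  rw [Real.norm_eq_abs, abs_mul, abs_of_nonneg (h0 m)]
  have := le_mul_half_pow h 0 m
  rw [zero_add] at this
  exact (mul_le_of_le_one_right (h0 m) (hδ m)).trans this

/-- A series with coefficients in `[-1, 1]` against a fast decreasing sequence is controlled by its
first non-vanishing term. -/
lemma abs_tsum_le (h0 : ∀ m, 0 ≤ r m) (h : ∀ m, r (m + 1) ≤ r m / 2) {δ : ℕ → ℝ}
    (hδ : ∀ m, |δ m| ≤ 1) {m : ℕ} (hm : ∀ j < m, δ j = 0) : |∑' j, r j * δ j| ≤ 2 * r m := by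
  have hs := summable_mul_of_abs_le_one h0 h hδ
  rw [← hs.sum_add_tsum_nat_add m, Finset.sum_eq_zero (fun j hj => by
    rw [hm j (Finset.mem_range.1 hj), mul_zero]), zero_add, ← Real.norm_eq_abs]
  have hg := (hasSum_geometric_of_lt_one (r := (1 / 2 : ℝ)) (by norm_num)
    (by norm_num)).mul_left (r m)
  refine (tsum_of_norm_bounded hg fun j => ?_).trans (le_of_eq (by norm_num; ring))
  rw [Real.norm_eq_abs, abs_mul, abs_of_nonneg (h0 _), add_comm j m]
  exact (mul_le_of_le_one_right (h0 _) (hδ _)).trans (le_mul_half_pow h m j)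

/-- A series with coefficients in `[-1, 1]` against a fast decreasing sequence is bounded below in
terms of its first non-vanishing term. -/
lemma le_abs_tsum (h0 : ∀ m, 0 ≤ r m) (h : ∀ m, r (m + 1) ≤ r m / 2) {δ : ℕ → ℝ}
    (hδ : ∀ m, |δ m| ≤ 1) {m : ℕ} (hm : ∀ j < m, δ j = 0) :
    r m * |δ m| - 2 * r (m + 1) ≤ |∑' j, r j * δ j| := by
  have hs := summable_mul_of_abs_le_one h0 h hδ
  set δ' : ℕ → ℝ := fun j => if j = m then 0 else δ j with hδ'
  have hδ'1 : ∀ j, |δ' j| ≤ 1 := fun j => by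
    simp only [hδ']; split_ifs
    · simp
    · exact hδ j
  have h1 : |∑' j, r j * δ' j| ≤ 2 * r (m + 1) := abs_tsum_le h0 h hδ'1 fun j hj => by
    simp only [hδ']; split_ifs with hjm
    · rfl
    · exact hm j (by omega)
  have h2 : ∑' j, r j * δ j = r m * δ m + ∑' j, r j * δ' j := by
    rw [hs.tsum_eq_add_tsum_ite m]
    congr 1
    refine tsum_congr fun j => ?_
    simp only [hδ']; split_ifs <;> simp
  rw [h2]
  have h3 := abs_sub_abs_le_abs_sub (r m * δ m) (-∑' j, r j * δ' j)
  rw [sub_neg_eq_add, abs_neg, abs_mul, abs_of_nonneg (h0 m)] at h3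
  linarith

end Series

/-! ### Digit expansions and their Hausdorff dimension -/

section Digits

/-- The triangular numbers `1 + 2 + ⋯ + m`. -/
def tri (m : ℕ) : ℕ := ∑ j ∈ Finset.range m, (j + 1)

lemma tri_succ (m : ℕ) : tri (m + 1) = tri m + (m + 1) := Finset.sum_range_succ _ _

lemma sq_le_two_mul_tri (m : ℕ) : m ^ 2 ≤ 2 * tri m := by
  induction m with
  | zero => simp
  | succ m ih => rw [tri_succ]; nlinarith

lemma le_tri (m : ℕ) : m ≤ tri m := by
  induction m with
  | zero => simp
  | succ m ih => rw [tri_succ]; omega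

/-- The sizes `2 ^ -(K m + (1 + ⋯ + m))`. -/
def scale (K m : ℕ) : ℝ := (1 / 2) ^ (K * m + tri m)

lemma scale_pos (K m : ℕ) : 0 < scale K m := by unfold scale; positivity

lemma scale_succ (K m : ℕ) : scale K (m + 1) = scale K m * (1 / 2) ^ K * (1 / 2) ^ (m + 1) := by
  simp only [scale, tri_succ, ← pow_add]
  congr 1; ring

lemma scale_zero (K : ℕ) : scale K 0 = 1 := by simp [scale, tri]

lemma scale_succ_le (K m : ℕ) : scale K (m + 1) ≤ scale K m / 2 := by
  have h : (1 / 2 : ℝ) ^ K * (1 / 2) ^ (m + 1) ≤ 1 * (1 / 2) ^ 1 :=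
    mul_le_mul (pow_le_one₀ (by norm_num) (by norm_num))
      (pow_le_pow_of_le_one (by norm_num) (by norm_num) (by omega)) (by positivity) zero_le_one
  have h1 := mul_le_mul_of_nonneg_left h (scale_pos K m).le
  rw [scale_succ]
  linarith

/-- Sequences of digits, the `m`-th one being a vector of `k` numbers less than `2 ^ (m + 1)`. -/
abbrev DigitSeq (k : ℕ) : Type := ∀ m : ℕ, Fin k → Fin (2 ^ (m + 1))

/-- The `m`-th digit, scaled to the unit interval. -/
def unitDigit {k : ℕ} (x : DigitSeq k) (i : Fin k) (m : ℕ) : ℝ := (x m i : ℝ) / 2 ^ (m + 1)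

/-- The point of `ℝ ^ k` with given digits and sizes `r m` of the levels. For `r = scale 0` this is
a mixed radix expansion. -/
def digitSum {k : ℕ} (r : ℕ → ℝ) (x : DigitSeq k) : Fin k → ℝ :=
  fun i => ∑' m, r m * unitDigit x i m

variable {k : ℕ} {r : ℕ → ℝ}

lemma unitDigit_mem (x : DigitSeq k) (i : Fin k) (m : ℕ) : unitDigit x i m ∈ Icc (0 : ℝ) 1 := by
  refine ⟨by unfold unitDigit; positivity, div_le_one_of_le₀ ?_ (by positivity)⟩
  exact_mod_cast (x m i).2.le

lemma abs_unitDigit_sub_le (x y : DigitSeq k) (i : Fin k) (m : ℕ) :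
    |unitDigit x i m - unitDigit y i m| ≤ 1 := by
  have h1 := unitDigit_mem x i m
  have h2 := unitDigit_mem y i m
  exact abs_sub_le_iff.2 ⟨by linarith [h1.2, h2.1], by linarith [h2.2, h1.1]⟩

lemma le_abs_unitDigit_sub {x y : DigitSeq k} {i : Fin k} {m : ℕ} (h : x m i ≠ y m i) :
    (1 / 2) ^ (m + 1) ≤ |unitDigit x i m - unitDigit y i m| := by
  have h1 : (1 : ℝ) ≤ |((x m i : ℕ) : ℝ) - ((y m i : ℕ) : ℝ)| := by
    have : ((x m i : ℕ) : ℤ) - ((y m i : ℕ) : ℤ) ≠ 0 := fun h' => h (Fin.ext (by omega))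
    exact_mod_cast Int.one_le_abs this
  rw [unitDigit, unitDigit, ← sub_div, abs_div, abs_of_pos (by positivity : (0 : ℝ) < 2 ^ (m + 1)),
    one_div_pow]
  gcongr

lemma digitSum_sub (h0 : ∀ m, 0 ≤ r m) (h : ∀ m, r (m + 1) ≤ r m / 2) (x y : DigitSeq k)
    (i : Fin k) :
    digitSum r x i - digitSum r y i = ∑' m, r m * (unitDigit x i m - unitDigit y i m) := by
  have hx : ∀ z : DigitSeq k, Summable fun m => r m * unitDigit z i m := fun z =>
    summable_mul_of_abs_le_one h0 h fun m => by
      rw [abs_of_nonneg (unitDigit_mem z i m).1]; exact (unitDigit_mem z i m).2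
  rw [digitSum, digitSum, ← (hx x).tsum_sub (hx y)]
  exact tsum_congr fun m => by ring

lemma abs_digitSum_sub_le (h0 : ∀ m, 0 ≤ r m) (h : ∀ m, r (m + 1) ≤ r m / 2) {x y : DigitSeq k}
    {i : Fin k} {m : ℕ} (hm : ∀ j < m, x j i = y j i) :
    |digitSum r x i - digitSum r y i| ≤ 2 * r m := by
  rw [digitSum_sub h0 h]
  exact abs_tsum_le h0 h (abs_unitDigit_sub_le x y i) fun j hj => by
    simp [unitDigit, hm j hj]

lemma le_abs_digitSum_sub (h0 : ∀ m, 0 ≤ r m) (h : ∀ m, r (m + 1) ≤ r m / 2) {x y : DigitSeq k}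
    {i : Fin k} {m : ℕ} (hm : ∀ j < m, x j i = y j i) (hne : x m i ≠ y m i) :
    r m * (1 / 2) ^ (m + 1) - 2 * r (m + 1) ≤ |digitSum r x i - digitSum r y i| := by
  rw [digitSum_sub h0 h]
  refine le_trans ?_ (le_abs_tsum h0 h (abs_unitDigit_sub_le x y i) (m := m) fun j hj => by
    simp [unitDigit, hm j hj])
  have := mul_le_mul_of_nonneg_left (le_abs_unitDigit_sub hne) (h0 m)
  linarith

/-- Mixed radix expansions represent all points of the half open unit cube. -/
lemma pi_Ico_subset_range_digitSum :
    (univ.pi fun _ : Fin k => Ico (0 : ℝ) 1) ⊆ range (digitSum (scale 0)) := by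
  intro t ht
  refine ⟨fun m i => ⟨⌊2 ^ tri (m + 1) * t i⌋₊ % 2 ^ (m + 1), Nat.mod_lt _ (by positivity)⟩, ?_⟩
  funext i
  obtain ⟨ht0, ht1⟩ := ht i (mem_univ i)
  have hpart : ∀ m, ∑ j ∈ Finset.range m, scale 0 j *
      (((⌊2 ^ tri (j + 1) * t i⌋₊ % 2 ^ (j + 1) : ℕ) : ℝ) / 2 ^ (j + 1)) =
        (⌊2 ^ tri m * t i⌋₊ : ℝ) / 2 ^ tri m := by
    intro m
    induction m with
    | zero => simp [tri, Nat.floor_eq_zero.2 ht1]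
    | succ m ih =>
      rw [Finset.sum_range_succ, ih]
      have h1 : ⌊2 ^ tri m * t i⌋₊ = ⌊2 ^ tri (m + 1) * t i⌋₊ / 2 ^ (m + 1) := by
        rw [← Nat.floor_div_natCast, tri_succ, pow_add]
        congr 1
        push_cast
        field_simp
      have h2 := Nat.div_add_mod ⌊2 ^ tri (m + 1) * t i⌋₊ (2 ^ (m + 1))
      rw [← h1] at h2
      rw [← h2]
      have h3 : (⌊2 ^ tri m * t i⌋₊ : ℕ) = ⌊2 ^ tri m * t i⌋₊ := rfl
      rw [Nat.mul_add_mod, Nat.mod_mod]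
      simp only [scale, zero_mul, zero_add, tri_succ, pow_add, one_div, inv_pow]
      push_cast
      field_simp
  have hlim : Tendsto (fun m => (⌊2 ^ tri m * t i⌋₊ : ℝ) / 2 ^ tri m) atTop (𝓝 (t i)) := by
    have h1 := (tendsto_nat_floor_mul_div_atTop ht0).comp
      ((tendsto_pow_atTop_atTop_of_one_lt (one_lt_two (α := ℝ))).comp
        (tendsto_atTop_mono le_tri tendsto_id))
    refine h1.congr fun m => ?_
    simp only [Function.comp, mul_comm]
  have hsum : Summable fun m => scale 0 m * unitDigit (fun m i =>
      (⟨⌊2 ^ tri (m + 1) * t i⌋₊ % 2 ^ (m + 1), Nat.mod_lt _ (by positivity)⟩ :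
        Fin (2 ^ (m + 1)))) i m :=
    summable_mul_of_abs_le_one (fun m => (scale_pos 0 m).le) (scale_succ_le 0) fun m => by
      rw [abs_of_nonneg (unitDigit_mem _ i m).1]; exact (unitDigit_mem _ i m).2
  refine tendsto_nhds_unique hsum.hasSum.tendsto_sum_nat (hlim.congr fun m => ?_)
  rw [← hpart m]
  rfl

/-- Mixed radix expansions depend in a Hölder way, with any exponent `θ < 1`, on the point of the
sparser self-similar set with the same digits. -/
lemma exists_digitSum_holder (K : ℕ) (hK : 2 ≤ K) {θ : ℝ} (h0 : 0 < θ) (h1 : θ < 1) :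
    ∃ C : ℝ≥0, ∀ x y : DigitSeq k, edist (digitSum (scale 0) x) (digitSum (scale 0) y) ≤
      C * edist (digitSum (fun m => scale K (m + 1)) x)
        (digitSum (fun m => scale K (m + 1)) y) ^ θ := by
  have key : ∃ E : ℝ, 0 < E ∧ ∀ m : ℕ,
      2 * scale 0 m ≤ E * (scale K (m + 1) * (1 / 2) ^ (m + 1) / 2) ^ θ := by
    set δ := 1 - θ with hδ
    have hδ0 : 0 < δ := by linarith
    -- The exponents to compare grow linearly and quadratically in `m`; the last term of `E₀` comes
    -- from completing the square.
    set E₀ : ℝ := 1 + (K + 3) + (K + 2) ^ 2 / (2 * δ) with hE₀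
    refine ⟨2 ^ E₀, by positivity, fun m => ?_⟩
    have e1 : (2 : ℝ) * scale 0 m = 2 ^ (1 - (tri m : ℝ)) := by
      rw [Real.rpow_sub two_pos, Real.rpow_one, Real.rpow_natCast, scale, zero_mul, zero_add,
        one_div_pow, mul_one_div]
    have e2 : scale K (m + 1) * (1 / 2) ^ (m + 1) / 2 =
        (2 : ℝ) ^ (-((K * (m + 1) + tri (m + 1) + (m + 1) + 1 : ℕ) : ℝ)) := by
      rw [Real.rpow_neg two_pos.le, Real.rpow_natCast, scale, ← one_div, ← one_div_pow, pow_succ,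
        pow_add]
      ring
    rw [e1, e2, ← Real.rpow_mul two_pos.le, ← Real.rpow_add two_pos]
    refine Real.rpow_le_rpow_of_exponent_le one_le_two ?_
    rw [tri_succ]
    push_cast
    have h2 : (m : ℝ) ^ 2 ≤ 2 * tri m := by exact_mod_cast sq_le_two_mul_tri m
    have h3 : θ = 1 - δ := by rw [hδ]; ring
    have h4 : (K + 2 : ℝ) * m ≤ (K + 2) ^ 2 / (2 * δ) + δ * (m ^ 2 / 2) := by
      have : 0 ≤ ((K + 2 : ℝ) - δ * m) ^ 2 / (2 * δ) := by positivity
      have e : ((K + 2 : ℝ) - δ * m) ^ 2 / (2 * δ) =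
          (K + 2) ^ 2 / (2 * δ) + δ * (m ^ 2 / 2) - (K + 2) * m := by field_simp; ring
      linarith
    have h5 : δ * (m ^ 2 / 2 : ℝ) ≤ δ * tri m := by gcongr; linarith
    have h6 : 0 ≤ δ * (K * (m + 1) + (m + 1) + (m + 1) + 1 : ℝ) := by positivity
    rw [h3, hE₀]
    nlinarith
  obtain ⟨E, hE, hkey⟩ := key
  refine ⟨E.toNNReal, fun x y => ?_⟩
  set D : ℝ := dist (digitSum (fun m => scale K (m + 1)) x) (digitSum (fun m => scale K (m + 1)) y)
    with hD
  have hreal : dist (digitSum (scale 0) x) (digitSum (scale 0) y) ≤ E * D ^ θ := by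
    refine (dist_pi_le_iff (by positivity)).2 fun i => ?_
    rw [Real.dist_eq]
    by_cases hxy : ∀ j, x j i = y j i
    · have : digitSum (scale 0) x i = digitSum (scale 0) y i := by
        simp only [digitSum, unitDigit, hxy]
      rw [this, sub_self, abs_zero]; positivity
    · push Not at hxy
      classical
      have hne := Nat.find_spec hxy
      have hmin : ∀ j < Nat.find hxy, x j i = y j i := fun j hj => by
        simpa using Nat.find_min hxy hj
      set m := Nat.find hxy
      refine (abs_digitSum_sub_le (fun m => (scale_pos 0 m).le) (scale_succ_le 0) hmin).trans
        ((hkey m).trans ?_)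
      have hDi : |digitSum (fun m => scale K (m + 1)) x i -
          digitSum (fun m => scale K (m + 1)) y i| ≤ D :=
        dist_le_pi_dist (digitSum (fun m => scale K (m + 1)) x) _ i
      have h2 := (le_abs_digitSum_sub (r := fun m => scale K (m + 1)) (fun m => (scale_pos K _).le)
        (fun m => scale_succ_le K _) hmin hne).trans hDi
      have h3 : 2 * scale K (m + 1 + 1) ≤ scale K (m + 1) * (1 / 2) ^ (m + 1) / 2 := by
        rw [scale_succ K (m + 1)]
        have h4 : (1 / 2 : ℝ) ^ K ≤ (1 / 2) ^ 2 :=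
          pow_le_pow_of_le_one (by norm_num) (by norm_num) hK
        have h5 : (1 / 2 : ℝ) ^ (m + 1 + 1) = (1 / 2) ^ (m + 1) / 2 := by rw [pow_succ]; ring
        have h6 := scale_pos K (m + 1)
        have h7 : (0 : ℝ) < (1 / 2) ^ (m + 1) := by positivity
        rw [h5]
        have h8 : scale K (m + 1) * (1 / 2 : ℝ) ^ K * ((1 / 2) ^ (m + 1) / 2) ≤
            scale K (m + 1) * (1 / 2 : ℝ) ^ 2 * ((1 / 2) ^ (m + 1) / 2) := by gcongr
        nlinarith [mul_pos h6 h7]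
      have h9 : scale K (m + 1) * (1 / 2) ^ (m + 1) / 2 ≤ D := by
        linarith
      have h10 := scale_pos K (m + 1)
      gcongr
  rw [edist_dist, edist_dist, ← hD]
  rw [ENNReal.ofReal_rpow_of_nonneg dist_nonneg h0.le]
  refine (ENNReal.ofReal_le_ofReal hreal).trans (le_of_eq ?_)
  rw [ENNReal.ofReal_mul hE.le]
  rfl

/-- The self-similar set with sizes `scale K (m + 1)` has full dimension, since the number of digits
grows with the level. -/
lemma dimH_range_digitSum (K : ℕ) (hK : 2 ≤ K) :
    dimH (range (digitSum (k := k) fun m => scale K (m + 1))) = k := by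
  apply le_antisymm
  · refine (dimH_mono (subset_univ _)).trans (le_of_eq ?_)
    rw [Real.dimH_univ_pi_fin]
  · have hV : dimH (range (digitSum (k := k) (scale 0))) = k := by
      refine (Real.dimH_of_nonempty_interior (E := Fin k → ℝ) ?_).trans (by simp)
      refine ⟨fun _ => 1 / 2, interior_mono pi_Ico_subset_range_digitSum ?_⟩
      rw [interior_pi_set finite_univ]
      intro i _
      rw [interior_Ico]; norm_num
    have hθ : ∀ θ : ℝ≥0, 0 < θ → θ < 1 →
        (θ : ℝ≥0∞) * k ≤ dimH (range (digitSum (k := k) fun m => scale K (m + 1))) := by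
      intro θ h0 h1
      obtain ⟨C, hC⟩ := exists_digitSum_holder (k := k) K hK (θ := θ) (by exact_mod_cast h0)
        (by exact_mod_cast h1)
      have h2 := dimH_range_le_of_edist_le h0 hC
      rw [hV, ENNReal.le_div_iff_mul_le (by simp [h0.ne']) (by simp)] at h2
      rwa [mul_comm]
    have hlim : Tendsto (fun θ : ℝ≥0 => (θ : ℝ≥0∞) * k) (𝓝[<] 1) (𝓝 k) := by
      have h1 : Continuous fun θ : ℝ≥0 => (θ : ℝ≥0∞) * k :=
        (ENNReal.continuous_mul_const (by simp)).comp ENNReal.continuous_coe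
      have h2 := h1.tendsto 1
      rw [ENNReal.coe_one, one_mul] at h2
      exact h2.mono_left nhdsWithin_le_nhds
    have : (𝓝[<] (1 : ℝ≥0)).NeBot := nhdsLT_neBot_of_exists_lt ⟨0, zero_lt_one⟩
    refine le_of_tendsto hlim ?_
    filter_upwards [Ioo_mem_nhdsLT (zero_lt_one (α := ℝ≥0))] with θ hθ'
    exact hθ θ hθ'.1 hθ'.2

end Digits

/-! ### Cantor sets in groups with left-invariant distance -/

section CantorSet

variable {X : Type*} [PseudoMetricSpace X] [CompleteSpace X] [Group X] {k : ℕ}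

/-- In a complete group with left-invariant distance, infinite products of factors taken from
separated sets of rapidly decreasing size form a Cantor set, parametrised by digits. -/
lemma exists_separated_products (hinv : ∀ g x y : X, dist (g * x) (g * y) = dist x y)
    {K : ℕ} {s : ℝ} (hs : 0 < s) (e : ∀ m, (Fin k → Fin (2 ^ (m + 1))) → X)
    (he : ∀ m v, dist 1 (e m v) ≤ s * scale K m)
    (hsep : ∀ m v v', v ≠ v' → 8 * (s * scale K (m + 1)) ≤ dist (e m v) (e m v')) :
    ∃ A : DigitSeq k → X, (∀ x, dist 1 (A x) ≤ 2 * s) ∧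
      ∀ x y m, (∀ j < m, x j = y j) → x m ≠ y m → 4 * (s * scale K (m + 1)) ≤ dist (A x) (A y) := by
  set P : DigitSeq k → ℕ → X := fun x => Nat.rec 1 fun m g => g * e m (x m) with hP
  have hP0 : ∀ x, P x 0 = 1 := fun x => rfl
  have hPs : ∀ x m, P x (m + 1) = P x m * e m (x m) := fun x m => rfl
  have hstep : ∀ x m, dist (P x m) (P x (m + 1)) ≤ s * scale K m := fun x m => by
    have := hinv (P x m) 1 (e m (x m))
    rw [mul_one] at this
    rw [hPs, this]; exact he m _
  have hgeo : ∀ x m j, dist (P x (m + j)) (P x (m + j + 1)) ≤ 2 * (s * scale K m) / 2 / 2 ^ j := by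
    intro x m j
    refine (hstep x (m + j)).trans ?_
    have := le_mul_half_pow (scale_succ_le K) m j
    calc s * scale K (m + j) ≤ s * (scale K m * (1 / 2) ^ j) := by gcongr
      _ = _ := by rw [one_div_pow]; field_simp
  have hlim : ∀ x, ∃ a, Tendsto (P x) atTop (𝓝 a) := fun x => by
    refine cauchySeq_tendsto_of_complete (cauchySeq_of_le_geometric_two (C := 2 * (s * scale K 0))
      fun j => ?_)
    simpa using hgeo x 0 j
  choose A hA using hlim
  have hdist : ∀ x m, dist (P x m) (A x) ≤ 2 * (s * scale K m) := fun x m => by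
    have h1 : Tendsto (fun j => P x (m + j)) atTop (𝓝 (A x)) :=
      (hA x).comp (tendsto_atTop_mono (fun j => Nat.le_add_left j m) tendsto_id)
    exact dist_le_of_le_geometric_two_of_tendsto₀ (hgeo x m) h1
  refine ⟨A, fun x => ?_, fun x y m hm hne => ?_⟩
  · have := hdist x 0
    rwa [hP0, scale_zero, mul_one] at this
  · have hPm : ∀ j ≤ m, P x j = P y j := by
      intro j
      induction j with
      | zero => exact fun _ => rfl
      | succ j ih =>
        intro hj
        rw [hPs, hPs, ih (by omega), hm j (by omega)]
    have h1 : 8 * (s * scale K (m + 1)) ≤ dist (P x (m + 1)) (P y (m + 1)) := by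
      rw [hPs, hPs, hPm m le_rfl, hinv]
      exact hsep m _ _ hne
    have h2 := hdist x (m + 1)
    have h3 := hdist y (m + 1)
    have h4 := dist_triangle4 (P x (m + 1)) (A x) (A y) (P y (m + 1))
    rw [dist_comm (A y)] at h4
    linarith

/-- A complete group with left-invariant distance, whose small balls contain large separated sets
as in dimension `k`, has a Lipschitz map to `ℝ ^ k` which maps a ball to a set of dimension `k`. -/
theorem exists_lipschitz_dimH_eq (hinv : ∀ g x y : X, dist (g * x) (g * y) = dist x y)
    {a ρ₀ : ℝ} (ha : 0 < a) (hρ₀ : 0 < ρ₀)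
    (hsep : ∀ ρ σ : ℝ, 0 < σ → σ ≤ ρ → ρ ≤ ρ₀ → ∀ M : ℕ, (M : ℝ) ≤ a * (ρ / σ) ^ k →
      ∃ S : Finset X, S.card = M ∧ (∀ g ∈ S, dist 1 g ≤ ρ) ∧
        ∀ g ∈ S, ∀ h ∈ S, g ≠ h → σ ≤ dist g h) :
    ∃ (L : ℝ≥0) (f : X → EuclideanSpace ℝ (Fin k)), LipschitzWith L f ∧
      dimH (f '' Metric.ball 1 1) = k := by
  rcases Nat.eq_zero_or_pos k with rfl | hk
  · refine ⟨0, fun _ => 0, LipschitzWith.const _, ?_⟩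
    rw [(subsingleton_of_subsingleton).dimH_zero]; simp
  obtain ⟨K₀, hK₀⟩ := pow_unbounded_of_one_lt (1 / a) (one_lt_two (α := ℝ))
  -- The summand `3` absorbs the factor `8` in the separation, and `2 ^ K₀` the constant `a`.
  set K := K₀ + 3 with hK
  -- The bound `1 / 4` keeps the Cantor set in the unit ball.
  set s := min ρ₀ (1 / 4) with hs
  have hs0 : 0 < s := by positivity
  have hs1 : s ≤ 1 / 4 := min_le_right _ _
  have hscale1 : ∀ m, scale K m ≤ 1 := fun m => pow_le_one₀ (by norm_num) (by norm_num)
  have hlevel : ∀ m, ∃ e : (Fin k → Fin (2 ^ (m + 1))) → X, (∀ v, dist 1 (e v) ≤ s * scale K m) ∧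
      ∀ v v', v ≠ v' → 8 * (s * scale K (m + 1)) ≤ dist (e v) (e v') := by
    intro m
    have hpos := scale_pos K m
    have e1 : 8 * (s * scale K (m + 1)) = s * scale K m * ((1 / 2) ^ K₀ * (1 / 2) ^ (m + 1)) := by
      rw [scale_succ, hK, pow_add]; ring
    have e2 : s * scale K m / (8 * (s * scale K (m + 1))) = 2 ^ K₀ * 2 ^ (m + 1) := by
      rw [e1, one_div_pow, one_div_pow]; field_simp
    have h1 : 8 * (s * scale K (m + 1)) ≤ s * scale K m := by
      rw [e1, ← pow_add]
      exact mul_le_of_le_one_right (by positivity) (pow_le_one₀ (by norm_num) (by norm_num))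
    have h2 : s * scale K m ≤ ρ₀ :=
      (mul_le_of_le_one_right hs0.le (hscale1 m)).trans (min_le_left _ _)
    have h3 : (((2 ^ (m + 1)) ^ k : ℕ) : ℝ) ≤
        a * (s * scale K m / (8 * (s * scale K (m + 1)))) ^ k := by
      rw [e2, mul_pow, ← mul_assoc]
      push_cast
      refine le_mul_of_one_le_left (by positivity) ?_
      have h4 : (2 : ℝ) ^ K₀ ≤ (2 ^ K₀) ^ k :=
        le_self_pow₀ (one_le_pow₀ one_le_two) (by omega)
      rw [div_lt_iff₀' ha] at hK₀
      exact hK₀.le.trans (mul_le_mul_of_nonneg_left h4 ha.le)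
    obtain ⟨S, hS, hSd, hSs⟩ := hsep _ _ (by have := scale_pos K (m + 1); positivity) h1 h2 _ h3
    have hcard : Fintype.card (Fin k → Fin (2 ^ (m + 1))) = Fintype.card S := by
      rw [Fintype.card_coe, hS]; simp
    let φ := Fintype.equivOfCardEq hcard
    exact ⟨fun v => φ v, fun v => hSd _ (φ v).2, fun v v' hv => hSs _ (φ v).2 _ (φ v').2 fun h =>
      hv (φ.injective (Subtype.ext h))⟩
  choose e he hes using hlevel
  obtain ⟨A, hA1, hAs⟩ := exists_separated_products hinv hs0 e he hes
  set F : DigitSeq k → Fin k → ℝ := digitSum fun m => scale K (m + 1) with hF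
  set L : ℝ≥0 := (1 / (2 * s)).toNNReal with hL
  have hLr : (L : ℝ) = 1 / (2 * s) := Real.coe_toNNReal _ (by positivity)
  have hlip : ∀ x y, dist (F x) (F y) ≤ L * dist (A x) (A y) := by
    intro x y
    by_cases hxy : x = y
    · subst hxy; simp
    · have hex : ∃ m, x m ≠ y m := Function.ne_iff.1 hxy
      classical
      have hne := Nat.find_spec hex
      have hmin : ∀ j < Nat.find hex, x j = y j := fun j hj => by simpa using Nat.find_min hex hj
      set m := Nat.find hex
      have h1 := hAs x y m hmin hne
      refine (dist_pi_le_iff (by positivity)).2 fun i => ?_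
      have h2 := abs_digitSum_sub_le (r := fun m => scale K (m + 1)) (fun m => (scale_pos K _).le)
        (fun m => scale_succ_le K _) (i := i) fun j hj => congrFun (hmin j hj) i
      refine h2.trans ?_
      rw [hLr, div_mul_eq_mul_div, one_mul, le_div_iff₀ (by positivity)]
      linarith
  obtain ⟨f, hf, hfA⟩ := exists_lipschitzWith_extension hlip
  let Φ : EuclideanSpace ℝ (Fin k) ≃L[ℝ] (Fin k → ℝ) := EuclideanSpace.equiv (Fin k) ℝ
  refine ⟨_, fun x => Φ.symm (f x),
    (Φ.symm : (Fin k → ℝ) →L[ℝ] EuclideanSpace ℝ (Fin k)).lipschitz.comp hf, ?_⟩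
  have himg : (fun x => Φ.symm (f x)) '' Metric.ball 1 1 = Φ.symm '' (f '' Metric.ball 1 1) :=
    (image_image _ _ _).symm
  rw [himg, ContinuousLinearEquiv.dimH_image]
  apply le_antisymm
  · refine (dimH_mono (subset_univ _)).trans (le_of_eq ?_)
    rw [Real.dimH_univ_pi_fin]
  · rw [← dimH_range_digitSum (k := k) K (by omega)]
    refine dimH_mono ?_
    rintro _ ⟨x, rfl⟩
    refine ⟨A x, ?_, hfA x⟩
    rw [Metric.mem_ball, dist_comm]
    linarith [hA1 x]

end CantorSet

/-! ### Distances given as functions -/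

section LeftInvariantDistance

/-- A version of `exists_lipschitz_dimH_eq` for a distance which is not registered as an
instance. -/
lemma exists_lipschitz_dimH_eq_of_dist {X : Type*} [Group X] {k : ℕ} (δ : X → X → ℝ)
    (hself : ∀ x, δ x x = 0) (hsymm : ∀ x y, δ x y = δ y x)
    (htri : ∀ x y z, δ x z ≤ δ x y + δ y z) (hinv : ∀ g x y, δ (g * x) (g * y) = δ x y)
    (hcomplete : ∀ u : ℕ → X, (∀ ε > 0, ∃ N, ∀ m ≥ N, ∀ l ≥ N, δ (u m) (u l) < ε) →
      ∃ a, ∀ ε > 0, ∃ N, ∀ m ≥ N, δ (u m) a < ε)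
    {a ρ₀ : ℝ} (ha : 0 < a) (hρ₀ : 0 < ρ₀)
    (hsep : ∀ ρ σ : ℝ, 0 < σ → σ ≤ ρ → ρ ≤ ρ₀ → ∀ M : ℕ, (M : ℝ) ≤ a * (ρ / σ) ^ k →
      ∃ S : Finset X, S.card = M ∧ (∀ g ∈ S, δ 1 g ≤ ρ) ∧
        ∀ g ∈ S, ∀ h ∈ S, g ≠ h → σ ≤ δ g h) :
    ∃ (L : ℝ≥0) (f : X → EuclideanSpace ℝ (Fin k)), (∀ x y, dist (f x) (f y) ≤ L * δ x y) ∧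
      dimH (f '' {g | δ g 1 < 1}) = k := by
  let _ : PseudoMetricSpace X :=
    { dist := δ, dist_self := hself, dist_comm := hsymm, dist_triangle := htri }
  have hc : CompleteSpace X := by
    refine UniformSpace.complete_of_cauchySeq_tendsto fun u hu => ?_
    obtain ⟨b, hb⟩ := hcomplete u (Metric.cauchySeq_iff.1 hu)
    exact ⟨b, Metric.tendsto_atTop.2 hb⟩
  obtain ⟨L, f, hf, hdim⟩ := exists_lipschitz_dimH_eq (X := X) (k := k) hinv ha hρ₀ hsep
  exact ⟨L, f, hf.dist_le_mul, hdim⟩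

end LeftInvariantDistance

/-! ### The graded basis of the Lie algebra -/

section Grading

variable {n : ℕ} {G : Type*} [TopologicalSpace G] [ChartedSpace (Model n) G] [Group G]
  [LieGroup (𝓡 n) ∞ G]

/-- The Jacobi identity. -/
lemma ad_ad (x y z : Model n) :
    ad n G (ad n G x y) z = ad n G x (ad n G y z) - ad n G y (ad n G x z) := by
  have : LieGroup (𝓡 n) (minSmoothness ℝ 3) G := by
    rw [minSmoothness_of_isRCLikeNormedField]
    exact LieGroup.of_le (n := ∞) (WithTop.coe_le_coe.2 (le_top : (3 : ℕ∞) ≤ ⊤))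
  have h : ∀ a b c : GroupLieAlgebra (𝓡 n) G, ⁅⁅a, b⁆, c⁆ = ⁅a, ⁅b, c⁆⁆ - ⁅b, ⁅a, c⁆⁆ :=
    fun a b c => lie_lie a b c
  have h₁ : ∀ a b c : GroupLieAlgebra (𝓡 n) G, ⁅⁅a, b⁆, c⁆ = (ad n G (ad n G a b) c : Model n) :=
    fun a b c => (congrArg (fun t : GroupLieAlgebra (𝓡 n) G => ⁅t, c⁆) (lie_eq_ad a b)).trans
      (lie_eq_ad _ c)
  have h₂ : ∀ a b c : GroupLieAlgebra (𝓡 n) G, ⁅a, ⁅b, c⁆⁆ = (ad n G a (ad n G b c) : Model n) :=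
    fun a b c => (congrArg (fun t : GroupLieAlgebra (𝓡 n) G => ⁅a, t⁆) (lie_eq_ad b c)).trans
      (lie_eq_ad a _)
  exact (h₁ x y z).symm.trans ((h x y z).trans (congrArg₂ (fun s t : Model n => s - t)
    (h₂ x y z) (h₂ y x z)))

variable {V : ℕ → Submodule ℝ (Model n)}

/-- The layers form a grading. This follows from the case of the first layer by induction, with the
Jacobi identity. -/
lemma IsStratified.ad_mem (hV : IsStratified n G V)
    (h1 : ∀ j, ∀ x ∈ V 1, ∀ y ∈ V j, ad n G x y ∈ V (j + 1)) (i : ℕ) :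
    ∀ j, ∀ x ∈ V i, ∀ y ∈ V j, ad n G x y ∈ V (i + j) := by
  induction i with
  | zero =>
    intro j x hx y _
    rw [hV.zero_layer] at hx
    rw [(Submodule.mem_bot ℝ).1 hx, map_zero, zero_apply]
    exact Submodule.zero_mem _
  | succ i ih =>
    intro j x hx y hy
    rcases Nat.eq_zero_or_pos i with rfl | hi
    · rw [zero_add, add_comm]; exact h1 j x hx y hy
    · have h2 : Submodule.span ℝ {z | ∃ x ∈ V 1, ∃ y ∈ V i, ad n G x y = z} ≤
          (V (i + 1 + j)).comap
            (((ad n G).flip y : Model n →L[ℝ] Model n) : Model n →ₗ[ℝ] Model n) := by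
        rw [Submodule.span_le]
        rintro _ ⟨a, ha, b, hb, rfl⟩
        show ad n G (ad n G a b) y ∈ V (i + 1 + j)
        rw [ad_ad]
        refine Submodule.sub_mem _ ?_ ?_
        · have := h1 _ a ha _ (ih j b hb y hy)
          rwa [show i + 1 + j = i + j + 1 by ring]
        · have := ih _ b hb _ (h1 j a ha y hy)
          rwa [show i + 1 + j = i + (j + 1) by ring]
      exact h2 (hV.le_span i hi hx)

/-- The basis assembled from bases of the layers. -/
def layerBasis (hV : DirectSum.IsInternal V) :
    Module.Basis (Σ j, Fin (Module.finrank ℝ (V j))) ℝ (Model n) :=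
  hV.collectedBasis fun j => Module.finBasis ℝ (V j)

lemma layerBasis_mem (hV : DirectSum.IsInternal V) (i : Σ j, Fin (Module.finrank ℝ (V j))) :
    layerBasis hV i ∈ V i.1 := by
  rw [layerBasis, DirectSum.IsInternal.collectedBasis_coe]
  exact (Module.finBasis ℝ (V i.1) i.2).2

/-- The linear dilations of the Lie algebra, multiplying the `j`-th layer by `r ^ j`. -/
def layerDil (hV : DirectSum.IsInternal V) (r : ℝ) : Model n →L[ℝ] Model n :=
  LinearMap.toContinuousLinearMap
    ((layerBasis hV).constr ℝ fun i => r ^ i.1 • layerBasis hV i)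

lemma layerDil_layerBasis (hV : DirectSum.IsInternal V) (r : ℝ)
    (i : Σ j, Fin (Module.finrank ℝ (V j))) :
    layerDil hV r (layerBasis hV i) = r ^ i.1 • layerBasis hV i :=
  (layerBasis hV).constr_basis ℝ _ i

lemma layerDil_of_mem (hV : DirectSum.IsInternal V) (r : ℝ) {j : ℕ} {v : Model n} (hv : v ∈ V j) :
    layerDil hV r v = r ^ j • v := by
  have h1 : ∀ a, layerDil hV r (Module.finBasis ℝ (V j) a : Model n) =
      r ^ j • (Module.finBasis ℝ (V j) a : Model n) := fun a => by
    have := layerDil_layerBasis hV r ⟨j, a⟩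
    rwa [layerBasis, DirectSum.IsInternal.collectedBasis_coe] at this
  generalize layerDil hV r = T at h1 ⊢
  have h2 : (T : Model n →ₗ[ℝ] Model n) ∘ₗ (V j).subtype = r ^ j • (V j).subtype :=
    (Module.finBasis ℝ (V j)).ext fun a => h1 a
  exact DFunLike.congr_fun h2 ⟨v, hv⟩

lemma layer_ne_bot {j : ℕ} (a : Fin (Module.finrank ℝ (V j))) : V j ≠ ⊥ := fun h => by
  have h1 : Module.finrank ℝ (V j) = 0 := by rw [h, finrank_bot]
  exact absurd a.2 (by omega)

/-- The basis assembled from the layers, with weight `j` on the `j`-th layer, is graded. -/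
lemma isGradedBasis_layerBasis (hS : IsStratified n G V) (hV : DirectSum.IsInternal V)
    (h1 : ∀ j, ∀ x ∈ V 1, ∀ y ∈ V j, ad n G x y ∈ V (j + 1))
    [Fintype (Σ j, Fin (Module.finrank ℝ (V j)))] :
    IsGradedBasis G (V 1) (layerBasis hV) Sigma.fst (layerDil hV) where
  one_le i := by
    obtain ⟨j, a⟩ := i
    rcases Nat.eq_zero_or_pos j with rfl | hj
    · exact absurd hS.zero_layer (layer_ne_bot a)
    · exact hj
  map_basis r i := layerDil_layerBasis hV r i
  map_horizontal r u hu := by rw [layerDil_of_mem hV r hu, pow_one]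
  comp_ad r i := by
    refine ContinuousLinearMap.coe_injective ((layerBasis hV).ext fun i' => ?_)
    show layerDil hV r (ad n G (layerBasis hV i) (layerBasis hV i')) =
      r ^ i.1 • ad n G (layerBasis hV i) (layerDil hV r (layerBasis hV i'))
    rw [layerDil_of_mem hV r
      (hS.ad_mem h1 i.1 i'.1 _ (layerBasis_mem hV i) _ (layerBasis_mem hV i')), layerDil_layerBasis,
      map_smul, smul_smul, pow_add]

/-- The sum of the weights of the basis is the homogeneous dimension. -/
lemma sum_layer_weights {d : ℕ} (h0 : V 0 = ⊥) (hd : ∀ j, d < j → V j = ⊥)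
    [Fintype (Σ j, Fin (Module.finrank ℝ (V j)))] :
    ∑ i : (Σ j, Fin (Module.finrank ℝ (V j))), i.1 =
      ∑ j ∈ Finset.Icc 1 d, j * Module.finrank ℝ (V j) := by
  have h : (Finset.univ : Finset (Σ j, Fin (Module.finrank ℝ (V j)))) =
      (Finset.Icc 1 d).sigma fun _ => Finset.univ := by
    ext ⟨j, a⟩
    simp only [Finset.mem_univ, Finset.mem_sigma, Finset.mem_Icc, and_true, true_iff]
    constructor
    · rcases Nat.eq_zero_or_pos j with rfl | hj
      · exact absurd h0 (layer_ne_bot a)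
      · exact hj
    · exact not_lt.1 fun hj => layer_ne_bot a (hd j hj)
  rw [h, Finset.sum_sigma]
  refine Finset.sum_congr rfl fun j _ => ?_
  simp [mul_comm]

end Grading

/-! ### Euclidean length of horizontal vectors -/

section Euclidean

variable {n : ℕ} {W : Submodule ℝ (Model n)} {B : LinearMap.BilinForm ℝ W}

/-- The norm of a positive definite form on the horizontal layer. -/
lemma isLength_sqrt (hB : ∀ v, v ≠ 0 → 0 < B v v) : IsLength fun v : W => √(B v v) := by
  have hc : Continuous fun v : W => √(B v v) := by
    refine Real.continuous_sqrt.comp ?_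
    have h1 : Continuous fun v : W => (LinearMap.toContinuousLinearMap (B v) : W →L[ℝ] ℝ) :=
      ((LinearMap.toContinuousLinearMap : (W →ₗ[ℝ] ℝ) ≃ₗ[ℝ] W →L[ℝ] ℝ).toLinearMap.comp
        B).continuous_of_finiteDimensional
    exact h1.clm_apply continuous_id
  have hsmul : ∀ (r : ℝ) (v : W), √(B (r • v) (r • v)) = |r| * √(B v v) := fun r v => by
    rw [LinearMap.map_smul₂, map_smul, smul_eq_mul, smul_eq_mul, ← mul_assoc,
      Real.sqrt_mul (mul_self_nonneg r), Real.sqrt_mul_self_eq_abs]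
  have hpos : ∀ v : W, v ≠ 0 → 0 < √(B v v) := fun v hv => Real.sqrt_pos.2 (hB v hv)
  refine ⟨hc, hsmul, ?_⟩
  have hne : ∀ v ∈ Metric.sphere (0 : W) 1, v ≠ 0 := fun v hv => by
    rintro rfl; simp at hv
  obtain ⟨C, hC⟩ := (isCompact_sphere (0 : W) 1).bddAbove_image
    (f := fun v => (√(B v v))⁻¹) (hc.continuousOn.inv₀ fun v hv => (hpos v (hne v hv)).ne')
  refine ⟨max C 1, by positivity, fun v => ?_⟩
  by_cases hv : v = 0
  · subst hv; simp
  · have hn : 0 < ‖v‖ := norm_pos_iff.2 hv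
    have h1 : (√(B (‖v‖⁻¹ • v) (‖v‖⁻¹ • v)))⁻¹ ≤ C := hC ⟨‖v‖⁻¹ • v, by
      rw [mem_sphere_zero_iff_norm, norm_smul, norm_inv, norm_norm, inv_mul_cancel₀ hn.ne'], rfl⟩
    rw [hsmul, abs_of_pos (inv_pos.2 hn), mul_inv, inv_inv, ← div_eq_mul_inv,
      div_le_iff₀ (hpos v hv)] at h1
    exact h1.trans (mul_le_mul_of_nonneg_right (le_max_left _ _) (hpos v hv).le)

end Euclidean

/-! ### The Carnot-Carathéodory distance -/

section Distance

variable {n : ℕ} {G : Type*} [TopologicalSpace G] [ChartedSpace (Model n) G] [Group G]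
  {W : Submodule ℝ (Model n)} {p : W → ℝ}

/-- The Carnot-Carathéodory distance as a real number. It is `0` (the infimum of the empty set) for
points which no horizontal curve joins; this does not occur in connected groups, see
`exists_reach`. -/
def ccDist (p : W → ℝ) (g h : G) : ℝ := sInf {L | 0 < L ∧ Reach p g h L}

lemma Reach.max_pos {g h : G} {L : ℝ} (hr : Reach p g h L) : 0 < max L 1 ∧ Reach p g h (max L 1) :=
  ⟨by positivity, hr.mono (le_max_left _ _)⟩

lemma ccDist_lt_iff (hreach : ∀ g h : G, ∃ L, Reach p g h L) {g h : G} {L : ℝ}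
    (hL : 0 < L) : ccDist p g h < L ↔ Reach p g h L := by
  obtain ⟨M, hM⟩ := hreach g h
  have hbdd : BddBelow {L | 0 < L ∧ Reach p g h L} := ⟨0, fun L hL => hL.1.le⟩
  constructor
  · intro h1
    obtain ⟨L', h2, h3⟩ := exists_lt_of_csInf_lt (s := {L | 0 < L ∧ Reach p g h L})
      ⟨_, hM.max_pos⟩ h1
    exact h2.2.mono h3.le
  · intro h1
    obtain ⟨L', h2, h3⟩ := h1.exists_lt
    have h4 : Reach p g h (max L' (L / 2)) := h3.mono (le_max_left _ _)
    exact (csInf_le hbdd ⟨by positivity, h4⟩).trans_lt (max_lt h2 (by linarith))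

lemma ccDist_nonneg (g h : G) : 0 ≤ ccDist p g h := Real.sInf_nonneg fun _ hL => hL.1.le

lemma ccDist_le_iff (hreach : ∀ g h : G, ∃ L, Reach p g h L) {g h : G} {a : ℝ} (ha : 0 ≤ a) :
    ccDist p g h ≤ a ↔ ∀ L > a, Reach p g h L :=
  ⟨fun h1 _ hL => (ccDist_lt_iff hreach (ha.trans_lt hL)).1 (h1.trans_lt hL),
    fun h1 => le_of_forall_gt_imp_ge_of_dense fun L hL =>
      ((ccDist_lt_iff hreach (ha.trans_lt hL)).2 (h1 L hL)).le⟩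

lemma reach_of_ccDist_lt (hreach : ∀ g h : G, ∃ L, Reach p g h L) {g h : G} {L : ℝ}
    (hL : ccDist p g h < L) : Reach p g h L :=
  (ccDist_lt_iff hreach ((ccDist_nonneg g h).trans_lt hL)).1 hL

lemma ccDist_self (hp : IsLength p) (hreach : ∀ g h : G, ∃ L, Reach p g h L) (g : G) :
    ccDist p g g = 0 :=
  le_antisymm ((ccDist_le_iff hreach le_rfl).2 fun _ hL => reach_self hp g hL) (ccDist_nonneg g g)

lemma ccDist_comm (hp : IsLength p) (g h : G) : ccDist p g h = ccDist p h g := by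
  have : ∀ L, Reach p g h L ↔ Reach p h g L := fun L => ⟨fun h => h.symm hp, fun h => h.symm hp⟩
  simp only [ccDist, this]

lemma ccDist_triangle (hp : IsLength p) (hreach : ∀ g h : G, ∃ L, Reach p g h L) (g h k : G) :
    ccDist p g k ≤ ccDist p g h + ccDist p h k := by
  refine (ccDist_le_iff hreach (add_nonneg (ccDist_nonneg _ _) (ccDist_nonneg _ _))).2
    fun L hL => ?_
  set η := (L - (ccDist p g h + ccDist p h k)) / 2 with hη
  have hη0 : 0 < η := by linarith
  have h1 := (reach_of_ccDist_lt hreach (lt_add_of_pos_right (ccDist p g h) hη0)).trans hp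
    (reach_of_ccDist_lt hreach (lt_add_of_pos_right (ccDist p h k) hη0))
  exact h1.mono (by linarith)

variable [LieGroup (𝓡 n) ∞ G]

lemma ccEDist_eq_ofReal_ccDist {B : LinearMap.BilinForm ℝ W} (hpB : ∀ w : W, p w = √(B w w))
    (hp : IsLength p) (hreach : ∀ g h : G, ∃ L, Reach p g h L) (g h : G) :
    ccEDist W B g h = ENNReal.ofReal (ccDist p g h) := by
  have key : ∀ L : ℝ, 0 < L →
      (ccEDist W B g h < ENNReal.ofReal L ↔ ENNReal.ofReal (ccDist p g h) < ENNReal.ofReal L) :=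
    fun L hL => by
      rw [ENNReal.ofReal_lt_ofReal_iff hL, ccDist_lt_iff hreach hL]
      exact ccEDist_lt_iff hpB hp hL
  have hle : ∀ x y : ℝ≥0∞,
      (∀ L : ℝ, 0 < L → x < ENNReal.ofReal L → y < ENNReal.ofReal L) → y ≤ x := by
    refine fun x y hxy => le_of_forall_gt_imp_ge_of_dense fun c hc => ?_
    obtain ⟨L, h1, h2⟩ := ENNReal.lt_iff_exists_nnreal_btwn.1 hc
    have hL : (0 : ℝ) < L := by
      exact_mod_cast (zero_le.trans_lt h1 : (0 : ℝ≥0∞) < L)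
    rw [← ENNReal.ofReal_coe_nnreal] at h1 h2
    exact (hxy L hL h1).le.trans h2.le
  exact le_antisymm (hle _ _ fun L hL => (key L hL).2) (hle _ _ fun L hL => (key L hL).1)

lemma ccDist_mul_left (a g h : G) : ccDist p (a * g) (a * h) = ccDist p g h := by
  have : ∀ L, Reach p (a * g) (a * h) L ↔ Reach p g h L := fun L =>
    ⟨fun h1 => by simpa using h1.const_mul a⁻¹, fun h1 => h1.const_mul a⟩
  simp only [ccDist, this]

lemma eventually_reach_nhds (hchow : ∀ ε > 0, ∀ᶠ g in 𝓝 (1 : G), Reach p 1 g ε) (g : G) {ε : ℝ}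
    (hε : 0 < ε) : ∀ᶠ h in 𝓝 g, Reach p g h ε := by
  have : IsTopologicalGroup G := topologicalGroup_of_lieGroup (𝓡 n) ∞
  have h1 : Tendsto (fun h => g⁻¹ * h) (𝓝 g) (𝓝 1) :=
    (continuous_const_mul g⁻¹).tendsto' _ _ (inv_mul_cancel g)
  filter_upwards [h1.eventually (hchow ε hε)] with h hh
  simpa using hh.const_mul g

lemma isOpen_ccDist_lt (hp : IsLength p) (hreach : ∀ g h : G, ∃ L, Reach p g h L)
    (hchow : ∀ ε > 0, ∀ᶠ g in 𝓝 (1 : G), Reach p 1 g ε) (a : G) (r : ℝ) :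
    IsOpen {g | ccDist p g a < r} := by
  refine isOpen_iff_mem_nhds.2 fun g (hg : ccDist p g a < r) => ?_
  filter_upwards [eventually_reach_nhds hchow g (sub_pos.2 hg)] with h hh
  have h1 := (ccDist_lt_iff hreach (sub_pos.2 hg)).2 hh
  have h2 := ccDist_triangle hp hreach h g a
  rw [ccDist_comm hp h g] at h2
  exact show ccDist p h a < r by linarith

/-- Completeness of the Carnot-Carathéodory distance: a small ball is relatively compact. -/
lemma exists_limit_of_ccDist (hp : IsLength p) (hreach : ∀ g h : G, ∃ L, Reach p g h L)
    (hchow : ∀ ε > 0, ∀ᶠ g in 𝓝 (1 : G), Reach p 1 g ε) {Q : Set G} (hQ : IsCompact Q) {ε₀ : ℝ}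
    (hε₀ : 0 < ε₀) (hball : ∀ g, Reach p 1 g ε₀ → g ∈ Q) (u : ℕ → G)
    (hu : ∀ ε > 0, ∃ N, ∀ m ≥ N, ∀ l ≥ N, ccDist p (u m) (u l) < ε) :
    ∃ a, ∀ ε > 0, ∃ N, ∀ m ≥ N, ccDist p (u m) a < ε := by
  obtain ⟨N, hN⟩ := hu ε₀ hε₀
  have hmem : ∀ m, (u N)⁻¹ * u (N + m) ∈ Q := fun m => by
    refine hball _ ((ccDist_lt_iff hreach hε₀).1 ?_)
    rw [← ccDist_mul_left (u N), mul_one, mul_inv_cancel_left]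
    exact hN _ le_rfl _ (by omega)
  -- A cluster point for the topology of the group is a limit for the distance.
  obtain ⟨v, -, hv⟩ := hQ.exists_mapClusterPt_of_frequently (l := atTop)
    (Eventually.of_forall hmem).frequently
  refine ⟨u N * v, fun ε hε => ?_⟩
  obtain ⟨N', hN'⟩ := hu (ε / 2) (half_pos hε)
  have h1 := (mapClusterPt_iff_frequently.1 hv _
    (eventually_reach_nhds hchow v (half_pos hε))).and_eventually (eventually_ge_atTop N')
  obtain ⟨m, hm, hmN⟩ := h1.exists
  refine ⟨N', fun l hl => ?_⟩
  have h2 : ccDist p (u N * v) (u (N + m)) < ε / 2 := by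
    rw [← ccDist_mul_left (u N)⁻¹, inv_mul_cancel_left]
    exact (ccDist_lt_iff hreach (half_pos hε)).2 hm
  have h3 := hN' l hl (N + m) (by omega)
  have h4 := ccDist_triangle hp hreach (u l) (u (N + m)) (u N * v)
  rw [ccDist_comm hp (u (N + m))] at h4
  linarith

/-- Any two points of a connected group are joined by a horizontal curve: the points which can be
reached from the identity form an open subgroup. -/
lemma exists_reach [PreconnectedSpace G] (hp : IsLength p)
    (hchow : ∀ ε > 0, ∀ᶠ g in 𝓝 (1 : G), Reach p 1 g ε) (g h : G) : ∃ L, Reach p g h L := by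
  have : IsTopologicalGroup G := topologicalGroup_of_lieGroup (𝓡 n) ∞
  let H : Subgroup G :=
    { carrier := {g | ∃ L, Reach p 1 g L}
      mul_mem' := fun ⟨L, h1⟩ ⟨M, h2⟩ => ⟨L + M, h1.mul hp h2⟩
      one_mem' := ⟨1, reach_self hp 1 one_pos⟩
      inv_mem' := fun ⟨L, h1⟩ => ⟨L, h1.inv hp⟩ }
  have ho : IsOpen (H : Set G) := H.isOpen_of_mem_nhds (g := 1) (by
    filter_upwards [hchow 1 one_pos] with x hx
    exact ⟨1, hx⟩)
  have huniv := IsClopen.eq_univ ⟨H.isClosed_of_isOpen ho, ho⟩ ⟨1, H.one_mem⟩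
  obtain ⟨L, hL⟩ : g⁻¹ * h ∈ (H : Set G) := by rw [huniv]; trivial
  have := hL.const_mul g
  rw [mul_one, mul_inv_cancel_left] at this
  exact ⟨L, this⟩

end Distance

/-! ### Existence of the Lipschitz map -/

section Main

variable {n : ℕ} {G : Type*} [TopologicalSpace G] [T2Space G] [ChartedSpace (Model n) G] [Group G]
  [LieGroup (𝓡 n) ∞ G] {V : ℕ → Submodule ℝ (Model n)} {p : V 1 → ℝ}

/-- The Lipschitz map for the real-valued distance: the group is complete and has large separated
sets. -/
lemma exists_lipschitz_ccDist [PreconnectedSpace G] (hS : IsStratified n G V)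
    (hV : DirectSum.IsInternal V) (h1 : ∀ j, ∀ x ∈ V 1, ∀ y ∈ V j, ad n G x y ∈ V (j + 1))
    (hp : IsLength p) {d : ℕ} (hd : ∀ j, d < j → V j = ⊥) {k : ℕ}
    (hk : k = ∑ j ∈ Finset.Icc 1 d, j * Module.finrank ℝ (V j)) :
    ∃ (L : ℝ≥0) (f : G → EuclideanSpace ℝ (Fin k)),
      (∀ x y, dist (f x) (f y) ≤ L * ccDist p x y) ∧
      dimH (f '' {g | ccDist p g 1 < 1}) = k := by
  have := FiniteDimensional.fintypeBasisIndex (layerBasis hV)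
  have hchow : ∀ ε > 0, ∀ᶠ g in 𝓝 (1 : G), Reach p 1 g ε := fun ε hε => eventually_reach hS hp hε
  have hreach := exists_reach hp hchow
  have hD := isGradedBasis_layerBasis hS hV h1
  choose c hc using fun i => exists_isOneParam (G := G) (layerBasis hV i)
  obtain ⟨lg, N, r, C, K, hL⟩ := exists_isLogBox (G := G) hD.one_le hc
  obtain ⟨ε, _, hε, -, -, hbb⟩ := hL.exists_ballBox hD hc hp hchow
  obtain ⟨a, ρ₀, ha, hρ₀, hsep⟩ := hL.exists_separated hD hc hp hchow
  have hQ : IsCompact (expProd c '' box Sigma.fst (1 * r)) :=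
    (isCompact_box _).image (continuous_curveProd hc _)
  rw [sum_layer_weights hS.zero_layer hd, ← hk] at hsep
  refine exists_lipschitz_dimH_eq_of_dist (ccDist p) (ccDist_self hp hreach) (ccDist_comm hp)
    (ccDist_triangle hp hreach) ccDist_mul_left
    (exists_limit_of_ccDist hp hreach hchow hQ (ε₀ := 1 * ε) (by rwa [one_mul])
      (hbb 1 one_pos le_rfl).1) ha hρ₀ fun ρ σ hσ hσρ hρ M hM => ?_
  obtain ⟨S, hS1, hS2, hS3⟩ := hsep ρ σ hσ hσρ hρ M hM
  exact ⟨S, hS1, fun g hg => ((ccDist_lt_iff hreach (hσ.trans_le hσρ)).2 (hS2 g hg)).le,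
    fun g hg h hh hgh => not_lt.1 fun hlt => hS3 g hg h hh hgh ((ccDist_lt_iff hreach hσ).1 hlt)⟩

/-- The theorem for layers and a Euclidean metric given on the model space. -/
lemma exists_lipschitz_ccEDist [PreconnectedSpace G] (hS : IsStratified n G V)
    (hV : DirectSum.IsInternal V) (h1 : ∀ j, ∀ x ∈ V 1, ∀ y ∈ V j, ad n G x y ∈ V (j + 1))
    {B : LinearMap.BilinForm ℝ (V 1)} (hB : ∀ v, v ≠ 0 → 0 < B v v)
    {d : ℕ} (hd : ∀ j, d < j → V j = ⊥) {k : ℕ}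
    (hk : k = ∑ j ∈ Finset.Icc 1 d, j * Module.finrank ℝ (V j)) :
    ∃ U : Set G, U.Nonempty ∧ IsOpen U ∧
      (∃ R : ℝ≥0, ∀ x ∈ U, ∀ y ∈ U, ccEDist (V 1) B x y ≤ R) ∧
      ∃ F : U → EuclideanSpace ℝ (Fin k),
        (∃ L : ℝ≥0, ∀ x y : U, edist (F x) (F y) ≤ L * ccEDist (V 1) B (x : G) (y : G)) ∧
        dimH (Set.range F) = k := by
  have hp := isLength_sqrt hB
  have hchow : ∀ ε > 0, ∀ᶠ g in 𝓝 (1 : G), Reach (fun v : V 1 => √(B v v)) 1 g ε :=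
    fun ε hε => eventually_reach hS hp hε
  have hreach := exists_reach hp hchow
  have heq := ccEDist_eq_ofReal_ccDist (fun _ => rfl) hp hreach
  obtain ⟨L, f, hf, hdim⟩ := exists_lipschitz_ccDist hS hV h1 hp hd hk
  refine ⟨{g | ccDist (fun v : V 1 => √(B v v)) g 1 < 1}, ⟨1, ?_⟩,
    isOpen_ccDist_lt hp hreach hchow 1 1, ⟨2, fun x hx y hy => ?_⟩, fun x => f x,
    ⟨L, fun x y => ?_⟩, ?_⟩
  · exact (ccDist_self hp hreach 1).trans_lt one_pos
  · have h2 := ccDist_triangle hp hreach x 1 y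
    rw [ccDist_comm hp 1 y] at h2
    have hx' : ccDist (fun v : V 1 => √(B v v)) x 1 < 1 := hx
    have hy' : ccDist (fun v : V 1 => √(B v v)) y 1 < 1 := hy
    refine (heq x y).le.trans ?_
    rw [← ENNReal.ofReal_coe_nnreal]
    exact ENNReal.ofReal_le_ofReal (by push_cast; linarith)
  · rw [edist_dist]
    have h2 : ENNReal.ofReal (L * ccDist (fun v : V 1 => √(B v v)) (x : G) y) =
        L * ENNReal.ofReal (ccDist (fun v : V 1 => √(B v v)) (x : G) y) := by
      rw [ENNReal.ofReal_mul L.coe_nonneg, ENNReal.ofReal_coe_nnreal]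
    refine (ENNReal.ofReal_le_ofReal (hf x y)).trans (h2.le.trans ?_)
    exact mul_le_mul_right (heq x y).ge _
  · rw [← hdim, image_eq_range]

end Main

end Carnot

end

theorem corollary3p3 {n : ℕ} {G : Type*} [TopologicalSpace G] [T2Space G]
    [ChartedSpace (EuclideanSpace ℝ (Fin n)) G] [Group G] [LieGroup (𝓡 n) ∞ G]
    (V : ℕ → Submodule ℝ (GroupLieAlgebra (𝓡 n) G)) (d : ℕ)
    (hG : Carnot.IsCarnot V d) (hrat : Carnot.IsRationalizable V d)
    (B : LinearMap.BilinForm ℝ (V 1)) (hBsymm : ∀ v w, B v w = B w v)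
    (hBpos : ∀ v, v ≠ 0 → 0 < B v v)
    (k : ℕ) (hk : k = Carnot.homogeneousDim V d) :
    ∃ U : Set G, U.Nonempty ∧ IsOpen U ∧
      (∃ R : ℝ≥0, ∀ x ∈ U, ∀ y ∈ U, Carnot.ccEDist (V 1) B x y ≤ R) ∧
      ∃ F : U → EuclideanSpace ℝ (Fin k),
        (∃ L : ℝ≥0, ∀ x y : U, edist (F x) (F y) ≤ L * Carnot.ccEDist (V 1) B x y) ∧
        dimH (Set.range F) = k := by
  have := hG.simplyConnected
  have hle : ∀ j, 1 ≤ j → V (j + 1) ≤ Submodule.span ℝ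
      {z : GroupLieAlgebra (𝓡 n) G | ∃ x ∈ V 1, ∃ y ∈ V j, ⁅x, y⁆ = z} := fun j hj => by
    by_cases hjd : j ≤ d
    · exact (hG.bracket j hj hjd).ge
    · rw [hG.high_layer (j + 1) (by omega)]; exact bot_le
  have hS : Carnot.IsStratified n G V := by
    refine ⟨hG.zero_layer, hG.directSum.submodule_iSup_eq_top, fun j hj => ?_⟩
    refine le_trans (hle j hj) (Submodule.span_mono ?_)
    rintro z ⟨x, hx, y, hy, hz⟩
    exact ⟨x, hx, y, hy, (Carnot.lie_eq_ad x y).symm.trans hz⟩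
  have h1 : ∀ j, ∀ x ∈ V 1, ∀ y ∈ V j, ⁅x, y⁆ ∈ V (j + 1) := by
    intro j x hx y hy
    by_cases hj : 1 ≤ j ∧ j ≤ d
    · rw [← hG.bracket j hj.1 hj.2]
      exact Submodule.subset_span ⟨x, hx, y, hy, rfl⟩
    · have hVj : V j = ⊥ := by
        rcases Nat.eq_zero_or_pos j with rfl | h
        · exact hG.zero_layer
        · exact hG.high_layer j (by omega)
      have hy0 : y = 0 := by rw [hVj] at hy; exact (Submodule.mem_bot ℝ).1 hy
      have h2 : ⁅x, y⁆ = 0 := by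
        rw [hy0]
        exact (Carnot.lie_eq_ad x 0).trans (map_zero (Carnot.ad n G x))
      rw [h2]
      exact Submodule.zero_mem _
  exact Carnot.exists_lipschitz_ccEDist (G := G) hS hG.directSum
    (fun j x hx y hy => (congrArg (fun z : Carnot.Model n => z ∈ V (j + 1))
      (Carnot.lie_eq_ad x y)).mp (h1 j x hx y hy)) hBpos hG.high_layer hk
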